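/- **Proposition (a supertranslational Killing field implies absence of radiation).** Let $(\mathcal M,g)$ be a vacuum spacetime (signature $(+,-,-,-)$) that is asymptotically flat at null infinity $\mathscr I\simeq J\times S^2$, where $J\subseteq\mathbb R$ is the open set of retarded times ($J=\mathbb R$ if $\mathscr I$ is complete). This means: near $\mathscr I$ there are coordinates $(u,r,x)$, $u\in J$, $x\in S^2$, such that $l^\mu=(\partial_r)^\mu$ satisfies $l_\mu=\nabla_\mu u$ (so the hypersurfaces $u=\text{const}$ are null, and $r$ is an affine parameter of their generators, along which $x$ is constant). Moreover, with $y=rx\in\mathbb R^3$, the components of $g-\big((du+dr)^2-|dy|^2\big)$ in the coordinates $(u,y)$ are smooth and have expansions $$\sum_{k\ge 1}\sum_{j=0}^{N_k} f_{kj}(u,x)\,r^{-k}\ln^j r ,\qquad f_{kj}\in C^\infty(J\times S^2),$$ asymptotic as $r\to\infty$ and differentiable term by term to all orders. Let $m^\mu$ denote the complex null vector tangent to the surfaces $u,r=\text{const}$ with $g(m,\overline m)=-1$ (unique up to spin and conjugation). Assume that $\Psi_0=C_{\mu\nu\lambda\chi}l^\mu m^\nu l^\lambda m^\chi=O(r^{-4}\ln^{N}r)$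 for some $N$, and that the origin of $r$ is chosen such that $\rho=m^\mu\overline m^\nu\nabla_\nu l_\mu=-1/r+o(r^{-2})$. The case without logarithms is included. Suppose that $(\mathcal M,g)$ admits a supertranslational Killing vector field near $\mathscr I$, i.e. a smooth Killing field $\xi$ whose components in the coordinates $(u,y)$ have such polyhomogeneous expansions, now starting at the order $r^{1}$, and whose asymptotic form in the coordinates $(u,r,x)$ is $(\alpha(x),0,0,0)$ with $\alpha$ not identically zero: $\xi^u\to\alpha(x)$, $\xi^r/r\to0$, and the components tangent to $S^2$ tend to $0$. Then the spacetime is non-radiative. Namely, for every choice of $m^\mu$ whose rescaled limit $\lim_{r\to\infty} r\,m^\mu$ at $\mathscr I$ does not depend on $u$, the shear $\sigma=m^\mu m^\nu\nabla_\nu l_\mu$ has the form $\sigma=\sigma_{2,0}(u,x)\,r^{-2}+o(r^{-2})$, and the news function $\dot\sigma_{2,0}=\partial_u\sigma_{2,0}$ exists and vanishes for all retarded times $u\in J$. No axial symmetry is assumed. -/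

import Mathlib

/-!
Vacuum spacetimes near null infinity, in Newman-Unti (affine Bondi) coordinates.

A neighbourhood of null infinity `J × S²` is covered by the points `(u, r, x)` with `u` the retarded
time, `r` the affine parameter and `x` on the unit sphere. Writing `y = r x`, it becomes an open
subset of `ℝ⁴` with the global coordinates `(u, y¹, y², y³)`, so that no angular chart is needed.
Tensors are given by their components in these coordinates; the signature is `(+,-,-,-)`.
-/

open Filter Topology Asymptotics
open scoped ContDiff ComplexConjugate

noncomputable section

namespace NullInfinity

/-- Coordinates `(u, y¹, y², y³)`. -/
abbrev Pt : Type := Fin 4 → ℝ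

/-- The unit sphere of directions. -/
abbrev S2 : Type := Metric.sphere (0 : EuclideanSpace ℝ (Fin 3)) 1

/-- The affine parameter `r = |y|`. -/
def radius (p : Pt) : ℝ := √(∑ i : Fin 3, p i.succ ^ 2)

/-- The point with retarded time `u`, affine parameter `r` and direction `x`. -/
def pt (u r : ℝ) (x : S2) : Pt := Fin.cons u (fun i : Fin 3 => r * x.1 i)

/-- The dilation `(u, y) ↦ (u, t y)`, which moves points along the generators `∂_r`. -/
def dilate (t : ℝ) (p : Pt) : Pt := Fin.cons (p 0) (fun i : Fin 3 => t * p i.succ)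

/-- `u → u₀` and `r → ∞`, uniformly in the direction. -/
def nearScri (u₀ : ℝ) : Filter Pt :=
  comap (fun p : Pt => p 0) (𝓝 u₀) ⊓ comap radius atTop

/-- Coordinate partial derivative. -/
def pd (a : Fin 4) (f : Pt → ℝ) (p : Pt) : ℝ := fderiv ℝ f p (Pi.single a 1)

/-! ### Polyhomogeneous functions -/

/-- A smooth function on null infinity `J × S²`, regarded as a function on the spacetime that does
not depend on `r`. -/
def IsScriFunction (J : Set ℝ) (c : Pt → ℝ) : Prop :=
  ContDiffOn ℝ ∞ c {p | p 0 ∈ J ∧ 0 < radius p} ∧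
    ∀ (t : ℝ) (p : Pt), 0 < t → c (dilate t p) = c p

/-- `f ∼ ∑_{k ≥ 0} ∑_{j ≤ N k} c k j (u, x) r ^ (d - k) (log r) ^ j`: an asymptotic expansion at null
infinity that may be differentiated term by term any number of times. -/
def IsPolyhom (J : Set ℝ) (d : ℤ) (f : Pt → ℝ) : Prop :=
  ∃ (N : ℕ → ℕ) (c : ℕ → ℕ → Pt → ℝ),
    (∀ k j, IsScriFunction J (c k j)) ∧
    ∀ (K n : ℕ), ∀ u₀ ∈ J,
      (fun p => iteratedFDeriv ℝ n
        (fun q => f q - ∑ k ∈ Finset.range (K + 1), ∑ j ∈ Finset.range (N k + 1),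
          c k j q * Real.log (radius q) ^ j * radius q ^ (d - (k : ℤ))) p)
        =O[nearScri u₀] (fun p => radius p ^ (d - (K : ℤ)))

/-! ### Curvature and Killing fields of a metric given by its components -/

/-- A field of (symmetric) matrices `g_ab`. -/
abbrev MetricField : Type := Pt → Matrix (Fin 4) (Fin 4) ℝ

/-- Symmetric of signature `(+,-,-,-)`. -/
def IsLorentzian (G : Matrix (Fin 4) (Fin 4) ℝ) : Prop :=
  G.IsSymm ∧ ∃ A : Matrix (Fin 4) (Fin 4) ℝ,
    IsUnit A.det ∧ A.transpose * G * A = Matrix.diagonal ![1, -1, -1, -1]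

/-- Christoffel symbols `Γ^c_ab`. -/
def christoffel (g : MetricField) (c a b : Fin 4) (p : Pt) : ℝ :=
  (1 / 2) * ∑ d, (g p)⁻¹ c d *
    (pd a (fun q => g q d b) p + pd b (fun q => g q d a) p - pd d (fun q => g q a b) p)

/-- `R^a_bcd = ∂_c Γ^a_db - ∂_d Γ^a_cb + Γ^a_ce Γ^e_db - Γ^a_de Γ^e_cb`. -/
def riemann (g : MetricField) (a b c d : Fin 4) (p : Pt) : ℝ :=
  pd c (christoffel g a d b) p - pd d (christoffel g a c b) p
    + ∑ e, (christoffel g a c e p * christoffel g e d b p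
        - christoffel g a d e p * christoffel g e c b p)

/-- `R_abcd`. -/
def riemannLow (g : MetricField) (a b c d : Fin 4) (p : Pt) : ℝ :=
  ∑ e, g p a e * riemann g e b c d p

/-- `R_bd = R^a_bad`. -/
def ricci (g : MetricField) (b d : Fin 4) (p : Pt) : ℝ :=
  ∑ a, riemann g a b a d p

/-- `(𝓛_ξ g)_ab`. -/
def lieMetric (g : MetricField) (ξ : Pt → Fin 4 → ℝ) (a b : Fin 4) (p : Pt) : ℝ :=
  ∑ c, (ξ p c * pd c (fun q => g q a b) p
    + g p c b * pd a (fun q => ξ q c) p + g p a c * pd b (fun q => ξ q c) p)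

/-- A smooth Killing vector field on `D`. -/
def IsKilling (D : Set Pt) (g : MetricField) (ξ : Pt → Fin 4 → ℝ) : Prop :=
  (∀ a, ContDiffOn ℝ ∞ (fun p => ξ p a) D) ∧ ∀ p ∈ D, ∀ a b, lieMetric g ξ a b p = 0

/-! ### The null tetrad -/

/-- `l = ∂_r`, the tangent of the generators of the hypersurfaces `u = const`. -/
def lVec (p : Pt) : Fin 4 → ℝ := Fin.cons 0 (fun i : Fin 3 => p i.succ / radius p)

/-- `l_a = g_ab l^b`. -/
def lForm (g : MetricField) (p : Pt) (a : Fin 4) : ℝ := ∑ b, g p a b * lVec p b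

/-- `∇_b l_a`. -/
def nablaL (g : MetricField) (b a : Fin 4) (p : Pt) : ℝ :=
  pd b (fun q => lForm g q a) p - ∑ c, christoffel g c b a p * lForm g p c

/-- `m` is the complex leg of a null tetrad at `p`: it is tangent to the surface `u, r = const`,
null, and `g(m, m̄) = -1`. It is determined up to a spin `m ↦ e^{iϑ} m` and conjugation. -/
structure IsLegM (g : MetricField) (p : Pt) (m : Fin 4 → ℂ) : Prop where
  tangent_u : m 0 = 0
  tangent_r : ∑ i : Fin 3, (p i.succ : ℂ) * m i.succ = 0
  null : ∑ a, ∑ b, (g p a b : ℂ) * m a * m b = 0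
  norm : ∑ a, ∑ b, (g p a b : ℂ) * m a * conj (m b) = -1

/-- The spin coefficient `ρ = m^a m̄^b ∇_b l_a`. -/
def rho (g : MetricField) (p : Pt) (m : Fin 4 → ℂ) : ℂ :=
  ∑ a, ∑ b, (nablaL g b a p : ℂ) * m a * conj (m b)

/-- The shear `σ = m^a m^b ∇_b l_a`. -/
def shear (g : MetricField) (p : Pt) (m : Fin 4 → ℂ) : ℂ :=
  ∑ a, ∑ b, (nablaL g b a p : ℂ) * m a * m b

/-- `Ψ₀ = C_abcd l^a m^b l^c m^d`. In this contraction the Weyl and the Riemann tensor agree, since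
`g(l,l) = g(l,m) = g(m,m) = 0`. -/
def psi0 (g : MetricField) (p : Pt) (m : Fin 4 → ℂ) : ℂ :=
  ∑ a, ∑ b, ∑ c, ∑ d, (riemannLow g a b c d p : ℂ) * lVec p a * m b * lVec p c * m d

/-! ### Asymptotically flat spacetimes -/

/-- The Minkowski metric `du² + 2 du dr - r² (round metric) = (du + dr)² - |dy|²`. -/
def minkowski : MetricField := fun p a b =>
  let w : Fin 4 → ℝ := Fin.cons 1 (fun i : Fin 3 => p i.succ / radius p)
  w a * w b - (if a = b ∧ a ≠ 0 then 1 else 0)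

/-- An asymptotically flat vacuum spacetime, defined on a neighbourhood `D` of null infinity `J × S²`
and polyhomogeneous there. Smooth null infinity is the case without logarithms. -/
structure IsAsymptoticallyFlat (J : Set ℝ) (D : Set Pt) (g : MetricField) : Prop where
  isOpen_J : IsOpen J
  isOpen_D : IsOpen D
  D_subset : ∀ p ∈ D, p 0 ∈ J ∧ 0 < radius p
  D_nhds : ∀ u₀ ∈ J, D ∈ nearScri u₀
  smooth : ∀ a b, ContDiffOn ℝ ∞ (fun p => g p a b) D
  lorentzian : ∀ p ∈ D, IsLorentzian (g p)
  vacuum : ∀ p ∈ D, ∀ a b, ricci g a b p = 0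
  /-- `l_a = ∇_a u`: the hypersurfaces `u = const` are null, `r` is an affine parameter on their
  generators and the angular coordinates are constant along them. -/
  gauge : ∀ p ∈ D, ∀ a, lForm g p a = if a = 0 then 1 else 0
  /-- In the coordinates `(u, y)` the metric is `minkowski` plus a polyhomogeneous series that
  starts at the order `1 / r`. -/
  polyhom : ∀ a b, IsPolyhom J (-1) (fun p => g p a b - minkowski p a b)
  /-- The origin of `r` is chosen such that `ρ = -1 / r + o(r⁻²)`. -/
  origin : ∀ u₀ ∈ J, ∀ ε > 0, ∀ᶠ p in nearScri u₀, ∀ m, IsLegM g p m →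
    ‖rho g p m + 1 / (radius p : ℂ)‖ ≤ ε * radius p ^ (-2 : ℤ)
  /-- `Ψ₀ = O(r⁻⁴ (log r) ^ N)`. -/
  psi0_decay : ∃ N : ℕ, ∀ u₀ ∈ J, ∃ C : ℝ, ∀ᶠ p in nearScri u₀, ∀ m, IsLegM g p m →
    ‖psi0 g p m‖ ≤ C * (radius p ^ (-4 : ℤ) * Real.log (radius p) ^ N)

/-- The vector field is polyhomogeneous and its asymptotic form, in the coordinates `(u, r, x)`, is
`(α(x), 0, 0, 0)` with `α` not identically zero: `ξ^u → α`, `ξ^r / r → 0`, and the components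
tangent to the sphere tend to `0`. The last two are `ξ^i / r → 0` for the components along `y`. -/
def IsSupertranslational (J : Set ℝ) (ξ : Pt → Fin 4 → ℝ) : Prop :=
  (∀ a, IsPolyhom J 1 (fun p => ξ p a)) ∧
  ∃ α : S2 → ℝ, (∃ x, α x ≠ 0) ∧
    ∀ u ∈ J, ∀ x : S2,
      Tendsto (fun r => ξ (pt u r x) 0) atTop (𝓝 (α x)) ∧
      ∀ i : Fin 3, Tendsto (fun r => ξ (pt u r x) i.succ / r) atTop (𝓝 0)

/-- `m` is the complex leg of a null tetrad near the part `J × W` of null infinity, and its rescaled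
limit `μ` at null infinity does not depend on `u`. (`r ξ^i ∂_i` in the coordinates `x` is
`m` in the coordinates `y`.) -/
def IsTetradFrame (J : Set ℝ) (g : MetricField) (W : Set S2) (m : Pt → Fin 4 → ℂ)
    (μ : S2 → Fin 4 → ℂ) : Prop :=
  ∀ u ∈ J, ∀ x ∈ W,
    (∀ᶠ r in atTop, IsLegM g (pt u r x) (m (pt u r x))) ∧
    Tendsto (fun r => m (pt u r x)) atTop (𝓝 (μ x))

/-- `σ = σ₂₀(u, x) r⁻² + o(r⁻²)` along the generators over `W`. -/
def IsLeadingShear (J : Set ℝ) (g : MetricField) (W : Set S2) (m : Pt → Fin 4 → ℂ)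
    (σ₂₀ : ℝ → S2 → ℂ) : Prop :=
  ∀ u ∈ J, ∀ x ∈ W,
    Tendsto (fun r : ℝ => (r : ℂ) ^ 2 * shear g (pt u r x) (m (pt u r x))) atTop (𝓝 (σ₂₀ u x))

/-- In every null tetrad frame, the leading coefficient of the shear exists and its derivative in
`u`, the news function, exists and vanishes. -/
def IsNonRadiative (J : Set ℝ) (g : MetricField) : Prop :=
  ∀ (W : Set S2) (m : Pt → Fin 4 → ℂ) (μ : S2 → Fin 4 → ℂ), IsTetradFrame J g W m μ →
    ∃ σ₂₀ : ℝ → S2 → ℂ, IsLeadingShear J g W m σ₂₀ ∧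
      ∀ u ∈ J, ∀ x ∈ W, HasDerivAt (fun s => σ₂₀ s x) 0 u

end NullInfinity

end

noncomputable section

namespace NullInfinity

/-! ### Neighbourhoods of null infinity -/

/-- The cylinder over `J × S²` on which functions on null infinity are smooth. -/
def region (J : Set ℝ) : Set Pt := {p | p 0 ∈ J ∧ 0 < radius p}

theorem continuous_radius : Continuous radius := by
  unfold radius; fun_prop

theorem isOpen_region {J : Set ℝ} (hJ : IsOpen J) : IsOpen (region J) :=
  (hJ.preimage (continuous_apply 0)).inter (isOpen_lt continuous_const continuous_radius)

theorem radius_nonneg (p : Pt) : 0 ≤ radius p := Real.sqrt_nonneg _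

theorem radius_sq (p : Pt) : radius p ^ 2 = ∑ i : Fin 3, p i.succ ^ 2 :=
  Real.sq_sqrt (Finset.sum_nonneg fun _ _ => sq_nonneg _)

@[simp] theorem dilate_zero (t : ℝ) (p : Pt) : dilate t p 0 = p 0 := rfl

@[simp] theorem dilate_succ (t : ℝ) (p : Pt) (i : Fin 3) : dilate t p i.succ = t * p i.succ := rfl

@[simp] theorem pt_zero (u r : ℝ) (x : S2) : pt u r x 0 = u := rfl

@[simp] theorem pt_succ (u r : ℝ) (x : S2) (i : Fin 3) : pt u r x i.succ = r * x.1 i := rfl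

theorem radius_dilate {t : ℝ} (ht : 0 ≤ t) (p : Pt) : radius (dilate t p) = t * radius p := by
  simp only [radius, dilate_succ, mul_pow, ← Finset.mul_sum]
  rw [Real.sqrt_mul (sq_nonneg t), Real.sqrt_sq ht]

theorem sphere_sum_sq (x : S2) : ∑ i : Fin 3, x.1 i ^ 2 = 1 := by
  have h := x.2
  rw [mem_sphere_zero_iff_norm, EuclideanSpace.norm_eq] at h
  simpa using (Real.sqrt_eq_one.mp h)

theorem radius_pt {r : ℝ} (hr : 0 ≤ r) (u : ℝ) (x : S2) : radius (pt u r x) = r := by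
  simp only [radius, pt_succ, mul_pow, ← Finset.mul_sum, sphere_sum_sq, mul_one]
  exact Real.sqrt_sq hr

theorem dilate_pt (t u r : ℝ) (x : S2) : dilate t (pt u r x) = pt u (t * r) x := by
  ext a
  refine Fin.cases rfl (fun i => ?_) a
  simp [mul_assoc]

theorem eventually_nearScri {u₀ : ℝ} {P : Pt → Prop} :
    (∀ᶠ p in nearScri u₀, P p) ↔
      ∃ δ > 0, ∃ R : ℝ, ∀ p : Pt, |p 0 - u₀| < δ → R < radius p → P p := by
  have h1 := (Metric.nhds_basis_ball (x := u₀)).comap (fun p : Pt => p 0)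
  have h2 := (atTop_basis_Ioi (α := ℝ)).comap radius
  rw [nearScri, (h1.inf h2).eventually_iff]
  constructor
  · rintro ⟨⟨δ, R⟩, h, H⟩
    refine ⟨δ, h.1, R, fun p hp hr => H ⟨?_, ?_⟩⟩
    · simpa [Real.dist_eq] using hp
    · simpa using hr
  · rintro ⟨δ, hδ, R, H⟩
    refine ⟨⟨δ, R⟩, ⟨hδ, trivial⟩, fun p hp => H p ?_ ?_⟩
    · simpa [Real.dist_eq] using hp.1
    · simpa using hp.2

/-- The basic sets |u - u₀| < δ, r > R are open. Hence relations that hold near null infinity may be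
differentiated (`pd_congr_nearScri`). -/
theorem eventually_eventually_nhds {u₀ : ℝ} {P : Pt → Prop} (h : ∀ᶠ p in nearScri u₀, P p) :
    ∀ᶠ p in nearScri u₀, ∀ᶠ q in 𝓝 p, P q := by
  obtain ⟨δ, hδ, R, H⟩ := eventually_nearScri.1 h
  refine eventually_nearScri.2 ⟨δ, hδ, R, fun p hp hr => ?_⟩
  have h0 : Continuous fun q : Pt => |q 0 - u₀| := by fun_prop
  filter_upwards [h0.continuousAt.eventually (gt_mem_nhds hp),
    continuous_radius.continuousAt.eventually (lt_mem_nhds hr)] with q h1 h2 using H q h1 h2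

theorem eventually_radius_gt (u₀ R : ℝ) : ∀ᶠ p in nearScri u₀, R < radius p :=
  eventually_nearScri.2 ⟨1, one_pos, R, fun _ _ h => h⟩

theorem tendsto_radius (u₀ : ℝ) : Tendsto radius (nearScri u₀) atTop :=
  tendsto_comap.mono_left inf_le_right

theorem eventually_mem_region {J : Set ℝ} (hJ : IsOpen J) {u₀ : ℝ} (hu : u₀ ∈ J) :
    ∀ᶠ p in nearScri u₀, p ∈ region J := by
  obtain ⟨δ, hδ, H⟩ := Metric.isOpen_iff.1 hJ u₀ hu
  exact eventually_nearScri.2 ⟨δ, hδ, 0, fun p hp hr => ⟨H (by simpa [Real.dist_eq] using hp), hr⟩⟩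

theorem tendsto_dilate {p : Pt} (hp : 0 < radius p) :
    Tendsto (fun t => dilate t p) atTop (nearScri (p 0)) := by
  intro s hs
  obtain ⟨δ, hδ, R, H⟩ := eventually_nearScri.1 (show ∀ᶠ q in nearScri (p 0), q ∈ s from hs)
  rw [mem_map]
  filter_upwards [eventually_ge_atTop 0, eventually_gt_atTop (R / radius p)] with t h0 ht
  refine H _ (by simpa using hδ) ?_
  rw [radius_dilate h0]
  rwa [div_lt_iff₀ hp] at ht

theorem tendsto_pt (u : ℝ) (x : S2) : Tendsto (fun r => pt u r x) atTop (nearScri u) := by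
  have h := tendsto_dilate (p := pt u 1 x) (by rw [radius_pt zero_le_one]; exact one_pos)
  simpa [dilate_pt] using h

/-- The direction of a point. -/
def direction (p : Pt) (hp : 0 < radius p) : S2 :=
  ⟨WithLp.toLp 2 fun i => p i.succ / radius p, by
    rw [mem_sphere_zero_iff_norm, EuclideanSpace.norm_eq]
    simp only [norm_div, Real.norm_eq_abs, div_pow, sq_abs, ← Finset.sum_div]
    rw [← radius_sq, div_self (by positivity), Real.sqrt_one]⟩

theorem pt_direction (p : Pt) (hp : 0 < radius p) :
    pt (p 0) (radius p) (direction p hp) = p := by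
  ext a
  refine Fin.cases rfl (fun i => ?_) a
  simp only [pt_succ, direction]
  field_simp

/-! ### Coordinate derivatives -/

theorem pd_congr {F G : Pt → ℝ} {p : Pt} (h : F =ᶠ[𝓝 p] G) (a : Fin 4) : pd a F p = pd a G p := by
  rw [pd, h.fderiv_eq, pd]

theorem pd_congr_nearScri {u₀ : ℝ} {F G : Pt → ℝ} (h : F =ᶠ[nearScri u₀] G) (a : Fin 4) :
    pd a F =ᶠ[nearScri u₀] pd a G := by
  filter_upwards [eventually_eventually_nhds h] with p hp using pd_congr hp a

theorem pd_const (a : Fin 4) (c : ℝ) (p : Pt) : pd a (fun _ => c) p = 0 := by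
  simp [pd]

theorem pd_add {F G : Pt → ℝ} {p : Pt} (hF : DifferentiableAt ℝ F p) (hG : DifferentiableAt ℝ G p)
    (a : Fin 4) : pd a (fun q => F q + G q) p = pd a F p + pd a G p := by
  simp [pd, fderiv_fun_add hF hG]

theorem pd_sub {F G : Pt → ℝ} {p : Pt} (hF : DifferentiableAt ℝ F p) (hG : DifferentiableAt ℝ G p)
    (a : Fin 4) : pd a (fun q => F q - G q) p = pd a F p - pd a G p := by
  simp [pd, fderiv_fun_sub hF hG]

theorem pd_neg (F : Pt → ℝ) (p : Pt) (a : Fin 4) : pd a (fun q => -F q) p = -pd a F p := by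
  simp [pd, fderiv_fun_neg]

theorem pd_mul {F G : Pt → ℝ} {p : Pt} (hF : DifferentiableAt ℝ F p) (hG : DifferentiableAt ℝ G p)
    (a : Fin 4) : pd a (fun q => F q * G q) p = pd a F p * G p + F p * pd a G p := by
  simp [pd, fderiv_fun_mul hF hG]; ring

theorem pd_const_mul {F : Pt → ℝ} {p : Pt} (hF : DifferentiableAt ℝ F p) (c : ℝ)
    (a : Fin 4) : pd a (fun q => c * F q) p = c * pd a F p := by
  rw [pd_mul (differentiableAt_const c) hF, pd_const]; ring

theorem pd_sum {ι : Type*} (s : Finset ι) {F : ι → Pt → ℝ} {p : Pt}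
    (hF : ∀ i ∈ s, DifferentiableAt ℝ (F i) p) (a : Fin 4) :
    pd a (fun q => ∑ i ∈ s, F i q) p = ∑ i ∈ s, pd a (F i) p := by
  simp [pd, fderiv_fun_sum hF]

theorem pd_inv {F : Pt → ℝ} {p : Pt} (hF : DifferentiableAt ℝ F p) (h0 : F p ≠ 0) (a : Fin 4) :
    pd a (fun q => (F q)⁻¹) p = -(pd a F p * ((F p)⁻¹ * (F p)⁻¹)) := by
  have h := (hasDerivAt_inv h0).comp_hasFDerivAt p hF.hasFDerivAt
  have h' : HasFDerivAt (fun q => (F q)⁻¹) _ p := h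
  rw [pd, h'.fderiv, pd]
  simp [pow_two]
  ring

theorem pd_coord (a b : Fin 4) (p : Pt) : pd a (fun q => q b) p = if a = b then 1 else 0 := by
  have h : HasFDerivAt (fun q : Pt => q b) (ContinuousLinearMap.proj (R := ℝ) b) p :=
    (ContinuousLinearMap.proj (R := ℝ) (φ := fun _ : Fin 4 => ℝ) b).hasFDerivAt
  rw [pd, h.fderiv]
  simp [Pi.single_apply, eq_comm]

theorem contDiffAt_pd {F : Pt → ℝ} {p : Pt} (hF : ContDiffAt ℝ ∞ F p) (a : Fin 4) :
    ContDiffAt ℝ ∞ (pd a F) p := by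
  have h : ContDiffAt ℝ ∞ (fderiv ℝ F) p := hF.fderiv_right (by simp)
  exact h.clm_apply contDiffAt_const

theorem fderiv_eq_sum_pd (F : Pt → ℝ) (p v : Pt) : fderiv ℝ F p v = ∑ a, v a * pd a F p := by
  conv_lhs => rw [← Finset.univ_sum_single v]
  rw [map_sum]
  refine Finset.sum_congr rfl fun a _ => ?_
  have : (Pi.single a (v a) : Pt) = v a • Pi.single a 1 := by
    rw [← Pi.single_smul]; simp
  rw [this, map_smul, pd, smul_eq_mul]

theorem pd_comm {F : Pt → ℝ} {p : Pt} (hF : ContDiffAt ℝ ∞ F p) (a b : Fin 4) :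
    pd a (pd b F) p = pd b (pd a F) p := by
  have hd : DifferentiableAt ℝ (fderiv ℝ F) p :=
    (hF.fderiv_right (m := ∞) (by simp)).differentiableAt (by simp)
  have key : ∀ a b : Fin 4, pd a (pd b F) p =
      fderiv ℝ (fderiv ℝ F) p (Pi.single a 1) (Pi.single b 1) := by
    intro a b
    have h := hd.hasFDerivAt.clm_apply (hasFDerivAt_const (Pi.single b (1 : ℝ) : Pt) p)
    have h' : HasFDerivAt (pd b F) _ p := h
    rw [pd, h'.fderiv]; simp
  rw [key, key]
  exact (hF.isSymmSndFDerivAt (by simp only [minSmoothness_of_isRCLikeNormedField]; exact ENat.LEInfty.out)) _ _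

theorem contDiffAt_radius {p : Pt} (hp : 0 < radius p) : ContDiffAt ℝ ∞ radius p := by
  have h : (∑ i : Fin 3, p i.succ ^ 2) ≠ 0 := by
    rw [← radius_sq]; positivity
  have h1 : ContDiffAt ℝ ∞ (fun q : Pt => ∑ i : Fin 3, q i.succ ^ 2) p := by fun_prop
  exact h1.sqrt h

theorem differentiableAt_radius {p : Pt} (hp : 0 < radius p) : DifferentiableAt ℝ radius p :=
  (contDiffAt_radius hp).differentiableAt (by simp)

/-- The square of r is a polynomial; the derivatives of r itself follow from it by the product rule.
-/
theorem pd_radius_sq (a : Fin 4) (p : Pt) :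
    pd a (fun q => radius q * radius q) p = if a = 0 then 0 else 2 * p a := by
  have : (fun q => radius q * radius q) = fun q : Pt => ∑ i : Fin 3, q i.succ * q i.succ := by
    ext q; rw [← pow_two, radius_sq]; simp [pow_two]
  rw [this, pd_sum _ (fun i _ => by fun_prop)]
  have h : ∀ i : Fin 3, pd a (fun q : Pt => q i.succ * q i.succ) p =
      2 * ((if a = i.succ then 1 else 0) * p i.succ) := by
    intro i
    rw [pd_mul (by fun_prop) (by fun_prop), pd_coord]; ring
  simp only [h]
  refine Fin.cases ?_ (fun j => ?_) a
  · simp [(Fin.succ_ne_zero _).symm]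
  · simp [Fin.succ_ne_zero]

/-- The components `x^i` of the direction of a point. -/
def dir (i : Fin 3) (p : Pt) : ℝ := p i.succ / radius p

theorem pd_radius_zero {p : Pt} (hp : 0 < radius p) : pd 0 radius p = 0 := by
  have h := pd_radius_sq 0 p
  rw [pd_mul (differentiableAt_radius hp) (differentiableAt_radius hp), if_pos rfl] at h
  have : radius p * pd 0 radius p = 0 := by linarith
  exact (mul_eq_zero.1 this).resolve_left hp.ne'

theorem pd_radius_succ {p : Pt} (hp : 0 < radius p) (i : Fin 3) :
    pd i.succ radius p = dir i p := by
  have h := pd_radius_sq i.succ p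
  rw [pd_mul (differentiableAt_radius hp) (differentiableAt_radius hp),
    if_neg (Fin.succ_ne_zero i)] at h
  rw [dir, eq_div_iff hp.ne']; linarith

theorem pd_comp {φ : ℝ → ℝ} {φ' : ℝ} {F : Pt → ℝ} {p : Pt} (hφ : HasDerivAt φ φ' (F p))
    (hF : DifferentiableAt ℝ F p) (a : Fin 4) : pd a (fun q => φ (F q)) p = φ' * pd a F p := by
  have h := hφ.comp_hasFDerivAt p hF.hasFDerivAt
  have h' : HasFDerivAt (fun q => φ (F q)) _ p := h
  rw [pd, h'.fderiv, pd]; simp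

theorem sum_dir_sq {p : Pt} (hp : 0 < radius p) : ∑ i, dir i p * dir i p = 1 := by
  simp only [dir, ← pow_two, div_pow]
  rw [← Finset.sum_div, ← radius_sq, div_self (by positivity)]

/-- The projection `δ_ij - x_i x_j` to the tangent space of the sphere. -/
def proj (i j : Fin 3) (p : Pt) : ℝ := (if i = j then 1 else 0) - dir i p * dir j p

theorem contDiffAt_dir {p : Pt} (hp : 0 < radius p) (i : Fin 3) : ContDiffAt ℝ ∞ (dir i) p := by
  have h1 : ContDiffAt ℝ ∞ (fun q : Pt => q i.succ) p := by fun_prop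
  exact h1.div (contDiffAt_radius hp) hp.ne'

theorem pd_dir_zero {p : Pt} (hp : 0 < radius p) (i : Fin 3) : pd 0 (dir i) p = 0 := by
  have h : pd 0 (fun q => q i.succ * (radius q)⁻¹) p = 0 := by
    rw [pd_mul (by fun_prop) ((differentiableAt_radius hp).fun_inv hp.ne'), pd_coord,
      pd_inv (differentiableAt_radius hp) hp.ne', pd_radius_zero hp]
    simp [(Fin.succ_ne_zero i).symm]
  exact h

theorem pd_dir_succ {p : Pt} (hp : 0 < radius p) (i j : Fin 3) :
    pd j.succ (dir i) p = proj j i p / radius p := by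
  have h : pd j.succ (fun q => q i.succ * (radius q)⁻¹) p = proj j i p / radius p := by
    rw [pd_mul (by fun_prop) ((differentiableAt_radius hp).fun_inv hp.ne'), pd_coord,
      pd_inv (differentiableAt_radius hp) hp.ne', pd_radius_succ hp]
    simp only [Fin.succ_inj, proj, dir]
    have := hp.ne'
    by_cases hij : j = i
    · simp only [hij, if_true]; field_simp; ring
    · simp only [hij, if_false]; field_simp; ring
  exact h

theorem dir_dilate {t : ℝ} (ht : 0 < t) (i : Fin 3) (p : Pt) : dir i (dilate t p) = dir i p := by
  rw [dir, dir, radius_dilate ht.le, dilate_succ, mul_div_mul_left _ _ ht.ne']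

theorem proj_symm (i j : Fin 3) (p : Pt) : proj i j p = proj j i p := by
  simp only [proj, eq_comm (a := i), mul_comm]

theorem sum_dir_mul_proj {p : Pt} (hp : 0 < radius p) (i : Fin 3) :
    ∑ j, dir j p * proj j i p = 0 := by
  have h : ∑ j, dir j p * proj j i p = dir i p - (∑ j, dir j p * dir j p) * dir i p := by
    simp [proj, mul_sub, Finset.sum_sub_distrib, Finset.sum_mul, mul_assoc]
  rw [h, sum_dir_sq hp]; ring

/-! ### The derivative along the generators -/

/-- The derivative `∂_r = x^i ∂_i` along the generators. -/
def dr (F : Pt → ℝ) (p : Pt) : ℝ := ∑ i : Fin 3, dir i p * pd i.succ F p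

theorem dr_eq_sum_lVec (F : Pt → ℝ) (p : Pt) : dr F p = ∑ a, lVec p a * pd a F p := by
  simp [dr, Fin.sum_univ_succ (n := 3), lVec, dir]

theorem dr_congr {F G : Pt → ℝ} {p : Pt} (h : F =ᶠ[𝓝 p] G) : dr F p = dr G p := by
  simp only [dr, pd_congr h]

theorem dr_sub {F G : Pt → ℝ} {p : Pt} (hF : DifferentiableAt ℝ F p) (hG : DifferentiableAt ℝ G p) :
    dr (fun q => F q - G q) p = dr F p - dr G p := by
  simp only [dr, pd_sub hF hG, mul_sub, Finset.sum_sub_distrib]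

theorem dr_mul {F G : Pt → ℝ} {p : Pt} (hF : DifferentiableAt ℝ F p) (hG : DifferentiableAt ℝ G p) :
    dr (fun q => F q * G q) p = dr F p * G p + F p * dr G p := by
  simp only [dr, pd_mul hF hG, mul_add, Finset.sum_add_distrib, Finset.sum_mul, Finset.mul_sum]
  congr 1 <;> exact Finset.sum_congr rfl fun _ _ => by ring

theorem dr_sum {ι : Type*} (s : Finset ι) {F : ι → Pt → ℝ} {p : Pt}
    (hF : ∀ i ∈ s, DifferentiableAt ℝ (F i) p) :
    dr (fun q => ∑ i ∈ s, F i q) p = ∑ i ∈ s, dr (F i) p := by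
  simp only [dr, pd_sum s hF, Finset.mul_sum]
  exact Finset.sum_comm

theorem dr_const (c : ℝ) (p : Pt) : dr (fun _ => c) p = 0 := by simp [dr, pd_const]

theorem dr_radius {p : Pt} (hp : 0 < radius p) : dr radius p = 1 := by
  simp only [dr, pd_radius_succ hp, sum_dir_sq hp]

theorem dr_dir {p : Pt} (hp : 0 < radius p) (i : Fin 3) : dr (dir i) p = 0 := by
  simp only [dr, pd_dir_succ hp, ← mul_div_assoc, ← Finset.sum_div, sum_dir_mul_proj hp, zero_div]

theorem hasDerivAt_dilate (p : Pt) (t : ℝ) :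
    HasDerivAt (fun s => dilate s p) (Fin.cons 0 fun i : Fin 3 => p i.succ : Pt) t := by
  rw [hasDerivAt_pi]
  refine fun a => Fin.cases ?_ (fun i => ?_) a
  · simpa using hasDerivAt_const t (p 0)
  · simpa using (hasDerivAt_id t).mul_const (p i.succ)

theorem hasDerivAt_along_ray {F : Pt → ℝ} {p : Pt} {t : ℝ} (ht : 0 < t) (hp : 0 < radius p)
    (hF : DifferentiableAt ℝ F (dilate t p)) :
    HasDerivAt (fun s => F (dilate s p)) (radius p * dr F (dilate t p)) t := by
  have h := hF.hasFDerivAt.comp_hasDerivAt t (hasDerivAt_dilate p t)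
  refine h.congr_deriv ?_
  rw [fderiv_eq_sum_pd, dr, Fin.sum_univ_succ, Finset.mul_sum]
  simp only [Fin.cons_zero, zero_mul, zero_add, Fin.cons_succ, dir_dilate ht]
  refine Finset.sum_congr rfl fun i _ => ?_
  rw [dir]; field_simp

theorem dr_eq_zero_of_dilate {F : Pt → ℝ} {p : Pt} (hp : 0 < radius p)
    (hF : DifferentiableAt ℝ F p) (h : ∀ t : ℝ, 0 < t → F (dilate t p) = F p) : dr F p = 0 := by
  have e : dilate 1 p = p := by
    ext a; refine Fin.cases rfl (fun i => ?_) a; simp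
  have h1 := hasDerivAt_along_ray (F := F) one_pos hp (by rwa [e])
  have h2 : HasDerivAt (fun s => F (dilate s p)) 0 1 :=
    (hasDerivAt_const (1 : ℝ) (F p)).congr_of_eventuallyEq <| by
      filter_upwards [lt_mem_nhds one_pos] with s hs using h s hs
  have h3 := h1.unique h2
  rw [e] at h3
  exact (mul_eq_zero.1 h3).resolve_left hp.ne'

end NullInfinity

end

noncomputable section

namespace NullInfinity

/-! ### Symbols: functions with controlled growth together with all their derivatives -/

/-- The iterated coordinate derivative along a list of directions. -/
def iterPd : List (Fin 4) → (Pt → ℝ) → Pt → ℝ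
  | [], F => F
  | a :: w, F => iterPd w (pd a F)

/-- The number of spatial directions in a list. -/
def spatialCount (w : List (Fin 4)) : ℕ := w.countP (· ≠ 0)

/-- The orders of magnitude `r ^ d (log r) ^ N`. -/
def HasOrder (u₀ : ℝ) (d : ℤ) (F : Pt → ℝ) : Prop :=
  ∃ N : ℕ, F =O[nearScri u₀] fun p => radius p ^ d * Real.log (radius p) ^ N

/-- `F` is smooth near null infinity, of order `r ^ d` up to logarithms, and each derivative in a
spatial direction improves the order by one. -/
structure IsSymbol (u₀ : ℝ) (d : ℤ) (F : Pt → ℝ) : Prop where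
  smooth : ∀ᶠ p in nearScri u₀, ContDiffAt ℝ ∞ F p
  order : ∀ w, HasOrder u₀ (d - spatialCount w) (iterPd w F)

variable {u₀ : ℝ}

theorem HasOrder.congr {d : ℤ} {F G : Pt → ℝ} (hF : HasOrder u₀ d F) (h : F =ᶠ[nearScri u₀] G) :
    HasOrder u₀ d G := by
  obtain ⟨N, hN⟩ := hF
  exact ⟨N, hN.congr' h EventuallyEq.rfl⟩

theorem eventually_log_ge_one (u₀ : ℝ) : ∀ᶠ p in nearScri u₀, 1 ≤ Real.log (radius p) :=
  ((Real.tendsto_log_atTop.comp (tendsto_radius u₀)).eventually_ge_atTop 1)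

theorem isBigO_order_mono {d d' : ℤ} {N M : ℕ} (hd : d ≤ d') (hN : N ≤ M) :
    (fun p => radius p ^ d * Real.log (radius p) ^ N) =O[nearScri u₀]
      fun p => radius p ^ d' * Real.log (radius p) ^ M := by
  refine IsBigO.of_bound 1 ?_
  filter_upwards [eventually_log_ge_one u₀, eventually_radius_gt u₀ 1] with p hl hr
  have h1 : radius p ^ d ≤ radius p ^ d' := zpow_le_zpow_right₀ hr.le hd
  have h2 : Real.log (radius p) ^ N ≤ Real.log (radius p) ^ M := pow_le_pow_right₀ hl hN
  have h3 : 0 ≤ radius p ^ d := zpow_nonneg (radius_nonneg p) _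
  have h4 : 0 ≤ Real.log (radius p) ^ N := pow_nonneg (by linarith) _
  rw [one_mul, Real.norm_of_nonneg (mul_nonneg h3 h4),
    Real.norm_of_nonneg (mul_nonneg (h3.trans h1) (h4.trans h2))]
  exact mul_le_mul h1 h2 h4 (h3.trans h1)

theorem HasOrder.mono {d d' : ℤ} {F : Pt → ℝ} (hF : HasOrder u₀ d F) (h : d ≤ d') :
    HasOrder u₀ d' F := by
  obtain ⟨N, hN⟩ := hF
  exact ⟨N, hN.trans (isBigO_order_mono h le_rfl)⟩

theorem HasOrder.add {d : ℤ} {F G : Pt → ℝ} (hF : HasOrder u₀ d F) (hG : HasOrder u₀ d G) :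
    HasOrder u₀ d (fun p => F p + G p) := by
  obtain ⟨N, hN⟩ := hF
  obtain ⟨M, hM⟩ := hG
  exact ⟨max N M, (hN.trans (isBigO_order_mono le_rfl (le_max_left _ _))).add
    (hM.trans (isBigO_order_mono le_rfl (le_max_right _ _)))⟩

theorem HasOrder.mul {d d' e : ℤ} {F G : Pt → ℝ} (hF : HasOrder u₀ d F) (hG : HasOrder u₀ d' G)
    (he : e = d + d') : HasOrder u₀ e (fun p => F p * G p) := by
  obtain ⟨N, hN⟩ := hF
  obtain ⟨M, hM⟩ := hG
  refine ⟨N + M, (hN.mul hM).congr' EventuallyEq.rfl ?_⟩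
  filter_upwards [eventually_radius_gt u₀ 0] with p hp
  rw [he, zpow_add₀ hp.ne', pow_add]; ring

theorem HasOrder.neg {d : ℤ} {F : Pt → ℝ} (hF : HasOrder u₀ d F) :
    HasOrder u₀ d (fun p => -F p) := by
  obtain ⟨N, hN⟩ := hF
  exact ⟨N, hN.neg_left⟩

theorem hasOrder_zero (d : ℤ) : HasOrder u₀ d (fun _ => 0) := ⟨0, isBigO_zero _ _⟩

theorem iterPd_congr {F G : Pt → ℝ} (h : F =ᶠ[nearScri u₀] G) (w : List (Fin 4)) :
    iterPd w F =ᶠ[nearScri u₀] iterPd w G := by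
  induction w generalizing F G with
  | nil => exact h
  | cons a w ih => exact ih (pd_congr_nearScri h a)

theorem iterPd_zero (w : List (Fin 4)) : iterPd w (fun _ => 0) = fun _ => 0 := by
  induction w with
  | nil => rfl
  | cons a w ih => rw [iterPd, show pd a (fun _ => (0 : ℝ)) = fun _ => 0 from
      funext (pd_const a 0), ih]

theorem smooth_pd {F : Pt → ℝ} (h : ∀ᶠ p in nearScri u₀, ContDiffAt ℝ ∞ F p) (a : Fin 4) :
    ∀ᶠ p in nearScri u₀, ContDiffAt ℝ ∞ (pd a F) p := by
  filter_upwards [h] with p hp using contDiffAt_pd hp a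

theorem differentiableAt_of_smooth {F : Pt → ℝ} {p : Pt} (h : ContDiffAt ℝ ∞ F p) :
    DifferentiableAt ℝ F p := h.differentiableAt (by simp)

theorem iterPd_add {F G : Pt → ℝ} (hF : ∀ᶠ p in nearScri u₀, ContDiffAt ℝ ∞ F p)
    (hG : ∀ᶠ p in nearScri u₀, ContDiffAt ℝ ∞ G p) (w : List (Fin 4)) :
    iterPd w (fun p => F p + G p) =ᶠ[nearScri u₀] fun p => iterPd w F p + iterPd w G p := by
  induction w generalizing F G with
  | nil => exact EventuallyEq.rfl
  | cons a w ih =>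
    refine (iterPd_congr (G := fun p => pd a F p + pd a G p) ?_ w).trans
      (ih (smooth_pd hF a) (smooth_pd hG a))
    filter_upwards [hF, hG] with p h1 h2
    exact pd_add (differentiableAt_of_smooth h1) (differentiableAt_of_smooth h2) a

theorem iterPd_neg (F : Pt → ℝ) (w : List (Fin 4)) :
    iterPd w (fun p => -F p) = fun p => -iterPd w F p := by
  induction w generalizing F with
  | nil => rfl
  | cons a w ih =>
    rw [iterPd, show pd a (fun p => -F p) = fun p => -pd a F p from funext fun p => pd_neg F p a,
      ih]
    rfl

theorem spatialCount_cons (a : Fin 4) (w : List (Fin 4)) :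
    (spatialCount (a :: w) : ℤ) = spatialCount w + if a = 0 then 0 else 1 := by
  by_cases h : a = 0 <;> simp [spatialCount, h]

namespace IsSymbol

variable {d d' e : ℤ} {F G : Pt → ℝ}

theorem hasOrder (hF : IsSymbol u₀ d F) : HasOrder u₀ d F := by
  simpa [spatialCount, iterPd] using hF.order []

theorem congr (hF : IsSymbol u₀ d F) (h : F =ᶠ[nearScri u₀] G) : IsSymbol u₀ d G where
  smooth := by
    filter_upwards [hF.smooth, eventually_eventually_nhds h] with p h1 h2
    exact h1.congr_of_eventuallyEq (h2.mono fun _ hq => hq.symm)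
  order w := (hF.order w).congr (iterPd_congr h w)

theorem mono (hF : IsSymbol u₀ d F) (h : d ≤ d') : IsSymbol u₀ d' F where
  smooth := hF.smooth
  order w := (hF.order w).mono (by omega)

theorem pd (hF : IsSymbol u₀ d F) (a : Fin 4) : IsSymbol u₀ (d - if a = 0 then 0 else 1) (pd a F) where
  smooth := smooth_pd hF.smooth a
  order w := by
    have := hF.order (a :: w)
    rw [spatialCount_cons] at this
    rwa [sub_right_comm, sub_sub]

theorem pd_zero (hF : IsSymbol u₀ d F) : IsSymbol u₀ d (NullInfinity.pd 0 F) := by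
  simpa using hF.pd 0

theorem pd_succ (hF : IsSymbol u₀ d F) (i : Fin 3) (he : e = d - 1) :
    IsSymbol u₀ e (NullInfinity.pd i.succ F) := by
  simpa [he, Fin.succ_ne_zero] using hF.pd i.succ

/-- A function is a symbol if it has the right order and its derivatives are symbols. -/
theorem of_pd (hs : ∀ᶠ p in nearScri u₀, ContDiffAt ℝ ∞ F p) (h : HasOrder u₀ d F)
    (h' : ∀ a : Fin 4, ∀ w, HasOrder u₀ (d - (if a = 0 then 0 else 1) - spatialCount w)
      (iterPd w (NullInfinity.pd a F))) : IsSymbol u₀ d F where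
  smooth := hs
  order w := by
    cases w with
    | nil => simpa [spatialCount, iterPd] using h
    | cons a w =>
      rw [spatialCount_cons, add_comm, ← sub_sub]
      exact h' a w

theorem add (hF : IsSymbol u₀ d F) (hG : IsSymbol u₀ d G) : IsSymbol u₀ d (fun p => F p + G p) where
  smooth := by filter_upwards [hF.smooth, hG.smooth] with p h1 h2 using h1.add h2
  order w := ((hF.order w).add (hG.order w)).congr (iterPd_add hF.smooth hG.smooth w).symm

theorem neg (hF : IsSymbol u₀ d F) : IsSymbol u₀ d (fun p => -F p) where
  smooth := by filter_upwards [hF.smooth] with p h1 using h1.neg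
  order w := by rw [iterPd_neg]; exact (hF.order w).neg

theorem sub (hF : IsSymbol u₀ d F) (hG : IsSymbol u₀ d G) : IsSymbol u₀ d (fun p => F p - G p) := by
  simpa [sub_eq_add_neg] using hF.add hG.neg

theorem zero : IsSymbol u₀ d (fun _ => 0) where
  smooth := Eventually.of_forall fun _ => contDiffAt_const
  order w := by rw [iterPd_zero]; exact hasOrder_zero _

theorem sum {ι : Type*} (s : Finset ι) {F : ι → Pt → ℝ} (hF : ∀ i ∈ s, IsSymbol u₀ d (F i)) :
    IsSymbol u₀ d (fun p => ∑ i ∈ s, F i p) := by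
  classical
  induction s using Finset.induction_on with
  | empty => simpa using zero
  | insert i s hi ih =>
    simp only [Finset.sum_insert hi]
    exact (hF i (Finset.mem_insert_self _ _)).add
      (ih fun j hj => hF j (Finset.mem_insert_of_mem hj))

theorem const (c : ℝ) (hd : 0 ≤ d) : IsSymbol u₀ d (fun _ => c) := by
  refine of_pd (Eventually.of_forall fun _ => contDiffAt_const) ?_ fun a w => ?_
  · exact HasOrder.mono ⟨0, by simpa using isBigO_const_const c (one_ne_zero (α := ℝ)) _⟩ hd
  · rw [show NullInfinity.pd a (fun _ => c) = fun _ => 0 from funext (pd_const a c), iterPd_zero]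
    exact hasOrder_zero _

/-- The factors and their orders stay free in the induction: the product rule yields two products
whose factors are again symbols, one of them differentiated. -/
theorem mul_order (w : List (Fin 4)) : ∀ {d d' : ℤ} {F G : Pt → ℝ}, IsSymbol u₀ d F →
    IsSymbol u₀ d' G → HasOrder u₀ (d + d' - spatialCount w) (iterPd w fun p => F p * G p) := by
  induction w with
  | nil => exact fun hF hG => hF.hasOrder.mul hG.hasOrder (by simp [spatialCount])
  | cons a w ih =>
    intro d d' F G hF hG
    have h1 := ih (hF.pd a) hG
    have h2 := ih hF (hG.pd a)
    have hs1 := ((hF.pd a).smooth.and hG.smooth).mono fun p h => h.1.mul h.2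
    have hs2 := (hF.smooth.and (hG.pd a).smooth).mono fun p h => h.1.mul h.2
    have e1 : NullInfinity.pd a (fun p => F p * G p) =ᶠ[nearScri u₀]
        fun p => NullInfinity.pd a F p * G p + F p * NullInfinity.pd a G p := by
      filter_upwards [hF.smooth, hG.smooth] with p h1 h2
      exact pd_mul (differentiableAt_of_smooth h1) (differentiableAt_of_smooth h2) a
    have e2 := (iterPd_congr e1 w).trans (iterPd_add hs1 hs2 w)
    refine HasOrder.congr ?_ e2.symm
    rw [spatialCount_cons]
    exact (h1.mono (by omega)).add (h2.mono (by omega))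

theorem mul (hF : IsSymbol u₀ d F) (hG : IsSymbol u₀ d' G) (he : e = d + d') :
    IsSymbol u₀ e (fun p => F p * G p) where
  smooth := by filter_upwards [hF.smooth, hG.smooth] with p h1 h2 using h1.mul h2
  order w := he ▸ mul_order w hF hG

theorem const_mul (c : ℝ) (hF : IsSymbol u₀ d F) : IsSymbol u₀ d (fun p => c * F p) :=
  (const (d := 0) c le_rfl).mul hF (by simp)

theorem prod {ι : Type*} (s : Finset ι) {F : ι → Pt → ℝ} (hF : ∀ i ∈ s, IsSymbol u₀ 0 (F i)) :
    IsSymbol u₀ 0 (fun p => ∏ i ∈ s, F i p) := by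
  classical
  induction s using Finset.induction_on with
  | empty => simpa using const 1 le_rfl
  | insert i s hi ih =>
    simp only [Finset.prod_insert hi]
    exact (hF i (Finset.mem_insert_self _ _)).mul
      (ih fun j hj => hF j (Finset.mem_insert_of_mem hj)) (by simp)

/-- `F - G` is a symbol of order `-1` for products of such factors. -/
theorem prod_sub_prod {ι : Type*} (s : Finset ι) {F G : ι → Pt → ℝ}
    (hF : ∀ i ∈ s, IsSymbol u₀ 0 (F i)) (hG : ∀ i ∈ s, IsSymbol u₀ 0 (G i))
    (h : ∀ i ∈ s, IsSymbol u₀ (-1) (fun p => F i p - G i p)) :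
    IsSymbol u₀ (-1) (fun p => ∏ i ∈ s, F i p - ∏ i ∈ s, G i p) := by
  classical
  induction s using Finset.induction_on with
  | empty => simpa using zero
  | insert i s hi ih =>
    have hF' : ∀ j ∈ s, IsSymbol u₀ 0 (F j) := fun j hj => hF j (Finset.mem_insert_of_mem hj)
    have h1 := (h i (Finset.mem_insert_self _ _)).mul (prod s hF') (e := -1) (by simp)
    have h2 := (hG i (Finset.mem_insert_self _ _)).mul
      (ih hF' (fun j hj => hG j (Finset.mem_insert_of_mem hj))
        (fun j hj => h j (Finset.mem_insert_of_mem hj))) (e := -1) (by simp)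
    refine (h1.add h2).congr (Eventually.of_forall fun p => ?_)
    simp only [Finset.prod_insert hi]; ring

/-- The free numerator closes the induction: ∂(G/F) = ∂G/F - G∂F/F² is a sum of quotients of the
same kind, and F² is again of order 0 and bounded below, by c². -/
theorem inv_order (w : List (Fin 4)) : ∀ {F : Pt → ℝ} {c : ℝ}, 0 < c → IsSymbol u₀ 0 F →
    (∀ᶠ p in nearScri u₀, c ≤ |F p|) →
    ∀ {d : ℤ} {G : Pt → ℝ}, IsSymbol u₀ d G →
      HasOrder u₀ (d - spatialCount w) (iterPd w fun p => G p * (F p)⁻¹) := by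
  induction w with
  | nil =>
    intro F c hc hF hb d G hG
    refine hG.hasOrder.mul (d' := 0) ⟨0, ?_⟩ (by simp [spatialCount])
    refine IsBigO.of_bound c⁻¹ ?_
    filter_upwards [hb] with p hp
    simpa using inv_anti₀ hc hp
  | cons a w ih =>
    intro F c hc hF hb d G hG
    have h1 := ih hc hF hb (hG.pd a)
    have hF2 : IsSymbol u₀ 0 (fun p => F p * F p) := hF.mul hF (by simp)
    have hb2 : ∀ᶠ p in nearScri u₀, c * c ≤ |F p * F p| := by
      filter_upwards [hb] with p hp
      rw [abs_mul]; exact mul_le_mul hp hp hc.le (hc.le.trans hp)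
    have h2 := ih (mul_pos hc hc) hF2 hb2 (hG.mul (hF.pd a).neg rfl)
    have hne : ∀ᶠ p in nearScri u₀, F p ≠ 0 := by
      filter_upwards [hb] with p hp h0
      simp only [h0, abs_zero] at hp
      linarith
    have hs1 : ∀ᶠ p in nearScri u₀,
        ContDiffAt ℝ ∞ (fun p => NullInfinity.pd a G p * (F p)⁻¹) p := by
      filter_upwards [(hG.pd a).smooth, hF.smooth, hne] with p h1 h2 h3 using h1.mul (h2.inv h3)
    have hs2 : ∀ᶠ p in nearScri u₀,
        ContDiffAt ℝ ∞ (fun p => G p * -NullInfinity.pd a F p * (F p * F p)⁻¹) p := by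
      filter_upwards [(hF.pd a).smooth, hF.smooth, hG.smooth, hne] with p h1 h2 h3 h4
      exact (h3.mul h1.neg).mul ((h2.mul h2).inv (mul_ne_zero h4 h4))
    have e1 : NullInfinity.pd a (fun p => G p * (F p)⁻¹) =ᶠ[nearScri u₀]
        fun p => NullInfinity.pd a G p * (F p)⁻¹ +
          G p * -NullInfinity.pd a F p * (F p * F p)⁻¹ := by
      filter_upwards [hF.smooth, hG.smooth, hne] with p h1 h2 h3
      have h1' := differentiableAt_of_smooth h1
      rw [pd_mul (differentiableAt_of_smooth h2) (h1'.fun_inv h3), pd_inv h1' h3, mul_inv]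
      ring
    have e2 := (iterPd_congr e1 w).trans (iterPd_add hs1 hs2 w)
    refine HasOrder.congr ?_ e2.symm
    rw [spatialCount_cons]
    exact (h1.mono (by omega)).add (h2.mono (by omega))

theorem inv {c : ℝ} (hc : 0 < c) (hF : IsSymbol u₀ 0 F) (hb : ∀ᶠ p in nearScri u₀, c ≤ |F p|) :
    IsSymbol u₀ 0 (fun p => (F p)⁻¹) where
  smooth := by
    filter_upwards [hF.smooth, hb] with p h1 h2
    refine h1.inv fun h0 => ?_
    simp only [h0, abs_zero] at h2
    linarith
  order w := by simpa using inv_order w hc hF hb (const (d := 0) 1 le_rfl)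

theorem det {ι : Type*} [Fintype ι] [DecidableEq ι] {M : Pt → Matrix ι ι ℝ}
    (h : ∀ i j, IsSymbol u₀ 0 (fun p => M p i j)) : IsSymbol u₀ 0 (fun p => (M p).det) := by
  simp only [Matrix.det_apply']
  exact sum _ fun σ _ => const_mul _ (prod _ fun i _ => h _ _)

theorem det_sub_det {ι : Type*} [Fintype ι] [DecidableEq ι] {M M' : Pt → Matrix ι ι ℝ}
    (h : ∀ i j, IsSymbol u₀ 0 (fun p => M p i j)) (h' : ∀ i j, IsSymbol u₀ 0 (fun p => M' p i j))
    (hs : ∀ i j, IsSymbol u₀ (-1) (fun p => M p i j - M' p i j)) :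
    IsSymbol u₀ (-1) (fun p => (M p).det - (M' p).det) := by
  simp only [Matrix.det_apply', ← Finset.sum_sub_distrib, ← mul_sub]
  exact sum _ fun σ _ => const_mul _
    (prod_sub_prod _ (fun i _ => h _ _) (fun i _ => h' _ _) fun i _ => hs _ _)

end IsSymbol

/-! ### Functions on null infinity -/

/-- A smooth function on null infinity: `IsScriFunction`, restricted to the cylinder over
`J × S²`. -/
structure ScriSmooth (J : Set ℝ) (c : Pt → ℝ) : Prop where
  contDiffAt : ∀ p ∈ region J, ContDiffAt ℝ ∞ c p
  dilate : ∀ p ∈ region J, ∀ t : ℝ, 0 < t → c (dilate t p) = c p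

theorem dilate_mem_region {J : Set ℝ} {p : Pt} (hp : p ∈ region J) {t : ℝ} (ht : 0 < t) :
    dilate t p ∈ region J :=
  ⟨hp.1, by rw [radius_dilate ht.le]; exact mul_pos ht hp.2⟩

/-- The dilation as a linear map. -/
def dilateL (t : ℝ) : Pt →L[ℝ] Pt :=
  ContinuousLinearMap.pi fun a => (if a = 0 then 1 else t) • ContinuousLinearMap.proj a

theorem dilateL_apply (t : ℝ) (p : Pt) : dilateL t p = dilate t p := by
  ext a
  refine Fin.cases ?_ (fun i => ?_) a <;> simp [dilateL, Fin.succ_ne_zero]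

theorem pd_dilate {F : Pt → ℝ} {t : ℝ} {p : Pt} (hF : DifferentiableAt ℝ F (dilate t p))
    (a : Fin 4) :
    pd a (fun q => F (dilate t q)) p = (if a = 0 then 1 else t) * pd a F (dilate t p) := by
  have h0 : HasFDerivAt (fun q => dilate t q) (dilateL t) p := by
    have := (dilateL t).hasFDerivAt (x := p)
    rwa [show ⇑(dilateL t) = fun q => dilate t q from funext (dilateL_apply t)] at this
  have h : HasFDerivAt (fun q => F (dilate t q)) _ p := hF.hasFDerivAt.comp p h0
  have e : dilateL t (Pi.single a 1) = (if a = 0 then (1 : ℝ) else t) • Pi.single a (1 : ℝ) := by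
    ext b
    rw [dilateL_apply]
    revert a b
    simp only [Fin.forall_fin_succ (n := 3), dilate_zero, dilate_succ, Pi.smul_apply,
      Pi.single_apply]
    simp [Fin.succ_ne_zero, (Fin.succ_ne_zero _).symm]
  rw [pd, h.fderiv, pd, ContinuousLinearMap.comp_apply, e, map_smul, smul_eq_mul]

namespace ScriSmooth

variable {J : Set ℝ} {c c' : Pt → ℝ}

theorem of_isScriFunction (hJ : IsOpen J) (h : IsScriFunction J c) : ScriSmooth J c where
  contDiffAt p hp := h.1.contDiffAt ((isOpen_region hJ).mem_nhds hp)
  dilate p _ t ht := h.2 t p ht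

theorem differentiableAt (h : ScriSmooth J c) {p : Pt} (hp : p ∈ region J) :
    DifferentiableAt ℝ c p := differentiableAt_of_smooth (h.contDiffAt p hp)

theorem const (x : ℝ) : ScriSmooth J (fun _ => x) := ⟨fun _ _ => contDiffAt_const, fun _ _ _ _ => rfl⟩

theorem mul (h : ScriSmooth J c) (h' : ScriSmooth J c') : ScriSmooth J (fun p => c p * c' p) where
  contDiffAt p hp := (h.contDiffAt p hp).mul (h'.contDiffAt p hp)
  dilate p hp t ht := by rw [h.dilate p hp t ht, h'.dilate p hp t ht]

theorem add (h : ScriSmooth J c) (h' : ScriSmooth J c') : ScriSmooth J (fun p => c p + c' p) where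
  contDiffAt p hp := (h.contDiffAt p hp).add (h'.contDiffAt p hp)
  dilate p hp t ht := by rw [h.dilate p hp t ht, h'.dilate p hp t ht]

theorem neg (h : ScriSmooth J c) : ScriSmooth J (fun p => -c p) where
  contDiffAt p hp := (h.contDiffAt p hp).neg
  dilate p hp t ht := by rw [h.dilate p hp t ht]

theorem sub (h : ScriSmooth J c) (h' : ScriSmooth J c') : ScriSmooth J (fun p => c p - c' p) := by
  simpa [sub_eq_add_neg] using h.add h'.neg

theorem sum {ι : Type*} (s : Finset ι) {F : ι → Pt → ℝ} (hF : ∀ i ∈ s, ScriSmooth J (F i)) :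
    ScriSmooth J (fun p => ∑ i ∈ s, F i p) where
  contDiffAt p hp := ContDiffAt.sum fun i hi => (hF i hi).contDiffAt p hp
  dilate p hp t ht := Finset.sum_congr rfl fun i hi => (hF i hi).dilate p hp t ht

theorem dir (i : Fin 3) : ScriSmooth J (dir i) where
  contDiffAt _ hp := contDiffAt_dir hp.2 i
  dilate p _ _ ht := dir_dilate ht i p

theorem proj (i j : Fin 3) : ScriSmooth J (proj i j) :=
  (const _).sub ((dir i).mul (dir j))

/-- Differentiated homogeneity: ∂_u preserves the degree zero, a spatial derivative has degree -1.
-/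
theorem pd_dilate_eq (hJ : IsOpen J) (h : ScriSmooth J c) {p : Pt} (hp : p ∈ region J) {t : ℝ}
    (ht : 0 < t) (a : Fin 4) : (if a = 0 then 1 else t) * pd a c (NullInfinity.dilate t p) = pd a c p := by
  rw [← pd_dilate (h.differentiableAt (dilate_mem_region hp ht))]
  refine pd_congr ?_ a
  filter_upwards [(isOpen_region hJ).mem_nhds hp] with q hq using h.dilate q hq t ht

theorem pd_zero (hJ : IsOpen J) (h : ScriSmooth J c) : ScriSmooth J (pd 0 c) where
  contDiffAt p hp := contDiffAt_pd (h.contDiffAt p hp) 0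
  dilate p hp t ht := by simpa using h.pd_dilate_eq hJ hp ht 0

/-- The factor r restores the degree of homogeneity that ∂_i lowers. So r ∂_i serves as the angular
gradient on null infinity. -/
theorem radius_mul_pd (hJ : IsOpen J) (h : ScriSmooth J c) (i : Fin 3) :
    ScriSmooth J (fun p => radius p * pd i.succ c p) where
  contDiffAt p hp := (contDiffAt_radius hp.2).mul (contDiffAt_pd (h.contDiffAt p hp) _)
  dilate p hp t ht := by
    rw [← h.pd_dilate_eq hJ hp ht i.succ, if_neg (Fin.succ_ne_zero i), radius_dilate ht.le]; ring

theorem dr_eq_zero (h : ScriSmooth J c) {p : Pt} (hp : p ∈ region J) : dr c p = 0 :=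
  dr_eq_zero_of_dilate hp.2 (h.differentiableAt hp) fun t ht => h.dilate p hp t ht

/-- By homogeneity all values near null infinity are taken on the slice r = 1, |u - u₀| ≤ δ/2, which
is compact. -/
theorem bounded (hJ : IsOpen J) (h : ScriSmooth J c) {u₀ : ℝ} (hu : u₀ ∈ J) :
    c =O[nearScri u₀] fun _ => (1 : ℝ) := by
  obtain ⟨δ, hδ, H⟩ := Metric.isOpen_iff.1 hJ u₀ hu
  let K : Set Pt := {p | |p 0 - u₀| ≤ δ / 2 ∧ radius p = 1}
  have hKJ : K ⊆ region J := fun p hp => ⟨H (by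
    rw [Metric.mem_ball, Real.dist_eq]; linarith [hp.1]), by rw [hp.2]; exact one_pos⟩
  have hKc : IsCompact K := by
    refine Metric.isCompact_of_isClosed_isBounded ?_ ?_
    · have h0 : Continuous fun p : Pt => |p 0 - u₀| := by fun_prop
      exact (isClosed_le h0 continuous_const).inter
        (isClosed_eq continuous_radius continuous_const)
    · refine (Metric.isBounded_closedBall (x := (0 : Pt)) (r := |u₀| + δ + 1)).subset fun p hp => ?_
      rw [mem_closedBall_zero_iff, pi_norm_le_iff_of_nonneg (by positivity)]
      refine fun a => Fin.cases ?_ (fun i => ?_) a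
      · have := abs_sub_abs_le_abs_sub (p 0) u₀
        rw [Real.norm_eq_abs]; linarith [hp.1]
      · have h1 : p i.succ ^ 2 ≤ 1 := by
          have := radius_sq p
          rw [hp.2] at this
          rw [show (1 : ℝ) = 1 ^ 2 by norm_num, this]
          exact Finset.single_le_sum (f := fun j : Fin 3 => p j.succ ^ 2)
            (fun _ _ => sq_nonneg _) (Finset.mem_univ i)
        rw [Real.norm_eq_abs]
        linarith [(sq_le_one_iff_abs_le_one _).1 h1, abs_nonneg u₀]
  obtain ⟨B, hB⟩ := hKc.exists_bound_of_continuousOn (f := c)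
    fun p hp => (h.contDiffAt p (hKJ hp)).continuousAt.continuousWithinAt
  refine IsBigO.of_bound B (eventually_nearScri.2 ⟨δ / 2, by positivity, 0, fun p hp hr => ?_⟩)
  have hpJ : p ∈ region J := ⟨H (by rw [Metric.mem_ball, Real.dist_eq]; linarith), hr⟩
  rw [← h.dilate p hpJ (radius p)⁻¹ (inv_pos.2 hr), norm_one, mul_one]
  refine hB _ ⟨by simpa using hp.le, ?_⟩
  rw [radius_dilate (inv_pos.2 hr).le, inv_mul_cancel₀ hr.ne']

end ScriSmooth

/-! ### The terms of polyhomogeneous expansions -/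

/-- `c (log r) ^ j r ^ d`. -/
def term (c : Pt → ℝ) (j : ℕ) (d : ℤ) (p : Pt) : ℝ :=
  c p * Real.log (radius p) ^ j * radius p ^ d

theorem contDiffAt_log_radius {p : Pt} (hp : 0 < radius p) :
    ContDiffAt ℝ ∞ (fun q => Real.log (radius q)) p := (contDiffAt_radius hp).log hp.ne'

theorem contDiffAt_zpow_radius {p : Pt} (hp : 0 < radius p) (d : ℤ) :
    ContDiffAt ℝ ∞ (fun q => radius q ^ d) p := by
  have h : ContDiffAt ℝ ∞ (fun x : ℝ => x ^ d) (radius p) := by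
    cases d with
    | ofNat n => simpa using contDiffAt_id.pow n
    | negSucc n =>
      simp only [zpow_negSucc]
      exact (contDiffAt_id.pow (n + 1)).inv (pow_ne_zero _ hp.ne')
  exact h.comp p (contDiffAt_radius hp)

theorem contDiffAt_term {c : Pt → ℝ} {p : Pt} (hc : ContDiffAt ℝ ∞ c p) (hp : 0 < radius p)
    (j : ℕ) (d : ℤ) : ContDiffAt ℝ ∞ (term c j d) p :=
  (hc.mul ((contDiffAt_log_radius hp).pow j)).mul (contDiffAt_zpow_radius hp d)

theorem pd_term {c : Pt → ℝ} {p : Pt} (hc : DifferentiableAt ℝ c p) (hp : 0 < radius p)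
    (j : ℕ) (d : ℤ) (a : Fin 4) :
    pd a (term c j d) p = term (pd a c) j d p +
      (j * term c (j - 1) (d - 1) p + d * term c j (d - 1) p) * pd a radius p := by
  have hr := differentiableAt_radius hp
  have h1 := (Real.hasDerivAt_log hp.ne').pow j
  have h2 := hasDerivAt_zpow d (radius p) (Or.inl hp.ne')
  have e1 : pd a (fun q => Real.log (radius q) ^ j) p = _ := pd_comp h1 hr a
  have e2 : pd a (fun q => radius q ^ d) p = _ := pd_comp h2 hr a
  have d1 : DifferentiableAt ℝ (fun q => Real.log (radius q) ^ j) p :=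
    differentiableAt_of_smooth ((contDiffAt_log_radius hp).pow j)
  have d2 := differentiableAt_of_smooth (contDiffAt_zpow_radius hp d)
  have e3 : pd a (term c j d) p = _ := pd_mul (hc.fun_mul d1) d2 a
  rw [e3, pd_mul hc d1, e1, e2]
  simp only [term]
  rw [zpow_sub_one₀ hp.ne']
  ring

/-- A spatial derivative of c (log r)^j r^d is a sum of two terms of the same kind with exponent d -
1, whose coefficients are again functions on null infinity; the induction therefore leaves c, j and
d free. -/
theorem term_order {J : Set ℝ} (hJ : IsOpen J) (hu : u₀ ∈ J) (w : List (Fin 4)) :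
    ∀ {c : Pt → ℝ} (j : ℕ) (d : ℤ), ScriSmooth J c →
      HasOrder u₀ (d - spatialCount w) (iterPd w (term c j d)) := by
  induction w with
  | nil =>
    intro c j d hc
    refine ⟨j, ?_⟩
    have h := (hc.bounded hJ hu).mul (isBigO_refl
      (fun p => radius p ^ d * Real.log (radius p) ^ j) (nearScri u₀))
    refine (h.congr' (Eventually.of_forall fun p => ?_) (Eventually.of_forall fun p => ?_))
    · simp only [iterPd, term]; ring
    · simp [spatialCount]
  | cons a w ih =>
    intro c j d hc
    have hreg := eventually_mem_region hJ hu
    rw [spatialCount_cons]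
    refine Fin.cases ?_ (fun i => ?_) a
    · refine HasOrder.congr (F := iterPd w (term (pd 0 c) j d)) ?_ (iterPd_congr ?_ w)
      · simpa using ih j d (hc.pd_zero hJ)
      · filter_upwards [hreg] with p hp
        rw [pd_term (hc.differentiableAt hp) hp.2, pd_radius_zero hp.2, mul_zero, add_zero]
    -- For `j = 0` the factor j in the second coefficient removes the term with the truncated
    -- exponent `j - 1`.
    · have c1 : ScriSmooth J (fun p => radius p * pd i.succ c p + (d : ℝ) * (c p * dir i p)) :=
        (hc.radius_mul_pd hJ i).add ((ScriSmooth.const _).mul (hc.mul (ScriSmooth.dir i)))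
      have c2 : ScriSmooth J (fun p => (j : ℝ) * (c p * dir i p)) :=
        (ScriSmooth.const _).mul (hc.mul (ScriSmooth.dir i))
      have s : ∀ {c : Pt → ℝ} (j : ℕ), ScriSmooth J c →
          ∀ᶠ p in nearScri u₀, ContDiffAt ℝ ∞ (term c j (d - 1)) p := fun j hc => by
        filter_upwards [hreg] with p hp using contDiffAt_term (hc.contDiffAt p hp) hp.2 _ _
      have e : (fun p => term (fun p => radius p * pd i.succ c p + (d : ℝ) * (c p * dir i p))
          j (d - 1) p + term (fun p => (j : ℝ) * (c p * dir i p)) (j - 1) (d - 1) p)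
          =ᶠ[nearScri u₀] pd i.succ (term c j d) := by
        filter_upwards [hreg] with p hp
        rw [pd_term (hc.differentiableAt hp) hp.2, pd_radius_succ hp.2]
        simp only [term]
        rw [zpow_sub_one₀ hp.2.ne']
        have := hp.2.ne'
        field_simp
        ring
      refine HasOrder.congr (HasOrder.add ?_ ?_)
        ((iterPd_add (s j c1) (s (j - 1) c2) w).symm.trans (iterPd_congr e w))
      · exact (ih j (d - 1) c1).mono (by simp [Fin.succ_ne_zero]; omega)
      · exact (ih (j - 1) (d - 1) c2).mono (by simp [Fin.succ_ne_zero]; omega)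

theorem ScriSmooth.isSymbol_term {J : Set ℝ} (hJ : IsOpen J) (hu : u₀ ∈ J) {c : Pt → ℝ}
    (hc : ScriSmooth J c) (j : ℕ) (d : ℤ) : IsSymbol u₀ d (term c j d) where
  smooth := by
    filter_upwards [eventually_mem_region hJ hu] with p hp
    exact contDiffAt_term (hc.contDiffAt p hp) hp.2 _ _
  order w := term_order hJ hu w j d hc

theorem ScriSmooth.isSymbol_mul_zpow {J : Set ℝ} (hJ : IsOpen J) (hu : u₀ ∈ J) {c : Pt → ℝ}
    (hc : ScriSmooth J c) (d : ℤ) : IsSymbol u₀ d (fun p => c p * radius p ^ d) :=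
  (hc.isSymbol_term hJ hu 0 d).congr (Eventually.of_forall fun p => by simp [term])

theorem ScriSmooth.isSymbol {J : Set ℝ} (hJ : IsOpen J) (hu : u₀ ∈ J) {c : Pt → ℝ}
    (hc : ScriSmooth J c) : IsSymbol u₀ 0 c :=
  (hc.isSymbol_mul_zpow hJ hu 0).congr (Eventually.of_forall fun p => by simp)

theorem IsSymbol.dir (i : Fin 3) : IsSymbol u₀ 0 (dir i) :=
  (ScriSmooth.dir i).isSymbol isOpen_univ (Set.mem_univ u₀)

theorem IsSymbol.proj (i j : Fin 3) : IsSymbol u₀ 0 (proj i j) :=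
  (ScriSmooth.proj i j).isSymbol isOpen_univ (Set.mem_univ u₀)

theorem IsSymbol.zpow (d : ℤ) : IsSymbol u₀ d (fun p => radius p ^ d) := by
  simpa using (ScriSmooth.const 1).isSymbol_mul_zpow isOpen_univ (Set.mem_univ u₀) d

theorem IsSymbol.dr {d e : ℤ} {F : Pt → ℝ} (hF : IsSymbol u₀ d F) (he : e = d - 1) :
    IsSymbol u₀ e (dr F) :=
  IsSymbol.sum _ fun i _ => (IsSymbol.dir i).mul (hF.pd_succ i he) (by simp)

/-- Each coordinate derivative is a fixed linear evaluation of the Fréchet derivative, so bounds on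
all `iteratedFDeriv` pass to it. -/
theorem iterPd_isBigO {φ : Pt → ℝ} (w : List (Fin 4)) : ∀ {F : Pt → ℝ},
    (∀ᶠ p in nearScri u₀, ContDiffAt ℝ ∞ F p) →
    (∀ n : ℕ, (fun p => iteratedFDeriv ℝ n F p) =O[nearScri u₀] φ) →
    iterPd w F =O[nearScri u₀] φ := by
  induction w with
  | nil =>
    intro F _ h
    refine ((h 0).norm_left.congr_left fun p => ?_).of_norm_left
    simp [iterPd]
  | cons a w ih =>
    intro F hs h
    refine ih (smooth_pd hs a) fun n => ?_
    let L : (Pt →L[ℝ] ℝ) →L[ℝ] ℝ := ContinuousLinearMap.apply ℝ ℝ (Pi.single a 1 : Pt)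
    refine IsBigO.trans (IsBigO.of_bound ‖L‖ ?_) (h (n + 1))
    filter_upwards [hs] with p hp
    have h1 : ContDiffAt ℝ ∞ (fderiv ℝ F) p := hp.fderiv_right (by simp)
    rw [← norm_iteratedFDeriv_fderiv]
    exact L.norm_iteratedFDeriv_comp_left h1 (by exact_mod_cast le_top)

/-- A smooth polyhomogeneous function agrees with its expansion up to symbols of lower order. -/
theorem IsPolyhom.exists_expansion {J : Set ℝ} (hJ : IsOpen J) {d : ℤ} {f : Pt → ℝ}
    (h : IsPolyhom J d f) (hs : ∀ u ∈ J, ∀ᶠ p in nearScri u, ContDiffAt ℝ ∞ f p) :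
    ∃ (N : ℕ → ℕ) (c : ℕ → ℕ → Pt → ℝ), (∀ k j, ScriSmooth J (c k j)) ∧
      ∀ K : ℕ, ∀ u ∈ J, IsSymbol u (d - K) fun p =>
        f p - ∑ k ∈ Finset.range K, ∑ j ∈ Finset.range (N k + 1), term (c k j) j (d - k) p := by
  obtain ⟨N, c, hc, H⟩ := h
  have hc' := fun k j => ScriSmooth.of_isScriFunction hJ (hc k j)
  refine ⟨N, c, hc', fun K u hu => ?_⟩
  have hT : ∀ k : ℕ, IsSymbol u (d - k) fun p => ∑ j ∈ Finset.range (N k + 1), term (c k j) j (d - k) p :=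
    fun k => IsSymbol.sum _ fun j _ => (hc' k j).isSymbol_term hJ hu j _
  have hsm : ∀ M : ℕ, ∀ᶠ p in nearScri u, ContDiffAt ℝ ∞ (fun p => f p - ∑ k ∈ Finset.range M,
      ∑ j ∈ Finset.range (N k + 1), term (c k j) j (d - k) p) p := fun M => by
    filter_upwards [hs u hu, eventually_mem_region hJ hu] with p h1 h2
    exact h1.sub (ContDiffAt.sum fun k _ => ContDiffAt.sum fun j _ =>
      contDiffAt_term ((hc' k j).contDiffAt p h2) h2.2 _ _)
  refine ⟨hsm K, fun w => ?_⟩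
  -- In `IsPolyhom` the bound on the remainder does not improve under spatial derivatives. Expanding
  -- `w.length` orders further supplies the gain; the additional terms are symbols and are added
  -- back as `hL`.
  have hR := iterPd_isBigO w (hsm (K + w.length + 1)) fun n => H (K + w.length) n u hu
  have hR' : HasOrder u (d - K - spatialCount w) (iterPd w (fun p => f p -
      ∑ k ∈ Finset.range (K + w.length + 1),
      ∑ j ∈ Finset.range (N k + 1), term (c k j) j (d - k) p)) := by
    refine HasOrder.mono (d := d - ((K + w.length : ℕ) : ℤ)) ⟨0, by simpa using hR⟩ ?_
    have : spatialCount w ≤ w.length := List.countP_le_length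
    push_cast; omega
  have hL : IsSymbol u (d - K) fun p => ∑ i ∈ Finset.range (w.length + 1),
      ∑ j ∈ Finset.range (N (K + i) + 1), term (c (K + i) j) j (d - (K + i : ℕ)) p :=
    IsSymbol.sum _ fun i _ => (hT (K + i)).mono (by push_cast; omega)
  refine HasOrder.congr (hR'.add (hL.order w))
    ((iterPd_add (hsm _) hL.smooth w).symm.trans (iterPd_congr (Eventually.of_forall fun p => ?_) w))
  simp only [add_assoc K, Finset.sum_range_add (n := K)]
  ring

/-! ### Uniqueness of coefficients -/

theorem HasOrder.tendsto_zero_along {d : ℤ} {F : Pt → ℝ} (hF : HasOrder u₀ d F) (hd : d ≤ -1)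
    {γ : ℝ → Pt} (hγ : Tendsto γ atTop (nearScri u₀)) : Tendsto (fun t => F (γ t)) atTop (𝓝 0) := by
  obtain ⟨N, hN⟩ := hF.mono hd
  have h1 : Tendsto (fun x : ℝ => Real.log x ^ N / x) atTop (𝓝 0) := by
    have := (Real.isLittleO_pow_log_id_atTop (n := N)).tendsto_div_nhds_zero
    simpa using this
  have h2 : Tendsto (fun p => radius p ^ (-1 : ℤ) * Real.log (radius p) ^ N) (nearScri u₀) (𝓝 0) :=
    (h1.comp (tendsto_radius u₀)).congr fun p => by
      simp [div_eq_mul_inv, mul_comm]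
  exact (hN.trans_tendsto h2).comp hγ

/-- A polynomial in `log r` that tends to zero is zero. -/
theorem poly_eq_of_tendsto_log {P : Polynomial ℝ} {l x : ℝ} (hx : 0 < x)
    (h : Tendsto (fun t => P.eval (Real.log (t * x))) atTop (𝓝 l)) : P = Polynomial.C l := by
  have h1 : Tendsto (fun s : ℝ => P.eval s) atTop (𝓝 l) := by
    have h2 : Tendsto (fun s => Real.exp s / x) atTop atTop :=
      Real.tendsto_exp_atTop.atTop_div_const hx
    refine (h.comp h2).congr fun s => ?_
    simp [div_mul_cancel₀ _ hx.ne']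
  obtain ⟨h2, h3⟩ := (P.tendsto_nhds_iff).1 h1
  rw [Polynomial.eq_C_of_degree_le_zero h3] at h2 ⊢
  simpa using h2

/-- The coefficient is constant along each generator and, by the lower order, tends to zero there.
This is the uniqueness of leading coefficients. -/
theorem ScriSmooth.eq_zero_of_hasOrder {J : Set ℝ} {c : Pt → ℝ} (hc : ScriSmooth J c) (hu : u₀ ∈ J)
    {d e : ℤ} (h : HasOrder u₀ e fun p => c p * radius p ^ d) (he : e < d) {p : Pt}
    (hp0 : p 0 = u₀) (hp : 0 < radius p) : c p = 0 := by
  have hpJ : p ∈ region J := ⟨hp0 ▸ hu, hp⟩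
  have h1 : HasOrder u₀ (e - d) c := by
    refine (h.mul (IsSymbol.zpow (-d)).hasOrder (e := e - d) (by ring)).congr ?_
    filter_upwards [eventually_radius_gt u₀ 0] with q hq
    rw [mul_assoc, ← zpow_add₀ hq.ne']; simp
  have h2 := h1.tendsto_zero_along (by omega) (hp0 ▸ tendsto_dilate hp)
  refine tendsto_nhds_unique (tendsto_const_nhds.congr' ?_) h2
  filter_upwards [eventually_gt_atTop 0] with t ht using (hc.dilate p hpJ t ht).symm

end NullInfinity

end

noncomputable section

namespace NullInfinity

/-! ### The metric in the affine gauge -/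

variable {u₀ : ℝ} {J : Set ℝ} {D : Set Pt} {g : MetricField} {p : Pt}

/-- The deviation `h_ab` of the metric from the Minkowski metric. -/
def pert (g : MetricField) (a b : Fin 4) (p : Pt) : ℝ := g p a b - minkowski p a b

theorem minkowski_zero_zero (p : Pt) : minkowski p 0 0 = 1 := by simp [minkowski]

theorem minkowski_zero_succ (p : Pt) (i : Fin 3) : minkowski p 0 i.succ = dir i p := by
  simp [minkowski, dir, (Fin.succ_ne_zero i).symm]

theorem minkowski_succ_zero (p : Pt) (i : Fin 3) : minkowski p i.succ 0 = dir i p := by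
  simp [minkowski, dir, (Fin.succ_ne_zero i)]

theorem minkowski_succ_succ (p : Pt) (i j : Fin 3) :
    minkowski p i.succ j.succ = -proj i j p := by
  simp [minkowski, dir, proj, Fin.succ_ne_zero]

theorem isSymbol_minkowski (a b : Fin 4) : IsSymbol u₀ 0 (fun p => minkowski p a b) := by
  refine Fin.cases ?_ (fun i => ?_) a <;> refine Fin.cases ?_ (fun j => ?_) b
  · simpa only [minkowski_zero_zero] using IsSymbol.const 1 le_rfl
  · simpa only [minkowski_zero_succ] using IsSymbol.dir j
  · simpa only [minkowski_succ_zero] using IsSymbol.dir i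
  · simpa only [minkowski_succ_succ] using (IsSymbol.proj i j).neg

theorem pd_minkowski_zero (hp : 0 < radius p) (a b : Fin 4) :
    pd 0 (fun q => minkowski q a b) p = 0 := by
  have hd : ∀ i, DifferentiableAt ℝ (dir i) p := fun i => differentiableAt_of_smooth (contDiffAt_dir hp i)
  refine Fin.cases ?_ (fun i => ?_) a <;> refine Fin.cases ?_ (fun j => ?_) b
  · simp only [minkowski_zero_zero, pd_const]
  · simp only [minkowski_zero_succ]; exact pd_dir_zero hp j
  · simp only [minkowski_succ_zero]; exact pd_dir_zero hp i
  · simp only [minkowski_succ_succ, proj]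
    rw [pd_neg, pd_sub (differentiableAt_const _) ((hd i).fun_mul (hd j)), pd_const,
      pd_mul (hd i) (hd j), pd_dir_zero hp, pd_dir_zero hp]
    ring

theorem contDiffAt_minkowski (hp : 0 < radius p) (a b : Fin 4) :
    ContDiffAt ℝ ∞ (fun p => minkowski p a b) p := by
  refine Fin.cases ?_ (fun i => ?_) a <;> refine Fin.cases ?_ (fun j => ?_) b
  · simpa only [minkowski_zero_zero] using contDiffAt_const
  · simpa only [minkowski_zero_succ] using contDiffAt_dir hp j
  · simpa only [minkowski_succ_zero] using contDiffAt_dir hp i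
  · simp only [minkowski_succ_succ, proj]
    exact (contDiffAt_const.sub ((contDiffAt_dir hp i).mul (contDiffAt_dir hp j))).neg

theorem det_minkowski (hp : 0 < radius p) : (minkowski p).det = -1 := by
  have h := sum_dir_sq hp
  rw [Fin.sum_univ_three] at h
  have e : minkowski p = !![1, dir 0 p, dir 1 p, dir 2 p;
      dir 0 p, dir 0 p * dir 0 p - 1, dir 0 p * dir 1 p, dir 0 p * dir 2 p;
      dir 1 p, dir 1 p * dir 0 p, dir 1 p * dir 1 p - 1, dir 1 p * dir 2 p;
      dir 2 p, dir 2 p * dir 0 p, dir 2 p * dir 1 p, dir 2 p * dir 2 p - 1] := by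
    ext a b
    fin_cases a <;> fin_cases b <;> simp [minkowski, dir] <;> first | rfl | exact Or.inl rfl
  rw [e, Matrix.det_succ_row_zero]
  simp [Fin.sum_univ_succ, Matrix.det_fin_three, Matrix.submatrix, Fin.succAbove]
  ring

/-- The inverse of the Minkowski metric. -/
def minkowskiInv (p : Pt) : Matrix (Fin 4) (Fin 4) ℝ := fun a b =>
  Fin.cases (Fin.cases 0 (fun j => dir j p) b)
    (fun i => Fin.cases (dir i p) (fun j => if i = j then -1 else 0) b) a

theorem minkowski_mul_inv (hp : 0 < radius p) : minkowski p * minkowskiInv p = 1 := by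
  have h := sum_dir_sq hp
  ext a b
  rw [Matrix.mul_apply, Fin.sum_univ_succ]
  refine Fin.cases ?_ (fun i => ?_) a <;> refine Fin.cases ?_ (fun j => ?_) b
  · simpa [minkowski_zero_zero, minkowski_zero_succ, minkowskiInv] using h
  · simp [minkowski_zero_zero, minkowski_zero_succ, minkowskiInv, (Fin.succ_ne_zero j).symm]
  · have h2 := sum_dir_mul_proj hp i
    simp only [minkowski_succ_zero, minkowski_succ_succ, minkowskiInv, Fin.cases_zero,
      Fin.cases_succ, mul_zero, zero_add, neg_mul, Finset.sum_neg_distrib]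
    rw [Matrix.one_apply_ne (Fin.succ_ne_zero i), neg_eq_zero, ← h2]
    exact Finset.sum_congr rfl fun j _ => by rw [proj_symm]; ring
  · simp [minkowski_succ_zero, minkowski_succ_succ, minkowskiInv, proj, Matrix.one_apply]

theorem isSymbol_minkowskiInv (a b : Fin 4) : IsSymbol u₀ 0 (fun p => minkowskiInv p a b) := by
  refine Fin.cases ?_ (fun i => ?_) a <;> refine Fin.cases ?_ (fun j => ?_) b
  · exact IsSymbol.zero
  · exact IsSymbol.dir j
  · exact IsSymbol.dir i
  · exact IsSymbol.const _ le_rfl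

theorem lVec_zero (p : Pt) : lVec p 0 = 0 := rfl

theorem lVec_succ (p : Pt) (i : Fin 3) : lVec p i.succ = dir i p := rfl

theorem dr_proj (hp : 0 < radius p) (i j : Fin 3) : dr (proj i j) p = 0 :=
  (ScriSmooth.proj (J := Set.univ) i j).dr_eq_zero ⟨trivial, hp⟩

theorem contDiffAt_matrix_inv {M : Pt → Matrix (Fin 4) (Fin 4) ℝ}
    (h : ∀ a b, ContDiffAt ℝ ∞ (fun q => M q a b) p) (h0 : (M p).det ≠ 0) (a b : Fin 4) :
    ContDiffAt ℝ ∞ (fun q => (M q)⁻¹ a b) p := by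
  have hdet : ∀ {N : Pt → Matrix (Fin 4) (Fin 4) ℝ}, (∀ a b, ContDiffAt ℝ ∞ (fun q => N q a b) p) →
      ContDiffAt ℝ ∞ (fun q => (N q).det) p := fun hN => by
    simp only [Matrix.det_apply']
    exact ContDiffAt.sum fun σ _ => contDiffAt_const.mul (contDiffAt_prod fun i _ => hN _ _)
  simp only [Matrix.inv_def, Ring.inverse_eq_inv', Matrix.smul_apply, smul_eq_mul,
    Matrix.adjugate_apply]
  refine ((hdet h).inv h0).mul (hdet fun c d => ?_)
  by_cases hc : c = b
  · subst hc; simpa using contDiffAt_const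
  · simpa [Matrix.updateRow_ne hc] using h c d

namespace IsAsymptoticallyFlat

variable (hg : IsAsymptoticallyFlat J D g)
include hg

theorem radius_pos (hp : p ∈ D) : 0 < radius p := (hg.D_subset p hp).2

theorem eventually_mem {u : ℝ} (hu : u ∈ J) : ∀ᶠ p in nearScri u, p ∈ D := hg.D_nhds u hu

theorem symm (hp : p ∈ D) (a b : Fin 4) : g p a b = g p b a :=
  (hg.lorentzian p hp).1.apply b a

theorem pd_symm (hp : p ∈ D) (c a b : Fin 4) :
    pd c (fun q => g q a b) p = pd c (fun q => g q b a) p :=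
  pd_congr (by filter_upwards [hg.isOpen_D.mem_nhds hp] with q hq using hg.symm hq a b) c

theorem contDiffAt (hp : p ∈ D) (a b : Fin 4) : ContDiffAt ℝ ∞ (fun q => g q a b) p :=
  (hg.smooth a b).contDiffAt (hg.isOpen_D.mem_nhds hp)

theorem differentiableAt (hp : p ∈ D) (a b : Fin 4) : DifferentiableAt ℝ (fun q => g q a b) p :=
  differentiableAt_of_smooth (hg.contDiffAt hp a b)

theorem sum_mul_dir (hp : p ∈ D) (a : Fin 4) :
    ∑ j : Fin 3, g p a j.succ * dir j p = if a = 0 then 1 else 0 := by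
  have h := hg.gauge p hp a
  rwa [lForm, Fin.sum_univ_succ, lVec_zero, mul_zero, zero_add] at h

theorem sum_dir_mul (hp : p ∈ D) (a : Fin 4) :
    ∑ j : Fin 3, dir j p * g p j.succ a = if a = 0 then 1 else 0 := by
  rw [← hg.sum_mul_dir hp a]
  exact Finset.sum_congr rfl fun j _ => by rw [hg.symm hp]; ring

theorem det_ne_zero (hp : p ∈ D) : (g p).det ≠ 0 := by
  obtain ⟨-, A, hA, h⟩ := hg.lorentzian p hp
  intro h0
  have := congrArg Matrix.det h
  rw [Matrix.det_mul, Matrix.det_mul, h0, mul_zero, zero_mul, Matrix.det_diagonal] at this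
  simp [Fin.prod_univ_succ] at this

theorem mul_inv (hp : p ∈ D) : g p * (g p)⁻¹ = 1 :=
  Matrix.mul_nonsing_inv _ (hg.det_ne_zero hp).isUnit

theorem inv_mul (hp : p ∈ D) : (g p)⁻¹ * g p = 1 :=
  Matrix.nonsing_inv_mul _ (hg.det_ne_zero hp).isUnit

theorem inv_symm (hp : p ∈ D) (a b : Fin 4) : (g p)⁻¹ a b = (g p)⁻¹ b a :=
  (hg.lorentzian p hp).1.inv.apply b a

/-- The gauge condition l_a = ∇_a u with raised index: g^{0a} = g^{ab} ∂_b u = l^a. -/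
theorem inv_zero (hp : p ∈ D) (a : Fin 4) : (g p)⁻¹ 0 a = lVec p a := by
  have h : (g p).mulVec (lVec p) = Pi.single 0 1 := by
    ext a
    have := hg.gauge p hp a
    rw [Pi.single_apply, ← this]; rfl
  have h2 := congrArg (fun v => (g p)⁻¹.mulVec v) h
  simp only [Matrix.mulVec_mulVec, hg.inv_mul hp, Matrix.one_mulVec] at h2
  rw [hg.inv_symm hp, h2]
  simp

theorem inv_zero_zero (hp : p ∈ D) : (g p)⁻¹ 0 0 = 0 := hg.inv_zero hp 0

theorem inv_zero_succ (hp : p ∈ D) (j : Fin 3) : (g p)⁻¹ 0 j.succ = dir j p :=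
  hg.inv_zero hp j.succ

theorem inv_succ_zero (hp : p ∈ D) (j : Fin 3) : (g p)⁻¹ j.succ 0 = dir j p := by
  rw [hg.inv_symm hp, hg.inv_zero_succ hp]

theorem contDiffAt_inv (hp : p ∈ D) (a b : Fin 4) : ContDiffAt ℝ ∞ (fun q => (g q)⁻¹ a b) p :=
  contDiffAt_matrix_inv (hg.contDiffAt hp) (hg.det_ne_zero hp) a b

theorem contDiffAt_christoffel (hp : p ∈ D) (a b c : Fin 4) :
    ContDiffAt ℝ ∞ (christoffel g a b c) p :=
  contDiffAt_const.mul <| ContDiffAt.sum fun d _ => (hg.contDiffAt_inv hp a d).mul <|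
    ((contDiffAt_pd (hg.contDiffAt hp _ _) _).add (contDiffAt_pd (hg.contDiffAt hp _ _) _)).sub
      (contDiffAt_pd (hg.contDiffAt hp _ _) _)

theorem christoffel_symm (hp : p ∈ D) (c a b : Fin 4) :
    christoffel g c a b p = christoffel g c b a p := by
  simp only [christoffel]
  congr 1
  refine Finset.sum_congr rfl fun d _ => ?_
  rw [hg.pd_symm hp d a b]; ring

/-- The gauge condition fixes x^j g_jb, so its derivative vanishes; a derivative of g contracted
with x is traded for a derivative of x. -/
theorem sum_dir_mul_pd (hp : p ∈ D) (a b : Fin 4) :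
    ∑ j : Fin 3, dir j p * pd a (fun q => g q j.succ b) p =
      -∑ j : Fin 3, pd a (dir j) p * g p j.succ b := by
  have hr := hg.radius_pos hp
  have hd : ∀ i, DifferentiableAt ℝ (dir i) p := fun i =>
    differentiableAt_of_smooth (contDiffAt_dir hr i)
  have h : pd a (fun q => ∑ j : Fin 3, dir j q * g q j.succ b) p = 0 := by
    rw [pd_congr (G := fun _ => if b = 0 then (1 : ℝ) else 0) _ a, pd_const]
    filter_upwards [hg.isOpen_D.mem_nhds hp] with q hq using hg.sum_dir_mul hq b
  rw [pd_sum _ fun j _ => (hd j).fun_mul (hg.differentiableAt hp _ _)] at h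
  simp only [pd_mul (hd _) (hg.differentiableAt hp _ _), Finset.sum_add_distrib] at h
  linarith

theorem sum_dir_mul_pd_zero (hp : p ∈ D) (b : Fin 4) :
    ∑ j : Fin 3, dir j p * pd 0 (fun q => g q j.succ b) p = 0 := by
  simp [hg.sum_dir_mul_pd hp, pd_dir_zero (hg.radius_pos hp)]

theorem sum_dir_mul_pd_succ_zero (hp : p ∈ D) (i : Fin 3) :
    ∑ j : Fin 3, dir j p * pd i.succ (fun q => g q j.succ 0) p =
      -((g p i.succ 0 - dir i p) / radius p) := by
  rw [hg.sum_dir_mul_pd hp]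
  simp only [pd_dir_succ (hg.radius_pos hp), proj]
  congr 1
  have h := hg.sum_dir_mul hp 0
  rw [if_pos rfl] at h
  have : ∑ j : Fin 3, ((if i = j then 1 else 0) - dir i p * dir j p) / radius p * g p j.succ 0 =
      (g p i.succ 0 - dir i p * ∑ j : Fin 3, dir j p * g p j.succ 0) / radius p := by
    simp only [sub_div, sub_mul, Finset.sum_sub_distrib, Finset.mul_sum, Finset.sum_div]
    simp [ite_div, ite_mul]
    ring_nf
  rw [this, h, mul_one]

theorem sum_dir_mul_pd_succ_succ (hp : p ∈ D) (i k : Fin 3) :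
    ∑ j : Fin 3, dir j p * pd i.succ (fun q => g q j.succ k.succ) p =
      -(g p i.succ k.succ / radius p) := by
  rw [hg.sum_dir_mul_pd hp]
  simp only [pd_dir_succ (hg.radius_pos hp), proj]
  congr 1
  have h := hg.sum_dir_mul hp k.succ
  rw [if_neg (Fin.succ_ne_zero k)] at h
  have : ∑ j : Fin 3, ((if i = j then 1 else 0) - dir i p * dir j p) / radius p * g p j.succ k.succ =
      (g p i.succ k.succ - dir i p * ∑ j : Fin 3, dir j p * g p j.succ k.succ) / radius p := by
    simp only [sub_div, sub_mul, Finset.sum_sub_distrib, Finset.mul_sum, Finset.sum_div]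
    simp [ite_div, ite_mul]
    ring_nf
  rw [this, h, mul_zero, sub_zero]

theorem dr_sum_eq_zero (hp : p ∈ D) (b : Fin 4) :
    ∑ j : Fin 3, dir j p * dr (fun q => g q j.succ b) p = 0 := by
  have hr := hg.radius_pos hp
  have hd : ∀ i, DifferentiableAt ℝ (dir i) p := fun i =>
    differentiableAt_of_smooth (contDiffAt_dir hr i)
  have h : dr (fun q => ∑ j : Fin 3, dir j q * g q j.succ b) p = 0 := by
    rw [dr_congr (G := fun _ => if b = 0 then (1 : ℝ) else 0), dr_const]
    filter_upwards [hg.isOpen_D.mem_nhds hp] with q hq using hg.sum_dir_mul hq b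
  rw [dr_sum _ fun j _ => (hd j).fun_mul (hg.differentiableAt hp _ _)] at h
  simpa only [dr_mul (hd _) (hg.differentiableAt hp _ _), dr_dir hr, zero_mul, zero_add] using h

theorem christoffel_zero (hp : p ∈ D) (a b : Fin 4) :
    christoffel g 0 a b p = (1 / 2) * (∑ j : Fin 3, dir j p * pd a (fun q => g q j.succ b) p +
      ∑ j : Fin 3, dir j p * pd b (fun q => g q j.succ a) p - dr (fun q => g q a b) p) := by
  rw [christoffel, Fin.sum_univ_succ, hg.inv_zero_zero hp]
  simp only [hg.inv_zero_succ hp, zero_mul, zero_add, dr, ← Finset.sum_add_distrib,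
    ← Finset.sum_sub_distrib]
  congr 1
  exact Finset.sum_congr rfl fun j _ => by ring

/-- The second fundamental form of the surfaces `u, r = const` along `l`. -/
theorem christoffel_zero_succ_succ (hp : p ∈ D) (i j : Fin 3) :
    christoffel g 0 i.succ j.succ p =
      -(g p i.succ j.succ / radius p) - (1 / 2) * dr (fun q => g q i.succ j.succ) p := by
  rw [hg.christoffel_zero hp, hg.sum_dir_mul_pd_succ_succ hp, hg.sum_dir_mul_pd_succ_succ hp,
    hg.symm hp j.succ i.succ]
  ring

/-- As Γ^0_ab = -∇_a l_b, this says l^a ∇_a l_b = 0: the generators are affinely parametrised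
geodesics. -/
theorem sum_dir_mul_christoffel_zero (hp : p ∈ D) (b : Fin 4) :
    ∑ k : Fin 3, dir k p * christoffel g 0 k.succ b p = 0 := by
  have hr := hg.radius_pos hp
  refine Fin.cases ?_ (fun j => ?_) b
  · have h1 := hg.dr_sum_eq_zero hp 0
    have h2 := hg.sum_dir_mul hp 0
    have h3 := sum_dir_sq hr
    have e : ∀ k : Fin 3, dir k p * christoffel g 0 k.succ 0 p =
        (-(1 / 2) / radius p) * (dir k p * g p k.succ 0 - dir k p * dir k p)
          - (1 / 2) * (dir k p * dr (fun q => g q k.succ 0) p) := fun k => by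
      rw [hg.christoffel_zero hp, hg.sum_dir_mul_pd_succ_zero hp, hg.sum_dir_mul_pd_zero hp]; ring
    simp only [e, Finset.sum_sub_distrib, ← Finset.mul_sum, h1, h2, h3]
    simp
  · have h1 := hg.dr_sum_eq_zero hp j.succ
    have h2 := hg.sum_dir_mul hp j.succ
    rw [if_neg (Fin.succ_ne_zero j)] at h2
    have e : ∀ k : Fin 3, dir k p * christoffel g 0 k.succ j.succ p =
        (-1 / radius p) * (dir k p * g p k.succ j.succ)
          - (1 / 2) * (dir k p * dr (fun q => g q k.succ j.succ) p) := fun k => by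
      rw [hg.christoffel_zero_succ_succ hp]; ring
    simp only [e, Finset.sum_sub_distrib, ← Finset.mul_sum, h1, h2]
    simp

theorem sum_christoffel_zero_mul_dir (hp : p ∈ D) (b : Fin 4) :
    ∑ k : Fin 3, christoffel g 0 b k.succ p * dir k p = 0 := by
  rw [← hg.sum_dir_mul_christoffel_zero hp b]
  exact Finset.sum_congr rfl fun k _ => by rw [hg.christoffel_symm hp]; ring

theorem sum_dir_mul_christoffel (hp : p ∈ D) (e : Fin 4) (i : Fin 3) :
    ∑ k : Fin 3, dir k p * christoffel g e k.succ i.succ p =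
      (1 / 2) * ((g p)⁻¹ e 0 * (dr (fun q => g q 0 i.succ) p - (g p i.succ 0 - dir i p) / radius p) +
        ∑ m : Fin 3, (g p)⁻¹ e m.succ * dr (fun q => g q m.succ i.succ) p) := by
  have h1 : ∀ d : Fin 4, ∑ k : Fin 3, dir k p * (pd k.succ (fun q => g q d i.succ) p +
      pd i.succ (fun q => g q d k.succ) p - pd d (fun q => g q k.succ i.succ) p) =
      dr (fun q => g q d i.succ) p + ∑ k : Fin 3, dir k p * pd i.succ (fun q => g q k.succ d) p -
        ∑ k : Fin 3, dir k p * pd d (fun q => g q k.succ i.succ) p := fun d => by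
    simp only [mul_sub, mul_add, Finset.sum_sub_distrib, Finset.sum_add_distrib, dr,
      hg.pd_symm hp i.succ d]
  have h2 : ∑ k : Fin 3, dir k p * christoffel g e k.succ i.succ p =
      (1 / 2) * ∑ d, (g p)⁻¹ e d * ∑ k : Fin 3, dir k p * (pd k.succ (fun q => g q d i.succ) p +
      pd i.succ (fun q => g q d k.succ) p - pd d (fun q => g q k.succ i.succ) p) := by
    simp only [christoffel, Finset.mul_sum]
    rw [Finset.sum_comm]
    exact Finset.sum_congr rfl fun _ _ => Finset.sum_congr rfl fun _ _ => by ring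
  rw [h2, Fin.sum_univ_succ]
  simp only [h1, hg.sum_dir_mul_pd_zero hp, hg.sum_dir_mul_pd_succ_zero hp,
    hg.sum_dir_mul_pd_succ_succ hp]
  congr 2
  · ring
  · refine Finset.sum_congr rfl fun m _ => ?_
    rw [hg.symm hp i.succ m.succ]; ring

/-- The components `R_{i l j l}` of the curvature. -/
theorem sum_dir_mul_riemann (hp : p ∈ D) (i j : Fin 3) :
    ∑ k : Fin 3, dir k p * riemann g 0 i.succ k.succ j.succ p =
      dr (christoffel g 0 j.succ i.succ) p + christoffel g 0 j.succ i.succ p / radius p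
        - (1 / 2) * ∑ m : Fin 3, ∑ n : Fin 3, christoffel g 0 j.succ m.succ p *
          ((g p)⁻¹ m.succ n.succ * dr (fun q => g q n.succ i.succ) p) := by
  have hr := hg.radius_pos hp
  have hd : ∀ i, DifferentiableAt ℝ (dir i) p := fun i =>
    differentiableAt_of_smooth (contDiffAt_dir hr i)
  have hc : ∀ a b c, DifferentiableAt ℝ (christoffel g a b c) p := fun a b c =>
    differentiableAt_of_smooth (hg.contDiffAt_christoffel hp a b c)
  -- The identity x^k Γ^0_ki = 0 is differentiated. The derivative of x^k is the projection over r,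
  -- and the x-part of the projection drops out by the same identity.
  have h1 : ∑ k : Fin 3, dir k p * pd j.succ (christoffel g 0 k.succ i.succ) p =
      -(christoffel g 0 j.succ i.succ p / radius p) := by
    have h : pd j.succ (fun q => ∑ k : Fin 3, dir k q * christoffel g 0 k.succ i.succ q) p = 0 := by
      rw [pd_congr (G := fun _ => 0), pd_const]
      filter_upwards [hg.isOpen_D.mem_nhds hp] with q hq
      exact hg.sum_dir_mul_christoffel_zero hq i.succ
    rw [pd_sum _ fun k _ => (hd k).fun_mul (hc _ _ _)] at h
    simp only [pd_mul (hd _) (hc _ _ _), Finset.sum_add_distrib, pd_dir_succ hr] at h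
    have h' : ∑ k : Fin 3, proj j k p / radius p * christoffel g 0 k.succ i.succ p =
        (christoffel g 0 j.succ i.succ p - dir j p *
          ∑ k : Fin 3, dir k p * christoffel g 0 k.succ i.succ p) / radius p := by
      simp only [proj, sub_div, sub_mul, Finset.sum_sub_distrib, Finset.mul_sum, Finset.sum_div]
      simp [ite_div, ite_mul]
      ring_nf
    rw [h', hg.sum_dir_mul_christoffel_zero hp, mul_zero, sub_zero] at h
    linarith
  have h2 : ∑ k : Fin 3, dir k p * ∑ e, christoffel g 0 k.succ e p * christoffel g e j.succ i.succ p
      = 0 := by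
    simp only [Finset.mul_sum]
    rw [Finset.sum_comm]
    refine Finset.sum_eq_zero fun e _ => ?_
    simp only [← mul_assoc, ← Finset.sum_mul, hg.sum_dir_mul_christoffel_zero hp, zero_mul]
  have h3 : ∑ k : Fin 3, dir k p * ∑ e, christoffel g 0 j.succ e p * christoffel g e k.succ i.succ p
      = (1 / 2) * ∑ m : Fin 3, ∑ n : Fin 3, christoffel g 0 j.succ m.succ p *
          ((g p)⁻¹ m.succ n.succ * dr (fun q => g q n.succ i.succ) p) := by
    have h4 : ∑ k : Fin 3, dir k p * ∑ e, christoffel g 0 j.succ e p * christoffel g e k.succ i.succ p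
        = ∑ e, christoffel g 0 j.succ e p * ∑ k : Fin 3, dir k p * christoffel g e k.succ i.succ p := by
      simp only [Finset.mul_sum]
      rw [Finset.sum_comm]
      exact Finset.sum_congr rfl fun _ _ => Finset.sum_congr rfl fun _ _ => by ring
    have h5 : ∑ k : Fin 3, dir k p * dr (fun q => g q k.succ i.succ) p = 0 :=
      hg.dr_sum_eq_zero hp i.succ
    rw [h4, Fin.sum_univ_succ]
    simp only [hg.sum_dir_mul_christoffel hp, hg.inv_zero_zero hp, hg.inv_zero_succ hp,
      hg.inv_succ_zero hp, h5]
    -- The value of `Y` is irrelevant: it comes with a factor x^m, which Γ^0_jm annihilates.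
    set Y := dr (fun q => g q 0 i.succ) p - (g p i.succ 0 - dir i p) / radius p
    have h6 : ∀ m : Fin 3, christoffel g 0 j.succ m.succ p * (1 / 2 * (dir m p * Y +
        ∑ n : Fin 3, (g p)⁻¹ m.succ n.succ * dr (fun q => g q n.succ i.succ) p)) =
        (1 / 2) * Y * (christoffel g 0 j.succ m.succ p * dir m p) + (1 / 2) *
          ∑ n : Fin 3, christoffel g 0 j.succ m.succ p *
          ((g p)⁻¹ m.succ n.succ * dr (fun q => g q n.succ i.succ) p) := fun m => by
      rw [← Finset.mul_sum]; ring
    simp only [h6, Finset.sum_add_distrib, ← Finset.mul_sum, hg.sum_christoffel_zero_mul_dir hp]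
    ring
  simp only [riemann, mul_add, mul_sub, Finset.sum_add_distrib, Finset.sum_sub_distrib, h1, h2, h3]
  rw [dr]
  ring

/-- The expansion of a leg contraction: the tangential part of `∇_b l_a`. -/
theorem nablaL_eq (hp : p ∈ D) (b a : Fin 4) : nablaL g b a p = -christoffel g 0 b a p := by
  have h : pd b (fun q => lForm g q a) p = 0 := by
    rw [pd_congr (G := fun _ => if a = 0 then (1 : ℝ) else 0), pd_const]
    filter_upwards [hg.isOpen_D.mem_nhds hp] with q hq using hg.gauge q hq a
  rw [nablaL, h]
  simp [hg.gauge p hp]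

end IsAsymptoticallyFlat

theorem IsLegM.sum_mul {m : Fin 4 → ℂ} (hm : IsLegM g p m) (T : Fin 4 → Fin 4 → ℂ) (n : Fin 4 → ℂ)
    (hn : n 0 = 0) : ∑ a, ∑ b, T a b * m a * n b =
      ∑ i : Fin 3, ∑ j : Fin 3, T i.succ j.succ * m i.succ * n j.succ := by
  simp [Fin.sum_univ_succ (n := 3), hm.tangent_u, hn]

namespace IsAsymptoticallyFlat

variable (hg : IsAsymptoticallyFlat J D g)
include hg

/-- On vectors tangent to u = const, ∇_b l_a = g_ab/r + ½ ∂_r h_ab: the flat expansion of the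
spheres plus the change of the deviation. The projection contained in g is constant along the
generators. -/
theorem sum_nablaL (hp : p ∈ D) {m : Fin 4 → ℂ} (hm : IsLegM g p m) (n : Fin 4 → ℂ)
    (hn : n 0 = 0) : ∑ a, ∑ b, (nablaL g b a p : ℂ) * m a * n b =
      (∑ a, ∑ b, (g p a b : ℂ) * m a * n b) / radius p + (1 / 2) *
        ∑ i : Fin 3, ∑ j : Fin 3, (dr (pert g i.succ j.succ) p : ℂ) * m i.succ * n j.succ := by
  have hr := hg.radius_pos hp
  rw [hm.sum_mul _ n hn, hm.sum_mul _ n hn, Finset.sum_div, Finset.mul_sum, ← Finset.sum_add_distrib]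
  refine Finset.sum_congr rfl fun i _ => ?_
  rw [Finset.sum_div, Finset.mul_sum, ← Finset.sum_add_distrib]
  refine Finset.sum_congr rfl fun j _ => ?_
  have h : dr (fun q => g q j.succ i.succ) p = dr (pert g i.succ j.succ) p := by
    have h1 : (fun q => g q j.succ i.succ) =ᶠ[𝓝 p]
        fun q => pert g i.succ j.succ q - proj i j q := by
      filter_upwards [hg.isOpen_D.mem_nhds hp] with q hq
      rw [pert, minkowski_succ_succ, hg.symm hq]; ring
    have h2 : DifferentiableAt ℝ (pert g i.succ j.succ) p :=
      (hg.differentiableAt hp _ _).fun_sub (differentiableAt_of_smooth (contDiffAt_minkowski hr _ _))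
    have h3 : DifferentiableAt ℝ (proj i j) p :=
      (ScriSmooth.proj (J := Set.univ) i j).differentiableAt ⟨trivial, hr⟩
    rw [dr_congr h1, dr_sub h2 h3, dr_proj hr, sub_zero]
  rw [hg.nablaL_eq hp, hg.christoffel_zero_succ_succ hp, h, hg.symm hp]
  push_cast
  ring

theorem rho_eq (hp : p ∈ D) {m : Fin 4 → ℂ} (hm : IsLegM g p m) :
    rho g p m + 1 / radius p = (1 / 2) * ∑ i : Fin 3, ∑ j : Fin 3,
      (dr (pert g i.succ j.succ) p : ℂ) * m i.succ * conj (m j.succ) := by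
  rw [rho, hg.sum_nablaL hp hm (fun b => conj (m b)) (by simp [hm.tangent_u]), hm.norm]
  ring

theorem shear_eq (hp : p ∈ D) {m : Fin 4 → ℂ} (hm : IsLegM g p m) :
    shear g p m = (1 / 2) * ∑ i : Fin 3, ∑ j : Fin 3,
      (dr (pert g i.succ j.succ) p : ℂ) * m i.succ * m j.succ := by
  rw [shear, hg.sum_nablaL hp hm m hm.tangent_u, hm.null]
  ring

/-- Since l_a is the first basis covector, contracting R_abcd with l^a leaves R^0_bcd. -/
theorem psi0_eq (hp : p ∈ D) {m : Fin 4 → ℂ} (hm : IsLegM g p m) :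
    psi0 g p m = ∑ i : Fin 3, ∑ j : Fin 3,
      ((∑ k : Fin 3, dir k p * riemann g 0 i.succ k.succ j.succ p : ℝ) : ℂ) *
        m i.succ * m j.succ := by
  have h1 : ∀ b c d, ∑ a, riemannLow g a b c d p * lVec p a = riemann g 0 b c d p := by
    intro b c d
    simp only [riemannLow, Finset.sum_mul]
    rw [Finset.sum_comm]
    have : ∀ e, ∑ a, g p a e * riemann g e b c d p * lVec p a =
        (if e = 0 then 1 else 0) * riemann g e b c d p := fun e => by
      rw [← hg.gauge p hp e, lForm, Finset.sum_mul]
      exact Finset.sum_congr rfl fun a _ => by rw [hg.symm hp a e]; ring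
    simp [this]
  have h2 : psi0 g p m = ∑ b, ∑ d, ((∑ c, lVec p c * riemann g 0 b c d p : ℝ) : ℂ) *
      m b * m d := by
    rw [psi0, Finset.sum_comm]
    refine Finset.sum_congr rfl fun b _ => ?_
    simp only [← h1, Complex.ofReal_sum, Complex.ofReal_mul, Finset.sum_mul, Finset.mul_sum]
    rw [Finset.sum_comm_cycle, Finset.sum_comm_cycle]
    rw [Finset.sum_comm]
    refine Finset.sum_congr rfl fun d _ => ?_
    refine Finset.sum_congr rfl fun c _ => Finset.sum_congr rfl fun a _ => ?_
    ring
  rw [h2, hm.sum_mul _ m hm.tangent_u]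
  simp only [Fin.sum_univ_succ (n := 3) (fun c => lVec p c * _), lVec_zero, lVec_succ, zero_mul,
    zero_add]

end IsAsymptoticallyFlat
end NullInfinity
end

/-! ### Orders of the metric, its inverse, the connection and the curvature -/

noncomputable section

namespace NullInfinity

variable {u₀ : ℝ} {J : Set ℝ} {D : Set Pt} {g : MetricField} {p : Pt}

theorem sum_proj_mul {v : Fin 3 → ℝ} (hv : ∑ j, dir j p * v j = 0) (i : Fin 3) :
    ∑ j, proj i j p * v j = v i := by
  have : ∑ j, proj i j p * v j = v i - dir i p * ∑ j, dir j p * v j := by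
    simp only [proj, sub_mul, Finset.sum_sub_distrib, Finset.mul_sum]
    simp [ite_mul, mul_assoc]
  rw [this, hv, mul_zero, sub_zero]

theorem metric_eq (g : MetricField) (i j : Fin 3) : (fun q => g q i.succ j.succ) =
    fun q => pert g i.succ j.succ q - proj i j q := by
  ext q
  rw [pert, minkowski_succ_succ]; ring

theorem contDiffAt_dr {F : Pt → ℝ} (hp : 0 < radius p) (hF : ContDiffAt ℝ ∞ F p) :
    ContDiffAt ℝ ∞ (dr F) p :=
  ContDiffAt.sum fun i _ => (contDiffAt_dir hp i).mul (contDiffAt_pd hF _)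

theorem dr_inv_radius (hp : 0 < radius p) :
    dr (fun q => (radius q)⁻¹) p = -((radius p)⁻¹ * (radius p)⁻¹) := by
  simp only [dr, pd_inv (differentiableAt_radius hp) hp.ne', pd_radius_succ hp]
  have := sum_dir_sq hp
  simp only [mul_neg, Finset.sum_neg_distrib, ← mul_assoc, ← Finset.sum_mul, this, one_mul]

theorem IsSymbol.inv_radius : IsSymbol u₀ (-1) (fun p => (radius p)⁻¹) := by
  simpa using IsSymbol.zpow (u₀ := u₀) (-1)

namespace IsAsymptoticallyFlat

variable (hg : IsAsymptoticallyFlat J D g)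
include hg

theorem contDiffAt_pert (hp : p ∈ D) (a b : Fin 4) : ContDiffAt ℝ ∞ (pert g a b) p :=
  (hg.contDiffAt hp a b).sub (contDiffAt_minkowski (hg.radius_pos hp) a b)

theorem differentiableAt_pert (hp : p ∈ D) (a b : Fin 4) : DifferentiableAt ℝ (pert g a b) p :=
  differentiableAt_of_smooth (hg.contDiffAt_pert hp a b)

theorem pert_symm (hp : p ∈ D) (i j : Fin 3) :
    pert g i.succ j.succ p = pert g j.succ i.succ p := by
  rw [pert, pert, hg.symm hp, minkowski_succ_succ, minkowski_succ_succ, proj_symm]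

theorem sum_dir_mul_pert (hp : p ∈ D) (a : Fin 4) :
    ∑ j : Fin 3, dir j p * pert g j.succ a p = 0 := by
  have hr := hg.radius_pos hp
  simp only [pert, mul_sub, Finset.sum_sub_distrib, hg.sum_dir_mul hp]
  refine Fin.cases ?_ (fun i => ?_) a
  · simp [minkowski_succ_zero, sum_dir_sq hr]
  · simp [minkowski_succ_succ, sum_dir_mul_proj hr, Fin.succ_ne_zero]



theorem differentiableAt_proj (hp : p ∈ D) (i j : Fin 3) : DifferentiableAt ℝ (proj i j) p :=
  (ScriSmooth.proj (J := Set.univ) i j).differentiableAt ⟨trivial, hg.radius_pos hp⟩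

theorem dr_metric (hp : p ∈ D) (i j : Fin 3) :
    dr (fun q => g q i.succ j.succ) p = dr (pert g i.succ j.succ) p := by
  rw [metric_eq g i j, dr_sub (hg.differentiableAt_pert hp _ _)
    (hg.differentiableAt_proj hp i j), dr_proj (hg.radius_pos hp), sub_zero]

theorem isSymbol_pert (hu : u₀ ∈ J) (a b : Fin 4) : IsSymbol u₀ (-1) (pert g a b) := by
  obtain ⟨N, c, -, h⟩ := (hg.polyhom a b).exists_expansion hg.isOpen_J fun u hu => by
    filter_upwards [hg.eventually_mem hu] with p hp using hg.contDiffAt_pert hp a b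
  have h0 := h 0 u₀ hu
  simp only [Finset.range_zero, Finset.sum_empty, sub_zero, Nat.cast_zero] at h0
  exact h0

theorem isSymbol_metric (hu : u₀ ∈ J) (a b : Fin 4) : IsSymbol u₀ 0 (fun p => g p a b) :=
  (((hg.isSymbol_pert hu a b).mono (by norm_num)).add (isSymbol_minkowski a b)).congr
    (Eventually.of_forall fun p => by simp [pert])

theorem isSymbol_inv (hu : u₀ ∈ J) (a b : Fin 4) : IsSymbol u₀ 0 (fun p => (g p)⁻¹ a b) := by
  have hdet : IsSymbol u₀ 0 (fun p => (g p).det) := IsSymbol.det (hg.isSymbol_metric hu)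
  have hsub : IsSymbol u₀ (-1) (fun p => (g p).det - (minkowski p).det) :=
    IsSymbol.det_sub_det (hg.isSymbol_metric hu) isSymbol_minkowski (hg.isSymbol_pert hu)
  have hb : ∀ᶠ p in nearScri u₀, 1 / 2 ≤ |(g p).det| := by
    obtain ⟨N, hN⟩ := hsub.hasOrder
    have h1 : Tendsto (fun x : ℝ => Real.log x ^ N / x) atTop (𝓝 0) := by
      have := (Real.isLittleO_pow_log_id_atTop (n := N)).tendsto_div_nhds_zero
      simpa using this
    have h2 : Tendsto (fun p => radius p ^ (-1 : ℤ) * Real.log (radius p) ^ N) (nearScri u₀) (𝓝 0) :=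
      (h1.comp (tendsto_radius u₀)).congr fun p => by
        simp [div_eq_mul_inv, mul_comm]
    filter_upwards [(hN.trans_tendsto h2).eventually (Metric.ball_mem_nhds 0 one_half_pos),
      eventually_radius_gt u₀ 0] with p h3 h4
    rw [det_minkowski h4, Real.dist_eq, sub_zero, abs_lt] at h3
    rw [le_abs]; right; linarith [h3.2]
  have hinv := IsSymbol.inv one_half_pos hdet hb
  have hadj : IsSymbol u₀ 0 (fun p => (g p).adjugate a b) := by
    simp only [Matrix.adjugate_apply]
    refine IsSymbol.det fun c d => ?_
    by_cases hc : c = b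
    · subst hc; simpa using IsSymbol.const _ le_rfl
    · simpa [Matrix.updateRow_ne hc] using hg.isSymbol_metric hu c d
  refine (hinv.mul hadj (by simp)).congr (Eventually.of_forall fun p => ?_)
  simp [Matrix.inv_def, Ring.inverse_eq_inv']

/-- Resolvent identity: with g₀ the Minkowski metric, g⁻¹ - g₀⁻¹ = -g⁻¹ (g - g₀) g₀⁻¹. -/
theorem isSymbol_inv_sub (hu : u₀ ∈ J) (a b : Fin 4) :
    IsSymbol u₀ (-1) (fun p => (g p)⁻¹ a b - minkowskiInv p a b) := by
  have h : IsSymbol u₀ (-1) (fun p => -∑ c, ∑ d, (g p)⁻¹ a d * pert g d c p * minkowskiInv p c b) :=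
    (IsSymbol.sum _ fun c _ => IsSymbol.sum _ fun d _ => ((hg.isSymbol_inv hu a d).mul
      (hg.isSymbol_pert hu d c) (e := -1) (by simp)).mul (isSymbol_minkowskiInv c b) (by simp)).neg
  refine h.congr ?_
  filter_upwards [hg.eventually_mem hu] with p hp
  have e : (g p)⁻¹ - minkowskiInv p = -((g p)⁻¹ * (g p - minkowski p) * minkowskiInv p) := by
    rw [mul_sub, sub_mul, hg.inv_mul hp, one_mul, mul_assoc,
      minkowski_mul_inv (hg.radius_pos hp), mul_one, neg_sub]
  have e2 := congrFun (congrFun e a) b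
  rw [Matrix.sub_apply, Matrix.neg_apply, Matrix.mul_apply] at e2
  rw [e2]
  simp only [Matrix.mul_apply, Matrix.sub_apply, Finset.sum_mul, pert]

/-- The derivative in u sees only the deviation, which is O(r⁻¹) up to logarithms, and a spatial
derivative gains one order by itself. -/
theorem isSymbol_pd_metric (hu : u₀ ∈ J) (c a b : Fin 4) :
    IsSymbol u₀ (-1) (pd c (fun p => g p a b)) := by
  refine Fin.cases ?_ (fun i => ?_) c
  · refine ((hg.isSymbol_pert hu a b).pd_zero).congr ?_
    filter_upwards [hg.eventually_mem hu] with p hp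
    have hr := hg.radius_pos hp
    rw [show pert g a b = fun p => g p a b - minkowski p a b from rfl,
      pd_sub (hg.differentiableAt hp a b) (differentiableAt_of_smooth (contDiffAt_minkowski hr a b)),
      pd_minkowski_zero hr, sub_zero]
  · exact (hg.isSymbol_metric hu a b).pd_succ i (by simp)

theorem isSymbol_christoffel (hu : u₀ ∈ J) (c a b : Fin 4) :
    IsSymbol u₀ (-1) (christoffel g c a b) :=
  IsSymbol.const_mul _ <| IsSymbol.sum _ fun d _ => (hg.isSymbol_inv hu c d).mul
    (((hg.isSymbol_pd_metric hu _ _ _).add (hg.isSymbol_pd_metric hu _ _ _)).sub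
      (hg.isSymbol_pd_metric hu _ _ _)) (by simp)

theorem christoffel_zero_eq (hp : p ∈ D) (i j : Fin 3) : christoffel g 0 j.succ i.succ p =
    (proj i j p - pert g i.succ j.succ p) * (radius p)⁻¹
      - (1 / 2) * dr (pert g i.succ j.succ) p := by
  rw [hg.christoffel_symm hp, hg.christoffel_zero_succ_succ hp, hg.dr_metric hp,
    show g p i.succ j.succ = pert g i.succ j.succ p - proj i j p by
      rw [pert, minkowski_succ_succ]; ring]
  ring

theorem dr_pert_symm (hp : p ∈ D) (i j : Fin 3) :
    dr (pert g i.succ j.succ) p = dr (pert g j.succ i.succ) p :=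
  dr_congr <| by filter_upwards [hg.isOpen_D.mem_nhds hp] with q hq using hg.pert_symm hq i j

/-- The curvature component is -½ ∂_r²h - r⁻¹ ∂_r h plus terms quadratic in h. The flat
contributions and the terms h/r² cancel, and the quadratic terms are of order r⁻⁴ up to logarithms.
-/
theorem isSymbol_riemann (hu : u₀ ∈ J) (i j : Fin 3) : IsSymbol u₀ (-4) (fun p =>
    ∑ k : Fin 3, dir k p * riemann g 0 i.succ k.succ j.succ p
      + (1 / 2) * dr (dr (pert g i.succ j.succ)) p
      + dr (pert g i.succ j.succ) p * (radius p)⁻¹) := by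
  have hh := fun a b => hg.isSymbol_pert hu a b
  have hdr : ∀ a b, IsSymbol u₀ (-2) (dr (pert g a b)) := fun a b => (hh a b).dr (by norm_num)
  have hs : ∀ m : Fin 3, IsSymbol u₀ (-2) (fun p => -(pert g m.succ j.succ p * (radius p)⁻¹)
      - (1 / 2) * dr (pert g m.succ j.succ) p) := fun m =>
    ((hh _ _).mul IsSymbol.inv_radius (by norm_num)).neg.sub ((hdr _ _).const_mul _)
  have hP : ∀ m : Fin 3, IsSymbol u₀ (-1) (fun p => proj m j p * (radius p)⁻¹) := fun m =>
    (IsSymbol.proj m j).mul IsSymbol.inv_radius (by norm_num)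
  have h1 : IsSymbol u₀ (-4) (fun p => -(1 / 2) * ∑ m : Fin 3, ∑ n : Fin 3,
      ((-(pert g m.succ j.succ p * (radius p)⁻¹) - (1 / 2) * dr (pert g m.succ j.succ) p) *
        ((g p)⁻¹ m.succ n.succ * dr (pert g n.succ i.succ) p) +
      proj m j p * (radius p)⁻¹ * (((g p)⁻¹ m.succ n.succ - minkowskiInv p m.succ n.succ) *
        dr (pert g n.succ i.succ) p))) :=
    IsSymbol.const_mul _ <| IsSymbol.sum _ fun m _ => IsSymbol.sum _ fun n _ =>
      ((hs m).mul ((hg.isSymbol_inv hu _ _).mul (hdr _ _) rfl) (by norm_num)).add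
        ((hP m).mul ((hg.isSymbol_inv_sub hu _ _).mul (hdr _ _) rfl) (by norm_num))
  refine h1.congr ?_
  filter_upwards [hg.eventually_mem hu] with p hp
  have hr := hg.radius_pos hp
  have e1 : dr (christoffel g 0 j.succ i.succ) p =
      -dr (pert g i.succ j.succ) p * (radius p)⁻¹
      - (proj i j p - pert g i.succ j.succ p) * ((radius p)⁻¹ * (radius p)⁻¹)
      - (1 / 2) * dr (dr (pert g i.succ j.succ)) p := by
    have e0 : christoffel g 0 j.succ i.succ =ᶠ[𝓝 p] fun q =>
        (proj i j q - pert g i.succ j.succ q) * (radius q)⁻¹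
        - (1 / 2) * dr (pert g i.succ j.succ) q := by
      filter_upwards [hg.isOpen_D.mem_nhds hp] with q hq using hg.christoffel_zero_eq hq i j
    have d1 := hg.differentiableAt_proj hp i j
    have d2 := hg.differentiableAt_pert hp i.succ j.succ
    have d3 := (differentiableAt_radius hr).fun_inv hr.ne'
    have d4 : DifferentiableAt ℝ (dr (pert g i.succ j.succ)) p :=
      differentiableAt_of_smooth (contDiffAt_dr hr (hg.contDiffAt_pert hp _ _))
    rw [dr_congr e0, dr_sub ((d1.fun_sub d2).fun_mul d3) ((differentiableAt_const _).fun_mul d4),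
      dr_mul (d1.fun_sub d2) d3, dr_sub d1 d2, dr_proj hr, dr_inv_radius hr,
      dr_mul (differentiableAt_const _) d4, dr_const]
    ring
  have e2 : ∑ m : Fin 3, proj j m p * dr (pert g m.succ i.succ) p =
      dr (pert g i.succ j.succ) p := by
    rw [hg.dr_pert_symm hp i j]
    refine sum_proj_mul ?_ j
    rw [← hg.dr_sum_eq_zero hp i.succ]
    exact Finset.sum_congr rfl fun m _ => by rw [hg.dr_metric hp]
  have e3 : ∀ m : Fin 3, ∑ n : Fin 3, proj m j p * (radius p)⁻¹ * (minkowskiInv p m.succ n.succ *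
      dr (pert g n.succ i.succ) p) = -((radius p)⁻¹ * (proj j m p * dr (pert g m.succ i.succ) p)) :=
    fun m => by
      rw [← Finset.mul_sum]
      simp [minkowskiInv, proj_symm m j]
      ring
  have e4 : ∑ m : Fin 3, ∑ n : Fin 3, christoffel g 0 j.succ m.succ p *
      ((g p)⁻¹ m.succ n.succ * dr (fun q => g q n.succ i.succ) p) =
      ∑ m : Fin 3, ∑ n : Fin 3,
      ((-(pert g m.succ j.succ p * (radius p)⁻¹) - (1 / 2) * dr (pert g m.succ j.succ) p) *
        ((g p)⁻¹ m.succ n.succ * dr (pert g n.succ i.succ) p) +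
      proj m j p * (radius p)⁻¹ * (((g p)⁻¹ m.succ n.succ - minkowskiInv p m.succ n.succ) *
        dr (pert g n.succ i.succ) p)) - (radius p)⁻¹ * dr (pert g i.succ j.succ) p := by
    have : (radius p)⁻¹ * dr (pert g i.succ j.succ) p = -∑ m : Fin 3, ∑ n : Fin 3,
        proj m j p * (radius p)⁻¹ * (minkowskiInv p m.succ n.succ *
        dr (pert g n.succ i.succ) p) := by
      simp only [e3, Finset.sum_neg_distrib, neg_neg, ← Finset.mul_sum, e2]
    rw [this, sub_neg_eq_add]
    simp only [← Finset.sum_add_distrib]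
    refine Finset.sum_congr rfl fun m _ => Finset.sum_congr rfl fun n _ => ?_
    rw [hg.christoffel_zero_eq hp, hg.dr_metric hp]
    ring
  rw [hg.sum_dir_mul_riemann hp, e1, e4, hg.christoffel_zero_eq hp]
  ring

end IsAsymptoticallyFlat

/-! ### Existence of null tetrads along the generators -/

/-- The vector e is the horizontal part of x turned by a right angle, or a coordinate vector at the
poles, and f = x × e. The completeness relation is the orthogonality of the columns of the matrix
with rows x, e, f. -/
theorem exists_orthonormal_tangent {x : Fin 3 → ℝ} (hx : ∑ i, x i * x i = 1) :
    ∃ e f : Fin 3 → ℝ, ∑ i, x i * e i = 0 ∧ ∑ i, x i * f i = 0 ∧ ∑ i, e i * e i = 1 ∧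
      ∑ i, f i * f i = 1 ∧ ∑ i, e i * f i = 0 ∧
      ∀ i j, e i * e j + f i * f j = (if i = j then 1 else 0) - x i * x j := by
  have h1 : ∃ e : Fin 3 → ℝ, ∑ i, x i * e i = 0 ∧ ∑ i, e i * e i = 1 := by
    by_cases h : x 0 = 0 ∧ x 1 = 0
    · exact ⟨![1, 0, 0], by simp [Fin.sum_univ_three, h.1], by simp [Fin.sum_univ_three]⟩
    · have hs : 0 < x 0 ^ 2 + x 1 ^ 2 := by
        rcases not_and_or.1 h with h | h
        · have := pow_pos (abs_pos.2 h) 2; rw [sq_abs] at this; nlinarith [sq_nonneg (x 1)]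
        · have := pow_pos (abs_pos.2 h) 2; rw [sq_abs] at this; nlinarith [sq_nonneg (x 0)]
      have hq := Real.sq_sqrt hs.le
      have hq0 := Real.sqrt_pos.2 hs
      refine ⟨![-x 1 / √(x 0 ^ 2 + x 1 ^ 2), x 0 / √(x 0 ^ 2 + x 1 ^ 2), 0], ?_, ?_⟩
      · simp [Fin.sum_univ_three]; ring
      · simp [Fin.sum_univ_three]; field_simp; linarith
  obtain ⟨e, hxe, hee⟩ := h1
  rw [Fin.sum_univ_three] at hx hxe hee
  let f : Fin 3 → ℝ := ![x 1 * e 2 - x 2 * e 1, x 2 * e 0 - x 0 * e 2, x 0 * e 1 - x 1 * e 0]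
  have hxf : x 0 * f 0 + x 1 * f 1 + x 2 * f 2 = 0 := by simp [f]; ring
  have hef : e 0 * f 0 + e 1 * f 1 + e 2 * f 2 = 0 := by simp [f]; ring
  have hff : f 0 * f 0 + f 1 * f 1 + f 2 * f 2 = 1 := by
    simp [f]
    linear_combination (e 0 * e 0 + e 1 * e 1 + e 2 * e 2) * hx + hee
      - (x 0 * e 0 + x 1 * e 1 + x 2 * e 2) * hxe
  have hM : (!![x 0, x 1, x 2; e 0, e 1, e 2; f 0, f 1, f 2] : Matrix (Fin 3) (Fin 3) ℝ) *
      !![x 0, e 0, f 0; x 1, e 1, f 1; x 2, e 2, f 2] = 1 := by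
    ext i j
    fin_cases i <;> fin_cases j <;> simp [Matrix.mul_apply, Fin.sum_univ_three] <;> linarith
  have hM' := mul_eq_one_comm.1 hM
  refine ⟨e, f, ?_, ?_, ?_, ?_, ?_, fun i j => ?_⟩
  · rwa [Fin.sum_univ_three]
  · rwa [Fin.sum_univ_three]
  · rwa [Fin.sum_univ_three]
  · rwa [Fin.sum_univ_three]
  · rwa [Fin.sum_univ_three]
  · have := congrFun (congrFun hM' i) j
    rw [Matrix.one_apply] at this
    rw [← this, Matrix.mul_apply, Fin.sum_univ_three]
    fin_cases i <;> fin_cases j <;> simp <;> ring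

/-- The components of the leg of a null dyad of the positive form `(a b; b c)`. -/
def legCoeff (v : ℝ × ℝ × ℝ) : ℂ × ℂ :=
  let w := √(v.2.2 / 2) / √(v.1 * v.2.2 - v.2.1 ^ 2)
  ((w : ℂ), ((-(v.2.1 / v.2.2) * w : ℝ) : ℂ) + ((√(v.2.2 / 2) / v.2.2 : ℝ) : ℂ) * Complex.I)

theorem legCoeff_base :
    legCoeff (1, 0, 1) = (((√(1 / 2) : ℝ) : ℂ), ((√(1 / 2) : ℝ) : ℂ) * Complex.I) := by
  simp [legCoeff]

theorem legCoeff_null {a b c : ℝ} (hc : 0 < c) (hd : 0 < a * c - b ^ 2) :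
    (a : ℂ) * (legCoeff (a, b, c)).1 ^ 2 + 2 * b * (legCoeff (a, b, c)).1 * (legCoeff (a, b, c)).2
      + c * (legCoeff (a, b, c)).2 ^ 2 = 0 := by
  have h1 : (√(c / 2) : ℝ) ^ 2 = c / 2 := Real.sq_sqrt (by positivity)
  have h2 := Real.sq_sqrt hd.le
  have h3 := Real.sqrt_pos.2 hd
  simp only [legCoeff]
  generalize √(c / 2) = s at h1
  generalize √(a * c - b ^ 2) = t at h2 h3
  apply Complex.ext
  · simp [pow_two]
    field_simp
    linear_combination -s ^ 2 * h2
  · simp [pow_two]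
    field_simp
    ring

theorem legCoeff_norm {a b c : ℝ} (hc : 0 < c) (hd : 0 < a * c - b ^ 2) :
    (a : ℂ) * (legCoeff (a, b, c)).1 * conj (legCoeff (a, b, c)).1
      + b * ((legCoeff (a, b, c)).1 * conj (legCoeff (a, b, c)).2
        + (legCoeff (a, b, c)).2 * conj (legCoeff (a, b, c)).1)
      + c * (legCoeff (a, b, c)).2 * conj (legCoeff (a, b, c)).2 = 1 := by
  have h1 : (√(c / 2) : ℝ) ^ 2 = c / 2 := Real.sq_sqrt (by positivity)
  have h2 := Real.sq_sqrt hd.le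
  have h3 := Real.sqrt_pos.2 hd
  simp only [legCoeff]
  generalize √(c / 2) = s at h1
  generalize √(a * c - b ^ 2) = t at h2 h3
  apply Complex.ext
  · simp
    field_simp
    linear_combination 2 * t ^ 2 * h1 - s ^ 2 * h2
  · simp
    field_simp
    ring

/-- Differentiability at the identity form makes the error of the leg linear in the perturbation of
the form, so that the leg converges at the rate r⁻¹ log^N r of the metric. -/
theorem differentiableAt_legCoeff : DifferentiableAt ℝ legCoeff (1, 0, 1) := by
  have h1 : ContDiffAt ℝ 1 (fun v : ℝ × ℝ × ℝ => √(v.2.2 / 2)) (1, 0, 1) :=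
    ContDiffAt.sqrt (by fun_prop) (by norm_num)
  have h2 : ContDiffAt ℝ 1 (fun v : ℝ × ℝ × ℝ => √(v.1 * v.2.2 - v.2.1 ^ 2)) (1, 0, 1) :=
    ContDiffAt.sqrt (by fun_prop) (by norm_num)
  have h3 : ContDiffAt ℝ 1 (fun v : ℝ × ℝ × ℝ => √(v.2.2 / 2) / √(v.1 * v.2.2 - v.2.1 ^ 2))
      (1, 0, 1) := h1.div h2 (by norm_num)
  have h0 : ContDiffAt ℝ 1 (fun v : ℝ × ℝ × ℝ => v.2.2) (1, 0, 1) := by fun_prop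
  have h0' : ContDiffAt ℝ 1 (fun v : ℝ × ℝ × ℝ => v.2.1) (1, 0, 1) := by fun_prop
  have h4 : ContDiffAt ℝ 1 (fun v : ℝ × ℝ × ℝ => -(v.2.1 / v.2.2)) (1, 0, 1) :=
    (h0'.div h0 one_ne_zero).neg
  have h5 : ContDiffAt ℝ 1 (fun v : ℝ × ℝ × ℝ => √(v.2.2 / 2) / v.2.2) (1, 0, 1) :=
    h1.div h0 one_ne_zero
  have ho : ∀ {f : ℝ × ℝ × ℝ → ℝ}, ContDiffAt ℝ 1 f (1, 0, 1) →
      DifferentiableAt ℝ (fun v => (f v : ℂ)) (1, 0, 1) := fun h =>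
    Complex.ofRealCLM.differentiableAt.comp _ (h.differentiableAt one_ne_zero)
  exact (ho h3).prodMk ((ho (h4.mul h3)).add ((ho h5).mul (differentiableAt_const _)))

theorem isLegM_of_coeff (hs : ∀ i j : Fin 3, g p i.succ j.succ = g p j.succ i.succ)
    (hr : 0 < radius p) {e f : Fin 3 → ℝ} (he : ∑ i, dir i p * e i = 0)
    (hf : ∑ i, dir i p * f i = 0) {a b c : ℝ} (ha : ∑ i, ∑ j, g p i.succ j.succ * e i * e j = -a)
    (hb : ∑ i, ∑ j, g p i.succ j.succ * e i * f j = -b)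
    (hc : ∑ i, ∑ j, g p i.succ j.succ * f i * f j = -c) (hc0 : 0 < c) (hd : 0 < a * c - b ^ 2) :
    IsLegM g p (Fin.cons 0 fun i => (legCoeff (a, b, c)).1 * e i + (legCoeff (a, b, c)).2 * f i) := by
  have hn := legCoeff_null hc0 hd
  have hm := legCoeff_norm hc0 hd
  set v := legCoeff (a, b, c)
  obtain ⟨q, hq⟩ : ∃ q : Fin 3 → Fin 3 → ℝ, ∀ i j, g p i.succ j.succ = q i j := ⟨_, fun _ _ => rfl⟩
  simp only [hq] at hs ha hb hc
  have s01 := hs 0 1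
  have s02 := hs 0 2
  have s12 := hs 1 2
  rw [Fin.sum_univ_three] at he hf
  simp only [Fin.sum_univ_three] at ha hb hc
  rw [← s01, ← s02, ← s12] at ha hb hc
  have he' := congrArg (fun y : ℝ => (y : ℂ)) he
  have hf' := congrArg (fun y : ℝ => (y : ℂ)) hf
  have ha' := congrArg (fun y : ℝ => (y : ℂ)) ha
  have hb' := congrArg (fun y : ℝ => (y : ℂ)) hb
  have hc' := congrArg (fun y : ℝ => (y : ℂ)) hc
  push_cast at he' hf' ha' hb' hc'
  have hdir : ∀ i, (p (Fin.succ i) : ℂ) = radius p * dir i p := fun i => by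
    have := hr.ne'
    rw [dir, ← Complex.ofReal_mul, mul_div_cancel₀ _ this]
  refine ⟨rfl, ?_, ?_, ?_⟩
  · simp only [Fin.sum_univ_three, Fin.cons_succ, hdir]
    linear_combination (radius p * v.1) * he' + (radius p * v.2) * hf'
  · simp only [Fin.sum_univ_succ (n := 3), Fin.cons_zero, Fin.cons_succ, mul_zero, zero_mul,
      zero_add, hq, Fin.sum_univ_three, ← s01, ← s02, ← s12]
    linear_combination v.1 ^ 2 * ha' + 2 * v.1 * v.2 * hb' + v.2 ^ 2 * hc' - hn
  · simp only [Fin.sum_univ_succ (n := 3), Fin.cons_zero, Fin.cons_succ, mul_zero, zero_mul,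
      zero_add, hq, Fin.sum_univ_three, ← s01, ← s02, ← s12, map_add, map_mul,
      Complex.conj_ofReal, map_zero]
    linear_combination v.1 * conj v.1 * ha' + (v.1 * conj v.2 + v.2 * conj v.1) * hb'
      + v.2 * conj v.2 * hc' - hm

end NullInfinity
end

noncomputable section

namespace NullInfinity

variable {u₀ : ℝ} {J : Set ℝ} {D : Set Pt} {g : MetricField} {p : Pt}

theorem sum_proj_mul_mul {e f : Fin 3 → ℝ} (he : ∑ i, dir i p * e i = 0) :
    ∑ i, ∑ j, proj i j p * e i * f j = ∑ i, e i * f i := by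
  have h : ∑ i, ∑ j, proj i j p * e i * f j =
      ∑ i, e i * f i - (∑ i, dir i p * e i) * ∑ j, dir j p * f j := by
    simp only [proj, Fin.sum_univ_three]
    simp
    ring
  rw [h, he, zero_mul, sub_zero]

/-- A null tetrad along a generator, with its rate of convergence. -/
theorem IsAsymptoticallyFlat.exists_leg (hg : IsAsymptoticallyFlat J D g) (hp : p ∈ region J)
    {e f : Fin 3 → ℝ} (hxe : ∑ i, dir i p * e i = 0) (hxf : ∑ i, dir i p * f i = 0)
    (hee : ∑ i, e i * e i = 1) (hff : ∑ i, f i * f i = 1) (hef : ∑ i, e i * f i = 0) :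
    ∃ (m : ℝ → Fin 4 → ℂ) (N : ℕ), (∀ᶠ t in atTop, IsLegM g (dilate t p) (m t)) ∧
      ∀ i : Fin 3, (fun t => m t i.succ - (√(1 / 2) : ℝ) * (e i + Complex.I * f i)) =O[atTop]
        fun t => radius (dilate t p) ^ (-1 : ℤ) * Real.log (radius (dilate t p)) ^ N := by
  have hu : p 0 ∈ J := hp.1
  let A : (Fin 3 → ℝ) → (Fin 3 → ℝ) → Pt → ℝ := fun e f q =>
    ∑ i, ∑ j, pert g i.succ j.succ q * e i * f j
  have hA : ∀ e f, HasOrder (p 0) (-1) (A e f) := fun e f => by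
    have h : IsSymbol (p 0) (-1) (A e f) := IsSymbol.sum _ fun i _ => IsSymbol.sum _ fun j _ =>
      ((hg.isSymbol_pert hu _ _).mul (IsSymbol.const _ le_rfl) (e := -1) (by simp)).mul
        (IsSymbol.const _ le_rfl) (by simp)
    exact h.hasOrder
  obtain ⟨N₁, h1⟩ := hA e e
  obtain ⟨N₂, h2⟩ := hA e f
  obtain ⟨N₃, h3⟩ := hA f f
  let N := N₁ + N₂ + N₃
  let ψ : ℝ → ℝ := fun t => radius (dilate t p) ^ (-1 : ℤ) * Real.log (radius (dilate t p)) ^ N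
  have hray := tendsto_dilate hp.2
  have hψ : Tendsto ψ atTop (𝓝 0) :=
    HasOrder.tendsto_zero_along (u₀ := p 0) (d := -1) ⟨N, isBigO_refl _ _⟩ le_rfl hray
  have b1 := (h1.trans (isBigO_order_mono (M := N) le_rfl (by omega))).comp_tendsto hray
  have b2 := (h2.trans (isBigO_order_mono (M := N) le_rfl (by omega))).comp_tendsto hray
  have b3 := (h3.trans (isBigO_order_mono (M := N) le_rfl (by omega))).comp_tendsto hray
  -- The Gram matrix of -g on the plane spanned by e and f, with entries ee, ef, ff; the
  -- contractions `A` of the deviation are its distance from the identity.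
  let v : ℝ → ℝ × ℝ × ℝ := fun t =>
    (1 - A e e (dilate t p), -A e f (dilate t p), 1 - A f f (dilate t p))
  have hv : (fun t => v t - (1, 0, 1)) =O[atTop] ψ := by
    have : (fun t => v t - (1, 0, 1)) = fun t =>
        (-A e e (dilate t p), -A e f (dilate t p), -A f f (dilate t p)) := by
      ext t <;> simp [v]
    rw [this]
    exact b1.neg_left.prod_left (b2.neg_left.prod_left b3.neg_left)
  have hv0 : Tendsto v atTop (𝓝 (1, 0, 1)) := by
    have := (hv.trans_tendsto hψ).add_const ((1 : ℝ), (0 : ℝ), (1 : ℝ))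
    simpa using this
  have hc : (fun t => legCoeff (v t) - legCoeff (1, 0, 1)) =O[atTop] ψ :=
    (differentiableAt_legCoeff.isBigO_sub.comp_tendsto hv0).trans hv
  refine ⟨fun t => Fin.cons 0 fun i => (legCoeff (v t)).1 * e i + (legCoeff (v t)).2 * f i, N,
    ?_, fun i => ?_⟩
  · have hD := hray.eventually (hg.eventually_mem hu)
    have c1 : ∀ᶠ t in atTop, 0 < (v t).2.2 :=
      (continuous_snd.snd.continuousAt.tendsto.comp hv0).eventually (lt_mem_nhds (by norm_num))
    have c2 : ∀ᶠ t in atTop, 0 < (v t).1 * (v t).2.2 - (v t).2.1 ^ 2 := by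
      have : Continuous fun w : ℝ × ℝ × ℝ => w.1 * w.2.2 - w.2.1 ^ 2 := by fun_prop
      exact (this.continuousAt.tendsto.comp hv0).eventually (lt_mem_nhds (by norm_num))
    filter_upwards [hD, c1, c2, eventually_gt_atTop 0] with t hD h1 h2 ht
    have hq : ∀ e f : Fin 3 → ℝ, ∑ i, dir i p * e i = 0 →
        ∑ i, ∑ j, g (dilate t p) i.succ j.succ * e i * f j =
        -(∑ i, e i * f i - A e f (dilate t p)) := fun e f he => by
      rw [← sum_proj_mul_mul (p := dilate t p) (by simpa only [dir_dilate ht] using he), neg_sub]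
      simp only [A, ← Finset.sum_sub_distrib]
      refine Finset.sum_congr rfl fun i _ => Finset.sum_congr rfl fun j _ => ?_
      rw [pert, minkowski_succ_succ]; ring
    refine isLegM_of_coeff (fun i j => hg.symm hD _ _) (hg.radius_pos hD)
      (by simpa only [dir_dilate ht] using hxe) (by simpa only [dir_dilate ht] using hxf)
      (by rw [hq e e hxe, hee]) (by rw [hq e f hxe, hef, zero_sub]) (by rw [hq f f hxf, hff]) h1 h2
  · have k1 : (fun t => (legCoeff (v t)).1 - (legCoeff (1, 0, 1)).1) =O[atTop] ψ :=
      (isBigO_fst_prod (f' := fun t => (legCoeff (v t) - legCoeff (1, 0, 1)).1)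
        (g' := fun t => (legCoeff (v t) - legCoeff (1, 0, 1)).2) (l := atTop)).trans hc
    have k2 : (fun t => (legCoeff (v t)).2 - (legCoeff (1, 0, 1)).2) =O[atTop] ψ :=
      (isBigO_snd_prod (f' := fun t => (legCoeff (v t) - legCoeff (1, 0, 1)).1)
        (g' := fun t => (legCoeff (v t) - legCoeff (1, 0, 1)).2) (l := atTop)).trans hc
    refine ((k1.const_mul_left (e i : ℂ)).add (k2.const_mul_left (f i : ℂ))).congr_left fun t => ?_
    simp only [legCoeff_base, Fin.cons_succ]
    ring

/-- Contractions with a null tetrad of a tensor along a generator: the tetrad can be replaced by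
its limit. -/
theorem tendsto_contraction_sub {m n : ℝ → Fin 4 → ℂ} {μ ν : Fin 3 → ℂ} {N : ℕ}
    (hp : 0 < radius p)
    (hm : ∀ i : Fin 3, (fun t => m t i.succ - μ i) =O[atTop]
      fun t => radius (dilate t p) ^ (-1 : ℤ) * Real.log (radius (dilate t p)) ^ N)
    (hn : ∀ i : Fin 3, (fun t => n t i.succ - ν i) =O[atTop]
      fun t => radius (dilate t p) ^ (-1 : ℤ) * Real.log (radius (dilate t p)) ^ N)
    {T : Fin 3 → Fin 3 → Pt → ℝ} (hT : ∀ i j, HasOrder (p 0) 0 (T i j)) :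
    Tendsto (fun t => ∑ i : Fin 3, ∑ j : Fin 3, (T i j (dilate t p) : ℂ) * m t i.succ * n t j.succ
      - ∑ i : Fin 3, ∑ j : Fin 3, (T i j (dilate t p) : ℂ) * μ i * ν j) atTop (𝓝 0) := by
  have hray := tendsto_dilate hp
  have hψ : Tendsto (fun t => radius (dilate t p) ^ (-1 : ℤ) *
      Real.log (radius (dilate t p)) ^ N) atTop (𝓝 0) :=
    HasOrder.tendsto_zero_along (u₀ := p 0) (d := -1) ⟨N, isBigO_refl _ _⟩ le_rfl hray
  have hn1 : ∀ j : Fin 3, (fun t => n t j.succ) =O[atTop] fun _ => (1 : ℝ) := fun j => by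
    have h := ((hn j).trans_tendsto hψ).add_const (ν j)
    simp only [sub_add_cancel, zero_add] at h
    exact h.isBigO_one ℝ
  simp only [← Finset.sum_sub_distrib]
  rw [show (0 : ℂ) = ∑ i : Fin 3, ∑ j : Fin 3, 0 by simp]
  refine tendsto_finsetSum _ fun i _ => tendsto_finsetSum _ fun j _ => ?_
  obtain ⟨M, hM⟩ := hT i j
  have hM' := Complex.isBigO_ofReal_left.2 (hM.comp_tendsto hray)
  have k : (fun t => m t i.succ * n t j.succ - μ i * ν j) =O[atTop]
      fun t => radius (dilate t p) ^ (-1 : ℤ) * Real.log (radius (dilate t p)) ^ N := by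
    have h1 := (hm i).mul (hn1 j)
    have h2 := (hn j).const_mul_left (μ i)
    refine ((h1.congr_right fun t => by rw [mul_one]).add h2).congr_left fun t => ?_
    ring
  have h3 := hM'.mul k
  -- The error r⁻¹ log^N r of the tetrad outweighs the growth log^M r that is allowed for the
  -- tensor.
  have h4 : Tendsto (fun t => radius (dilate t p) ^ (-1 : ℤ) *
      Real.log (radius (dilate t p)) ^ (M + N)) atTop (𝓝 0) :=
    HasOrder.tendsto_zero_along (u₀ := p 0) (d := -1) ⟨M + N, isBigO_refl _ _⟩ le_rfl hray
  refine (h3.trans_tendsto (h4.congr fun t => ?_)).congr fun t => ?_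
  · simp [pow_add]; ring
  · simp only [Function.comp_apply]; ring

/-! ### Polynomials in `log r` along the generators -/

open Polynomial in
/-- Along the generators `F` is a polynomial in `log r` times `r ^ d`. -/
structure IsRayPoly (J : Set ℝ) (H : Pt → ℝ[X]) (d : ℤ) (F : Pt → ℝ) : Prop where
  contDiffAt : ∀ p ∈ region J, ContDiffAt ℝ ∞ F p
  value : ∀ p ∈ region J, ∀ t : ℝ, 0 < t → F (dilate t p) =
    (H p).eval (Real.log (t * radius p)) * (t * radius p) ^ d

-- ∂_r (P(log r) r^d) = (P' + d P)(log r) r^(d-1). Differential equations in r thus become equations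
-- between polynomials in log r.
open Polynomial in
theorem IsRayPoly.dr {H : Pt → ℝ[X]} {d : ℤ} {F : Pt → ℝ} (h : IsRayPoly J H d F) :
    IsRayPoly J (fun p => derivative (H p) + C (d : ℝ) * H p) (d - 1) (dr F) where
  contDiffAt p hp := contDiffAt_dr hp.2 (h.contDiffAt p hp)
  value p hp t ht := by
    have hr := hp.2
    have htr : 0 < t * radius p := mul_pos ht hr
    have h1 := hasDerivAt_along_ray ht hr
      (differentiableAt_of_smooth (h.contDiffAt _ (dilate_mem_region hp ht)))
    have h2 : HasDerivAt (fun s => s * radius p) (radius p) t := by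
      simpa using (hasDerivAt_id t).mul_const (radius p)
    have h3 := h2.log htr.ne'
    have h4 : HasDerivAt (fun s => (H p).eval (Real.log (s * radius p))) _ t :=
      ((H p).hasDerivAt _).comp t h3
    have h5' := (hasDerivAt_zpow d (t * radius p) (Or.inl htr.ne')).comp t h2
    have h5 : HasDerivAt (fun s => (s * radius p) ^ d) _ t := h5'
    have h6 := (h4.mul h5).congr_of_eventuallyEq (f₁ := fun s => F (dilate s p)) (by
      filter_upwards [lt_mem_nhds ht] with s hs using h.value p hp s hs)
    have h7 := h1.unique h6
    refine mul_left_cancel₀ hr.ne' (h7.trans ?_)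
    rw [eval_add, eval_mul, eval_C, zpow_sub_one₀ htr.ne']
    field_simp

open Polynomial in
theorem isRayPoly_sum_term {c : ℕ → Pt → ℝ} (hc : ∀ k, ScriSmooth J (c k)) (N : ℕ)
    (d : ℤ) : IsRayPoly J (fun p => ∑ k ∈ Finset.range N, C (c k p) * X ^ k) d
      (fun p => ∑ k ∈ Finset.range N, term (c k) k d p) where
  contDiffAt p hp := ContDiffAt.sum fun k _ => contDiffAt_term ((hc k).contDiffAt p hp) hp.2 _ _
  value p hp t ht := by
    simp only [term, (hc _).dilate p hp t ht, radius_dilate ht.le, eval_finsetSum, eval_mul, eval_C,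
      eval_pow, eval_X, Finset.sum_mul]

open Polynomial in
theorem IsRayPoly.tendsto {H : Pt → ℝ[X]} {d : ℤ} {M F : Pt → ℝ} (h : IsRayPoly J H d M)
    (hp : p ∈ region J) (hF : HasOrder (p 0) (d - 1) fun q => F q - M q) :
    Tendsto (fun t => radius (dilate t p) ^ (-d) * F (dilate t p)
      - (H p).eval (Real.log (t * radius p))) atTop (𝓝 0) := by
  have h1 := (IsSymbol.zpow (u₀ := p 0) (-d)).hasOrder.mul hF (e := -1) (by ring)
  refine (h1.tendsto_zero_along le_rfl (tendsto_dilate hp.2)).congr' ?_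
  filter_upwards [eventually_gt_atTop 0] with t ht
  have htr : 0 < t * radius p := mul_pos ht hp.2
  rw [h.value p hp t ht, radius_dilate ht.le, mul_sub, zpow_neg]
  have := (zpow_pos htr d).ne'
  field_simp

-- The equation P' = P, to which the absence of logarithms is reduced several times, is solved only
-- by exponentials among the smooth functions; a nonzero polynomial loses degree under
-- differentiation.
open Polynomial in
theorem eq_zero_of_derivative_eq_self {P : ℝ[X]} (h : derivative P = P) : P = 0 := by
  by_contra h0
  have := degree_derivative_lt h0
  rw [h] at this
  exact lt_irrefl _ this

open Polynomial in
theorem eq_C_of_derivative_derivative_eq {P : ℝ[X]} (h : derivative (derivative P) = derivative P) :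
    P = C (P.coeff 0) :=
  eq_C_of_derivative_eq_zero (eq_zero_of_derivative_eq_self h)

end NullInfinity
end

/-! ### Absence of logarithms in the leading angular metric -/

noncomputable section

namespace NullInfinity

variable {u₀ : ℝ} {J : Set ℝ} {D : Set Pt} {g : MetricField} {p : Pt}

/-- A transversal trace-free symmetric tensor vanishes if its contractions with a null dyad do. -/
theorem eq_zero_of_contractions {x e f : Fin 3 → ℝ} {T : Fin 3 → Fin 3 → ℝ}
    (hef : ∀ i j, e i * e j + f i * f j = (if i = j then 1 else 0) - x i * x j)
    (hs : ∀ i j, T i j = T j i) (hx : ∀ i, ∑ j, x j * T j i = 0) (ht : ∑ i, T i i = 0)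
    (h1 : ∑ i, ∑ j, T i j * (e i * e j - f i * f j) = 0)
    (h2 : ∑ i, ∑ j, T i j * (e i * f j + f i * e j) = 0) (i j : Fin 3) : T i j = 0 := by
  have h0 : ∑ i, ∑ j, T i j * (e i * e j + f i * f j) = 0 := by
    simp only [hef, mul_sub, Finset.sum_sub_distrib]
    have : ∑ i, ∑ j, T i j * (x i * x j) = ∑ i, x i * ∑ j, x j * T j i := by
      simp only [Finset.mul_sum]
      exact Finset.sum_congr rfl fun i _ => Finset.sum_congr rfl fun j _ => by rw [hs]; ring
    rw [this]
    simp [hx, ht]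
  have hP : ∀ i j, T i j = ∑ k, (e i * e k + f i * f k) * T k j := fun i j => by
    simp only [hef, sub_mul, Finset.sum_sub_distrib, mul_assoc, ← Finset.mul_sum, hx]
    simp
  -- T is unchanged by the projection ee + ff on either side, so its components are combinations of
  -- the three contractions `h0`, `h1` and `h2`.
  have hP2 : T i j = ∑ k, ∑ l, (e i * e k + f i * f k) * (e j * e l + f j * f l) * T k l := by
    rw [hP i j]
    refine Finset.sum_congr rfl fun k _ => ?_
    rw [hs k j, hP j k, Finset.mul_sum]
    exact Finset.sum_congr rfl fun l _ => by rw [hs l k]; ring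
  have s01 := hs 0 1
  have s02 := hs 0 2
  have s12 := hs 1 2
  rw [hP2]
  simp only [Fin.sum_univ_three, ← s01, ← s02, ← s12] at h0 h1 h2 ⊢
  linear_combination (1 / 2) * (e i * e j + f i * f j) * h0 + (1 / 2) * (e i * e j - f i * f j) * h1
    + (1 / 2) * (e i * f j + f i * e j) * h2

theorem re_null_mul_conj (e f : Fin 3 → ℝ) (i j : Fin 3) :
    (((√(1 / 2) : ℝ) * (e i + Complex.I * f i)) *
      conj ((√(1 / 2) : ℝ) * (e j + Complex.I * f j) : ℂ)).re = (1 / 2) * (e i * e j + f i * f j) := by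
  have h : √(1 / 2) * √(1 / 2) = (1 / 2 : ℝ) := Real.mul_self_sqrt (by norm_num)
  generalize √(1 / 2) = s at h
  simp
  linear_combination (e i * e j + f i * f j) * h

theorem null_mul_null (e f : Fin 3 → ℝ) (i j : Fin 3) :
    ((√(1 / 2) : ℝ) * (e i + Complex.I * f i)) * ((√(1 / 2) : ℝ) * (e j + Complex.I * f j)) =
      (((1 / 2) * (e i * e j - f i * f j) : ℝ) : ℂ) +
        (((1 / 2) * (e i * f j + f i * e j) : ℝ) : ℂ) * Complex.I := by
  have h : √(1 / 2) * √(1 / 2) = (1 / 2 : ℝ) := Real.mul_self_sqrt (by norm_num)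
  generalize √(1 / 2) = s at h
  apply Complex.ext
  · simp
    linear_combination (e i * e j - f i * f j) * h
  · simp
    linear_combination (e i * f j + f i * e j) * h

theorem tendsto_sum_sum_sub {T S : Fin 3 → Fin 3 → ℝ → ℝ}
    (h : ∀ i j, Tendsto (fun t => T i j t - S i j t) atTop (𝓝 0)) (a : Fin 3 → Fin 3 → ℝ)
    (hT : Tendsto (fun t => ∑ i, ∑ j, T i j t * a i j) atTop (𝓝 0)) :
    Tendsto (fun t => ∑ i, ∑ j, S i j t * a i j) atTop (𝓝 0) := by
  have h1 : Tendsto (fun t => ∑ i, ∑ j, (T i j t - S i j t) * a i j) atTop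
      (𝓝 (∑ i : Fin 3, ∑ j : Fin 3, 0 * a i j)) :=
    tendsto_finsetSum _ fun i _ => tendsto_finsetSum _ fun j _ => (h i j).mul_const _
  have h2 := hT.sub h1
  simp only [zero_mul, Finset.sum_const_zero, sub_zero, ← Finset.sum_sub_distrib] at h2
  exact h2.congr fun t => by simp only [← sub_mul, sub_sub_cancel]

open Polynomial in
theorem poly_eval_sum_eq_zero {P : Fin 3 → Fin 3 → ℝ[X]} {x : ℝ} (hx : 0 < x)
    (a : Fin 3 → Fin 3 → ℝ)
    (h : Tendsto (fun t => ∑ i, ∑ j, (P i j).eval (Real.log (t * x)) * a i j) atTop (𝓝 0)) :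
    ∑ i, ∑ j, P i j * C (a i j) = 0 := by
  have := poly_eq_of_tendsto_log (P := ∑ i, ∑ j, P i j * C (a i j)) (l := 0) hx
    (by simpa [eval_finsetSum] using h)
  simpa using this

namespace IsAsymptoticallyFlat

variable (hg : IsAsymptoticallyFlat J D g)
include hg

theorem tendsto_rho (hp : p ∈ region J) {m : ℝ → Fin 4 → ℂ}
    (hm : ∀ᶠ t in atTop, IsLegM g (dilate t p) (m t)) :
    Tendsto (fun t => ∑ i : Fin 3, ∑ j : Fin 3,
      ((radius (dilate t p) ^ (2 : ℤ) * dr (pert g i.succ j.succ) (dilate t p) : ℝ) : ℂ) *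
        m t i.succ * conj (m t j.succ)) atTop (𝓝 0) := by
  have hray := tendsto_dilate hp.2
  rw [Metric.tendsto_nhds]
  intro ε hε
  filter_upwards [hm, hray.eventually (hg.origin (p 0) hp.1 (ε / 4) (by positivity)),
    hray.eventually (hg.eventually_mem hp.1)] with t h1 h2 h3
  have hr := hg.radius_pos h3
  have h4 := h2 _ h1
  rw [hg.rho_eq h3 h1] at h4
  rw [dist_zero_right]
  have h5 : ∑ i : Fin 3, ∑ j : Fin 3,
      ((radius (dilate t p) ^ (2 : ℤ) * dr (pert g i.succ j.succ) (dilate t p) : ℝ) : ℂ) *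
        m t i.succ * conj (m t j.succ) = (2 * (radius (dilate t p) ^ (2 : ℤ) : ℝ) : ℂ) *
        (1 / 2 * ∑ i : Fin 3, ∑ j : Fin 3, (dr (pert g i.succ j.succ) (dilate t p) : ℂ) *
        m t i.succ * conj (m t j.succ)) := by
    rw [mul_comm (2 : ℂ), mul_assoc, ← mul_assoc (2 : ℂ), mul_one_div_cancel two_ne_zero, one_mul]
    simp only [Finset.mul_sum]
    refine Finset.sum_congr rfl fun i _ => Finset.sum_congr rfl fun j _ => ?_
    push_cast; ring
  rw [h5, norm_mul, norm_mul, Complex.norm_real, Complex.norm_two,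
    Real.norm_of_nonneg (by positivity)]
  have h6 : 0 < radius (dilate t p) ^ (2 : ℤ) := by positivity
  have h7 : radius (dilate t p) ^ (2 : ℤ) * radius (dilate t p) ^ (-2 : ℤ) = 1 := by
    rw [← zpow_add₀ hr.ne']; simp
  calc _ ≤ 2 * radius (dilate t p) ^ (2 : ℤ) * (ε / 4 * radius (dilate t p) ^ (-2 : ℤ)) := by gcongr
    _ = ε / 2 := by linear_combination (ε / 2) * h7
    _ < ε := by linarith

theorem tendsto_psi0 (hp : p ∈ region J) {m : ℝ → Fin 4 → ℂ}
    (hm : ∀ᶠ t in atTop, IsLegM g (dilate t p) (m t)) :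
    Tendsto (fun t => ∑ i : Fin 3, ∑ j : Fin 3,
      ((radius (dilate t p) ^ (3 : ℤ) * ∑ k : Fin 3, dir k (dilate t p) *
        riemann g 0 i.succ k.succ j.succ (dilate t p) : ℝ) : ℂ) *
        m t i.succ * m t j.succ) atTop (𝓝 0) := by
  have hray := tendsto_dilate hp.2
  obtain ⟨N, hN⟩ := hg.psi0_decay
  obtain ⟨B, hB⟩ := hN (p 0) hp.1
  have hψ : Tendsto (fun t => B * (radius (dilate t p) ^ (-1 : ℤ) *
      Real.log (radius (dilate t p)) ^ N)) atTop (𝓝 (B * 0)) :=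
    (HasOrder.tendsto_zero_along (u₀ := p 0) (d := -1) ⟨N, isBigO_refl _ _⟩ le_rfl hray).const_mul B
  rw [mul_zero] at hψ
  refine squeeze_zero_norm' ?_ hψ
  filter_upwards [hm, hray.eventually hB, hray.eventually (hg.eventually_mem hp.1)] with t h1 h2 h3
  have hr := hg.radius_pos h3
  have h4 := h2 _ h1
  rw [hg.psi0_eq h3 h1] at h4
  have h5 : ∑ i : Fin 3, ∑ j : Fin 3,
      ((radius (dilate t p) ^ (3 : ℤ) * ∑ k : Fin 3, dir k (dilate t p) *
        riemann g 0 i.succ k.succ j.succ (dilate t p) : ℝ) : ℂ) *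
        m t i.succ * m t j.succ = ((radius (dilate t p) ^ (3 : ℤ) : ℝ) : ℂ) *
        (∑ i : Fin 3, ∑ j : Fin 3, ((∑ k : Fin 3, dir k (dilate t p) *
        riemann g 0 i.succ k.succ j.succ (dilate t p) : ℝ) : ℂ) * m t i.succ * m t j.succ) := by
    rw [Finset.mul_sum]
    refine Finset.sum_congr rfl fun i _ => ?_
    rw [Finset.mul_sum]
    refine Finset.sum_congr rfl fun j _ => ?_
    rw [Complex.ofReal_mul]
    ring
  rw [h5, norm_mul, Complex.norm_real, Real.norm_of_nonneg (by positivity)]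
  have h6 : 0 < radius (dilate t p) ^ (3 : ℤ) := by positivity
  have h7 : radius (dilate t p) ^ (3 : ℤ) * radius (dilate t p) ^ (-4 : ℤ) =
      radius (dilate t p) ^ (-1 : ℤ) := by
    rw [← zpow_add₀ hr.ne']; norm_num
  calc _ ≤ radius (dilate t p) ^ (3 : ℤ) * (B * (radius (dilate t p) ^ (-4 : ℤ) *
        Real.log (radius (dilate t p)) ^ N)) := by gcongr
    _ = _ := by rw [← h7]; ring

open Polynomial in
/-- The leading coefficients of the metric along a generator do not contain logarithms and are
trace-free. -/
theorem no_logarithms (hp : p ∈ region J) {H : Fin 3 → Fin 3 → Pt → ℝ[X]}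
    {M : Fin 3 → Fin 3 → Pt → ℝ} (hM : ∀ i j, IsRayPoly J (H i j) (-1) (M i j))
    (hsub : ∀ i j, IsSymbol (p 0) (-2) fun q => pert g i.succ j.succ q - M i j q) :
    (∀ i j, H i j p = C ((H i j p).coeff 0)) ∧ ∑ i, H i i p = 0 := by
  have hr := hp.2
  have hray := tendsto_dilate hr
  have hu : p 0 ∈ J := hp.1
  have hD := hray.eventually (hg.eventually_mem hu)
  have hMd : ∀ i j, ∀ᶠ q in nearScri (p 0), ContDiffAt ℝ ∞ (M i j) q := fun i j => by
    filter_upwards [eventually_mem_region hg.isOpen_J hu] with q hq using (hM i j).contDiffAt q hq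
  have hhd : ∀ i j : Fin 3, ∀ᶠ q in nearScri (p 0), ContDiffAt ℝ ∞ (pert g i.succ j.succ) q :=
    fun i j => by
      filter_upwards [hg.eventually_mem hu] with q hq using hg.contDiffAt_pert hq _ _
  have hsub1 : ∀ i j, IsSymbol (p 0) (-3) fun q => dr (pert g i.succ j.succ) q - dr (M i j) q :=
    fun i j => ((hsub i j).dr (e := -3) (by norm_num)).congr (by
      filter_upwards [hMd i j, hhd i j] with q h1 h2
      exact dr_sub (differentiableAt_of_smooth h2) (differentiableAt_of_smooth h1))
  have hsub2 : ∀ i j, IsSymbol (p 0) (-4) fun q =>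
      dr (dr (pert g i.succ j.succ)) q - dr (dr (M i j)) q :=
    fun i j => ((hsub1 i j).dr (e := -4) (by norm_num)).congr (by
      filter_upwards [hMd i j, hhd i j, eventually_radius_gt (p 0) 0] with q h1 h2 h3
      exact dr_sub (differentiableAt_of_smooth (contDiffAt_dr h3 h2))
        (differentiableAt_of_smooth (contDiffAt_dr h3 h1)))
  have l0 : ∀ i j, Tendsto (fun t => radius (dilate t p) ^ (1 : ℤ) *
      pert g i.succ j.succ (dilate t p) - (H i j p).eval (Real.log (t * radius p))) atTop (𝓝 0) :=
    fun i j => by simpa using (hM i j).tendsto hp (hsub i j).hasOrder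
  -- With H the polynomial of r h_ij, those of r² ∂_r h_ij and r³ ∂_r²h_ij are H' - H and H'' - 3H'
  -- + 2H.
  have l1 := fun i j => (hM i j).dr.tendsto hp (hsub1 i j).hasOrder
  have l2 := fun i j => (hM i j).dr.dr.tendsto hp (hsub2 i j).hasOrder
  simp only [Int.reduceNeg, Int.reduceSub, neg_neg] at l1 l2
  have hsym : ∀ i j, H i j p = H j i p := fun i j => by
    have h : Tendsto (fun t => (H i j p - H j i p).eval (Real.log (t * radius p))) atTop (𝓝 0) := by
      have := (l0 j i).sub (l0 i j)
      rw [sub_zero] at this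
      refine this.congr' ?_
      filter_upwards [hD] with t ht
      rw [hg.pert_symm ht i j, eval_sub]; ring
    have := poly_eq_of_tendsto_log hr h
    rwa [map_zero, sub_eq_zero] at this
  have htan : ∀ i, ∑ j, C (dir j p) * H j i p = 0 := fun i => by
    have h : Tendsto (fun t => (∑ j, C (dir j p) * H j i p).eval (Real.log (t * radius p)))
        atTop (𝓝 0) := by
      have h1 : Tendsto (fun t => ∑ j, dir j p * (radius (dilate t p) ^ (1 : ℤ) *
          pert g j.succ i.succ (dilate t p) - (H j i p).eval (Real.log (t * radius p)))) atTop
          (𝓝 (∑ j : Fin 3, dir j p * 0)) :=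
        tendsto_finsetSum _ fun j _ => (l0 j i).const_mul _
      have h2 := h1.neg
      simp only [mul_zero, Finset.sum_const_zero, neg_zero] at h2
      refine h2.congr' ?_
      filter_upwards [hD, eventually_gt_atTop 0] with t ht ht0
      have h3 := hg.sum_dir_mul_pert ht i.succ
      simp only [dir_dilate ht0] at h3
      simp only [mul_sub, Finset.sum_sub_distrib, eval_finsetSum, eval_mul, eval_C,
        mul_left_comm (dir _ p), ← Finset.mul_sum, h3]
      ring
    have := poly_eq_of_tendsto_log hr h
    rwa [map_zero] at this
  obtain ⟨e, f, hxe, hxf, hee, hff, hef, hP⟩ :=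
    exists_orthonormal_tangent (x := fun i => dir i p) (sum_dir_sq hr)
  obtain ⟨m, N, hleg, hm⟩ := hg.exists_leg hp hxe hxf hee hff hef
  have hmc : ∀ i : Fin 3, (fun t => conj (m t i.succ) -
      conj ((√(1 / 2) : ℝ) * (e i + Complex.I * f i) : ℂ)) =O[atTop]
        fun t => radius (dilate t p) ^ (-1 : ℤ) * Real.log (radius (dilate t p)) ^ N := fun i => by
    refine ((hm i).norm_left.congr_left fun t => ?_).of_norm_left
    rw [← map_sub, Complex.norm_conj]
  have o1 : ∀ i j : Fin 3, HasOrder (p 0) 0 fun q => radius q ^ (2 : ℤ) *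
      dr (pert g i.succ j.succ) q := fun i j =>
    (IsSymbol.zpow 2).hasOrder.mul ((hg.isSymbol_pert hu _ _).dr (e := -2) (by norm_num)).hasOrder
      (by norm_num)
  have r1 := tendsto_contraction_sub (n := fun t a => conj (m t a))
    (ν := fun i => conj ((√(1 / 2) : ℝ) * (e i + Complex.I * f i) : ℂ)) hr hm hmc o1
  have r2 := (hg.tendsto_rho hp hleg).sub r1
  simp only [sub_sub_cancel, sub_zero] at r2
  have r3 := (Complex.continuous_re.tendsto _).comp r2
  have r4 : Tendsto (fun t => ∑ i, ∑ j, (radius (dilate t p) ^ (2 : ℤ) *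
      dr (pert g i.succ j.succ) (dilate t p)) * ((1 / 2) * (e i * e j + f i * f j)))
      atTop (𝓝 0) := by
    refine r3.congr fun t => ?_
    simp only [Function.comp_apply, Complex.re_sum, mul_assoc]
    refine Finset.sum_congr rfl fun i _ => Finset.sum_congr rfl fun j _ => ?_
    rw [Complex.re_ofReal_mul, ← mul_assoc ((√(1 / 2) : ℝ) : ℂ), re_null_mul_conj, mul_assoc]
  have p1 := poly_eval_sum_eq_zero hr _ (tendsto_sum_sum_sub l1 _ r4)
  -- Contracting with m and m̄ gives half the trace, as H is transversal. The condition on ρ says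
  -- that the trace Q satisfies Q' - Q = 0.
  have htr : ∑ i, H i i p = 0 := by
    have e1 : ∑ i, ∑ j, H i j p * C (1 / 2 * (e i * e j + f i * f j)) =
        C (1 / 2) * ∑ i, H i i p := by
      have h1 : ∑ i, ∑ j, H i j p * C (1 / 2 * (e i * e j + f i * f j)) =
          C (1 / 2) * (∑ i, H i i p - ∑ i, C (dir i p) * ∑ j, C (dir j p) * H j i p) := by
        simp only [hP, Fin.sum_univ_three]
        simp [hsym 1 0, hsym 2 0, hsym 2 1]
        ring
      have h2 : ∑ i, C (dir i p) * ∑ j, C (dir j p) * H j i p = 0 :=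
        Finset.sum_eq_zero fun i _ => by rw [htan i, mul_zero]
      rw [h1, h2, sub_zero]
    have e2 : ∑ i, ∑ j, derivative (H i j p) * C (1 / 2 * (e i * e j + f i * f j)) =
        C (1 / 2) * derivative (∑ i, H i i p) := by
      have := congrArg derivative e1
      simpa [derivative_mul] using this
    simp only [add_mul, Finset.sum_add_distrib, mul_assoc, ← Finset.mul_sum, e1, e2] at p1
    apply eq_zero_of_derivative_eq_self
    have h2 : (C (1 / 2 : ℝ) : ℝ[X]) ≠ 0 := by simp
    apply mul_left_cancel₀ h2
    push_cast at p1
    simp only [map_neg, map_one] at p1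
    linear_combination p1
  refine ⟨fun i j => ?_, htr⟩
  have o2 : ∀ i j : Fin 3, HasOrder (p 0) 0 fun q => radius q ^ (3 : ℤ) * ∑ k : Fin 3, dir k q *
        riemann g 0 i.succ k.succ j.succ q := fun i j => by
    have h1 := (hg.isSymbol_pert hu i.succ j.succ).dr (e := -2) (by norm_num)
    have h2 := h1.dr (e := -3) (by norm_num)
    have h3 := (((hg.isSymbol_riemann hu i j).mono (d' := -3) (by norm_num)).sub
      (h2.const_mul (1 / 2))).sub (h1.mul IsSymbol.inv_radius (e := -3) (by norm_num))
    refine (((IsSymbol.zpow 3).mul h3 (e := 0) (by norm_num)).congr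
      (Eventually.of_forall fun q => ?_)).hasOrder
    ring
  have s1 := (tendsto_contraction_sub hr hm hm o2)
  have s2 := (hg.tendsto_psi0 hp hleg).sub s1
  simp only [sub_sub_cancel, sub_zero] at s2
  -- By `isSymbol_riemann`, r³ times the curvature component has the polynomial -½(H'' - 3H' + 2H) -
  -- (H' - H) = -½(H'' - H').
  have l3 : ∀ i j, Tendsto (fun t => radius (dilate t p) ^ (3 : ℤ) * ∑ k : Fin 3,
      dir k (dilate t p) * riemann g 0 i.succ k.succ j.succ (dilate t p) -
      (C (-1 / 2) * (derivative (derivative (H i j p)) - derivative (H i j p))).eval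
        (Real.log (t * radius p))) atTop (𝓝 0) := fun i j => by
    have h1 := ((IsSymbol.zpow 3).hasOrder.mul (hg.isSymbol_riemann hu i j).hasOrder
      (e := -1) (by norm_num)).tendsto_zero_along le_rfl hray
    have h2 := (h1.sub ((l2 i j).const_mul (1 / 2))).sub (l1 i j)
    simp only [mul_zero, sub_zero] at h2
    refine h2.congr' ?_
    filter_upwards [hD] with t ht
    have hrt := (hg.radius_pos ht).ne'
    simp only [eval_add, eval_sub, eval_mul, eval_C, derivative_add, derivative_mul, derivative_C]
    rw [show (3 : ℤ) = 2 + 1 by norm_num, zpow_add_one₀ hrt]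
    push_cast
    simp only [eval_zero]
    field_simp
    ring
  have s3 := (Complex.continuous_re.tendsto _).comp s2
  have s4 := (Complex.continuous_im.tendsto _).comp s2
  have s5 : Tendsto (fun t => ∑ i, ∑ j, (radius (dilate t p) ^ (3 : ℤ) * ∑ k : Fin 3,
      dir k (dilate t p) * riemann g 0 i.succ k.succ j.succ (dilate t p)) *
      ((1 / 2) * (e i * e j - f i * f j))) atTop (𝓝 0) := by
    refine s3.congr fun t => ?_
    simp only [Function.comp_apply, Complex.re_sum, mul_assoc]
    refine Finset.sum_congr rfl fun i _ => Finset.sum_congr rfl fun j _ => ?_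
    rw [← mul_assoc ((√(1 / 2) : ℝ) : ℂ), null_mul_null, Complex.re_ofReal_mul, Complex.add_re,
      Complex.ofReal_re, Complex.re_ofReal_mul, Complex.I_re, mul_zero, add_zero, mul_assoc]
  have s6 : Tendsto (fun t => ∑ i, ∑ j, (radius (dilate t p) ^ (3 : ℤ) * ∑ k : Fin 3,
      dir k (dilate t p) * riemann g 0 i.succ k.succ j.succ (dilate t p)) *
      ((1 / 2) * (e i * f j + f i * e j))) atTop (𝓝 0) := by
    refine s4.congr fun t => ?_
    simp only [Function.comp_apply, Complex.im_sum, mul_assoc]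
    refine Finset.sum_congr rfl fun i _ => Finset.sum_congr rfl fun j _ => ?_
    rw [← mul_assoc ((√(1 / 2) : ℝ) : ℂ), null_mul_null, Complex.im_ofReal_mul, Complex.add_im,
      Complex.ofReal_im, Complex.im_ofReal_mul, Complex.I_im, mul_one, zero_add, mul_assoc]
  have p2 := poly_eval_sum_eq_zero hr _ (tendsto_sum_sum_sub l3 _ s5)
  have p3 := poly_eval_sum_eq_zero hr _ (tendsto_sum_sum_sub l3 _ s6)
  set L : Fin 3 → Fin 3 → ℝ[X] := fun i j => derivative (derivative (H i j p)) - derivative (H i j p)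
    with hL
  have hLtan : ∀ i, ∑ j, C (dir j p) * L j i = 0 := fun i => by
    have h1 := congrArg derivative (htan i)
    have h2 := congrArg derivative h1
    simp only [derivative_sum, derivative_mul, derivative_C, zero_mul, zero_add, derivative_zero]
      at h1 h2
    simp only [hL, mul_sub, Finset.sum_sub_distrib, h1, h2, sub_zero]
  have hLtr : ∑ i, L i i = 0 := by
    have h1 := congrArg derivative htr
    have h2 := congrArg derivative h1
    simp only [derivative_sum, derivative_zero] at h1 h2
    simp only [hL, Finset.sum_sub_distrib, h1, h2, sub_zero]
  -- The decay of Ψ₀ makes both real contractions of H'' - H' with the null dyad vanish; being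
  -- symmetric, transversal and trace-free, H'' - H' is zero, and then H' = 0.
  have hL0 : L i j = 0 := by
    refine Polynomial.funext fun s => ?_
    rw [eval_zero]
    refine eq_zero_of_contractions (T := fun i j => (L i j).eval s) hP
      (fun i j => by simp only [hL, hsym i j]) (fun i => ?_) ?_ ?_ ?_ i j
    · simpa [eval_finsetSum] using congrArg (eval s) (hLtan i)
    · simpa [eval_finsetSum] using congrArg (eval s) hLtr
    · have := congrArg (eval s) p2
      simp only [eval_finsetSum, eval_mul, eval_C, eval_zero] at this
      have h3 : ∑ i, ∑ j, -1 / 2 * eval s (L i j) * (1 / 2 * (e i * e j - f i * f j)) =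
          -1 / 4 * ∑ i, ∑ j, eval s (L i j) * (e i * e j - f i * f j) := by
        simp only [Finset.mul_sum]
        exact Finset.sum_congr rfl fun _ _ => Finset.sum_congr rfl fun _ _ => by ring
      linarith
    · have := congrArg (eval s) p3
      simp only [eval_finsetSum, eval_mul, eval_C, eval_zero] at this
      have h3 : ∑ i, ∑ j, -1 / 2 * eval s (L i j) * (1 / 2 * (e i * f j + f i * e j)) =
          -1 / 4 * ∑ i, ∑ j, eval s (L i j) * (e i * f j + f i * e j) := by
        simp only [Finset.mul_sum]
        exact Finset.sum_congr rfl fun _ _ => Finset.sum_congr rfl fun _ _ => by ring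
      linarith
  exact eq_C_of_derivative_derivative_eq (sub_eq_zero.1 hL0)

/-- The leading coefficient `C_ij` of the angular part of the metric, which is smooth, transversal
and trace-free. -/
theorem exists_shearTensor : ∃ C : Fin 3 → Fin 3 → Pt → ℝ, (∀ i j, ScriSmooth J (C i j)) ∧
    (∀ u ∈ J, ∀ i j : Fin 3, IsSymbol u (-2)
      fun p => pert g i.succ j.succ p - C i j p * (radius p)⁻¹) ∧
    ∀ p ∈ region J, (∀ i j, C i j p = C j i p) ∧ (∀ i, ∑ j, dir j p * C j i p = 0) ∧
      ∑ i, C i i p = 0 := by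
  have hs : ∀ i j : Fin 3, ∀ u ∈ J, ∀ᶠ p in nearScri u,
      ContDiffAt ℝ ∞ (fun p => g p i.succ j.succ - minkowski p i.succ j.succ) p :=
    fun i j u hu => by
      filter_upwards [hg.eventually_mem hu] with p hp using hg.contDiffAt_pert hp _ _
  have := fun i j : Fin 3 => (hg.polyhom i.succ j.succ).exists_expansion hg.isOpen_J (hs i j)
  choose N c hc hexp using this
  have hM := fun i j => isRayPoly_sum_term (hc i j 0) (N i j 0 + 1) (-1)
  have hsub : ∀ u ∈ J, ∀ i j : Fin 3, IsSymbol u (-2) fun q => pert g i.succ j.succ q -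
      ∑ k ∈ Finset.range (N i j 0 + 1), term (c i j 0 k) k (-1) q := fun u hu i j => by
    simpa [pert] using hexp i j 1 u hu
  have hlog := fun p (hp : p ∈ region J) => hg.no_logarithms hp hM (hsub (p 0) hp.1)
  have hval : ∀ p ∈ region J, ∀ i j, (∑ k ∈ Finset.range (N i j 0 + 1),
      Polynomial.C (c i j 0 k p) * Polynomial.X ^ k : Polynomial ℝ) =
      Polynomial.C (c i j 0 0 p) := fun p hp i j => by
    have h := (hlog p hp).1 i j
    rw [h, Polynomial.finsetSum_coeff, Finset.sum_eq_single 0]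
    · simp
    · intro k _ hk
      simp [Polynomial.coeff_X_pow, hk.symm]
    · simp
  have hres : ∀ u ∈ J, ∀ i j : Fin 3, IsSymbol u (-2)
      fun p => pert g i.succ j.succ p - c i j 0 0 p * (radius p)⁻¹ := fun u hu i j => by
    refine (hsub u hu i j).congr ?_
    filter_upwards [eventually_mem_region hg.isOpen_J hu] with p hp
    have h := congrArg (Polynomial.eval (Real.log (radius p))) (hval p hp i j)
    simp only [Polynomial.eval_finsetSum, Polynomial.eval_mul, Polynomial.eval_C,
      Polynomial.eval_pow, Polynomial.eval_X] at h
    simp only [term, ← Finset.sum_mul, h, zpow_neg_one]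
  refine ⟨fun i j => c i j 0 0, fun i j => hc i j 0 0, hres, fun p hp => ⟨fun i j => ?_, fun i => ?_,
    ?_⟩⟩
  -- Symmetry and transversality hold exactly for h and pass to the coefficient of r⁻¹ by its
  -- uniqueness.
  · have h : IsSymbol (p 0) (-2) fun q => (c i j 0 0 q - c j i 0 0 q) * radius q ^ (-1 : ℤ) := by
      refine ((hres (p 0) hp.1 j i).sub (hres (p 0) hp.1 i j)).congr ?_
      filter_upwards [hg.eventually_mem hp.1] with q hq
      rw [hg.pert_symm hq i j, zpow_neg_one]; ring
    exact sub_eq_zero.1 (((hc i j 0 0).sub (hc j i 0 0)).eq_zero_of_hasOrder hp.1 h.hasOrder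
      (by norm_num) rfl hp.2)
  · have h : IsSymbol (p 0) (-2) fun q => (∑ j, dir j q * c j i 0 0 q) * radius q ^ (-1 : ℤ) := by
      refine ((IsSymbol.sum Finset.univ fun j _ => (IsSymbol.dir j).mul (hres (p 0) hp.1 j i)
        (e := -2) (by simp)).neg).congr ?_
      filter_upwards [hg.eventually_mem hp.1] with q hq
      simp only [mul_sub, Finset.sum_sub_distrib, hg.sum_dir_mul_pert hq, zpow_neg_one,
        Finset.sum_mul, mul_assoc]
      ring
    exact (ScriSmooth.sum _ fun j _ => (ScriSmooth.dir j).mul (hc j i 0 0)).eq_zero_of_hasOrder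
      hp.1 h.hasOrder (by norm_num) rfl hp.2
  · have h := (hlog p hp).2
    simp only [hval p hp, ← map_sum] at h
    exact (Polynomial.C_eq_zero).1 h

end IsAsymptoticallyFlat
end NullInfinity
end

noncomputable section

namespace NullInfinity

variable {u₀ : ℝ} {J : Set ℝ} {D : Set Pt} {g : MetricField} {p : Pt} {ξ : Pt → Fin 4 → ℝ}

/-! ### The asymptotic form of the Killing field -/

theorem tendsto_along_ray {X : Type*} {l : Filter X} {f : Pt → X} (hp : 0 < radius p)
    (h : Tendsto (fun r => f (pt (p 0) r (direction p hp))) atTop l) :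
    Tendsto (fun t => f (dilate t p)) atTop l := by
  have h1 : Tendsto (fun t => t * radius p) atTop atTop := tendsto_id.atTop_mul_const hp
  refine (h.comp h1).congr fun t => ?_
  rw [Function.comp_apply, ← dilate_pt, pt_direction]

open Polynomial in
/-- A polyhomogeneous function of order `r` that is `o(r)` is of order `r⁰`. -/
theorem IsPolyhom.exists_leading (hJ : IsOpen J) {f : Pt → ℝ} (h : IsPolyhom J 1 f)
    (hs : ∀ u ∈ J, ∀ᶠ p in nearScri u, ContDiffAt ℝ ∞ f p)
    (h0 : ∀ u ∈ J, ∀ x, Tendsto (fun r => f (pt u r x) / r) atTop (𝓝 0)) :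
    ∃ (N : ℕ) (c : ℕ → Pt → ℝ), (∀ j, ScriSmooth J (c j)) ∧ ∀ u ∈ J, IsSymbol u (-1) fun p =>
      f p - ∑ j ∈ Finset.range (N + 1), term (c j) j 0 p := by
  obtain ⟨N, c, hc, H⟩ := h.exists_expansion hJ hs
  refine ⟨N 1, c 1, hc 1, fun u hu => ?_⟩
  have hM := isRayPoly_sum_term (hc 0) (N 0 + 1) 1
  have hz : ∀ p ∈ region J, ∑ j ∈ Finset.range (N 0 + 1), term (c 0 j) j 1 p = 0 := fun p hp => by
    have h1 : IsSymbol (p 0) 0 fun q => f q - ∑ j ∈ Finset.range (N 0 + 1), term (c 0 j) j 1 q := by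
      simpa using H 1 (p 0) hp.1
    have h2 := hM.tendsto hp h1.hasOrder
    have h3 : Tendsto (fun t => radius (dilate t p) ^ (-1 : ℤ) * f (dilate t p)) atTop (𝓝 0) :=
      tendsto_along_ray (f := fun q => radius q ^ (-1 : ℤ) * f q) hp.2 <| by
        refine (h0 (p 0) hp.1 (direction p hp.2)).congr' ?_
        filter_upwards [eventually_gt_atTop 0] with r hr
        rw [radius_pt hr.le, zpow_neg_one, div_eq_inv_mul]
    have h4 := h3.sub h2
    simp only [sub_sub_cancel, sub_zero] at h4
    have h5 := poly_eq_of_tendsto_log hp.2 h4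
    have h6 := congrArg (Polynomial.eval (Real.log (radius p))) h5
    simp only [eval_finsetSum, eval_mul, eval_C, eval_pow, eval_X] at h6
    simp only [term, ← Finset.sum_mul, h6, zero_mul]
  have h2 := H 2 u hu
  simp only [Finset.sum_range_succ _ 1, Finset.sum_range_one] at h2
  refine (h2.mono (by norm_num)).congr ?_
  filter_upwards [eventually_mem_region hJ hu] with p hp
  have := hz p hp
  simp only [Nat.cast_zero, sub_zero, Nat.cast_one, sub_self]
  rw [this, zero_add]

theorem eventually_const_of_dr_eq_zero {F : Pt → ℝ} (hs : ∀ᶠ p in nearScri u₀, DifferentiableAt ℝ F p)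
    (hd : ∀ᶠ p in nearScri u₀, dr F p = 0) :
    ∀ᶠ p in nearScri u₀, ∀ t, 1 ≤ t → F (dilate t p) = F p := by
  obtain ⟨δ, hδ, R, H⟩ := eventually_nearScri.1 (hs.and hd)
  refine eventually_nearScri.2 ⟨δ, hδ, max R 0, fun p hp hr t ht => ?_⟩
  have hr0 : 0 < radius p := (le_max_right _ _).trans_lt hr
  have hmem : ∀ s, 1 ≤ s → DifferentiableAt ℝ F (dilate s p) ∧ dr F (dilate s p) = 0 := fun s hs =>
    H _ hp (by
      rw [radius_dilate (by linarith)]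
      have := (le_max_left R 0).trans_lt hr
      nlinarith)
  have hderiv : ∀ s, 1 ≤ s → HasDerivAt (fun s => F (dilate s p)) 0 s := fun s hs => by
    have := hasDerivAt_along_ray (by linarith) hr0 (hmem s hs).1
    rwa [(hmem s hs).2, mul_zero] at this
  have h := constant_of_derivWithin_zero (f := fun s => F (dilate s p)) (a := 1) (b := t)
    (fun s hs => (hderiv s hs.1).differentiableAt.differentiableWithinAt)
    (fun s hs => (hderiv s hs.1).hasDerivWithinAt.derivWithin
      (uniqueDiffOn_Icc (hs.1.trans_lt hs.2) s ⟨hs.1, hs.2.le⟩)) t ⟨ht, le_rfl⟩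
  have e : dilate 1 p = p := by
    ext a; refine Fin.cases rfl (fun i => ?_) a; simp
  simpa only [e] using h

namespace IsAsymptoticallyFlat

variable (hg : IsAsymptoticallyFlat J D g)
include hg

/-- In the contraction of 𝓛_ξ g with l the derivatives of g disappear by the differentiated gauge
condition. What remains is a system of ordinary differential equations along the generators. -/
theorem sum_dir_mul_lieMetric (hp : p ∈ D) (ξ : Pt → Fin 4 → ℝ) (b : Fin 4) :
    ∑ j : Fin 3, dir j p * lieMetric g ξ j.succ b p =
      ∑ c, g p c b * dr (fun q => ξ q c) p + pd b (fun q => ξ q 0) p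
        - (∑ k : Fin 3, ξ p k.succ * (g p k.succ b - dir k p * if b = 0 then 1 else 0)) *
          (radius p)⁻¹ := by
  have hr := hg.radius_pos hp
  have h1 : ∑ j : Fin 3, dir j p * lieMetric g ξ j.succ b p =
      ∑ c, ξ p c * ∑ j : Fin 3, dir j p * pd c (fun q => g q j.succ b) p
      + ∑ c, g p c b * dr (fun q => ξ q c) p
      + ∑ c, (∑ j : Fin 3, dir j p * g p j.succ c) * pd b (fun q => ξ q c) p := by
    simp only [lieMetric, dr, Finset.mul_sum, Finset.sum_mul]
    rw [← Finset.sum_add_distrib, ← Finset.sum_add_distrib, Finset.sum_comm]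
    refine Finset.sum_congr rfl fun c _ => ?_
    rw [← Finset.sum_add_distrib, ← Finset.sum_add_distrib]
    exact Finset.sum_congr rfl fun j _ => by ring
  have h2 : ∀ k : Fin 3, ∑ j : Fin 3, dir j p * pd k.succ (fun q => g q j.succ b) p =
      -((g p k.succ b - dir k p * if b = 0 then 1 else 0) * (radius p)⁻¹) := fun k => by
    rw [hg.sum_dir_mul_pd hp]
    simp only [pd_dir_succ hr]
    rw [← hg.sum_dir_mul hp b]
    congr 1
    simp only [proj, sub_mul, Finset.sum_sub_distrib, Finset.mul_sum, Finset.sum_mul,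
      div_eq_mul_inv]
    congr 1
    · simp [mul_comm]
    · exact Finset.sum_congr rfl fun j _ => by ring
  rw [h1, Fin.sum_univ_succ (fun c => ξ p c * _), hg.sum_dir_mul_pd_zero hp]
  simp only [h2, hg.sum_dir_mul hp]
  simp only [mul_zero, zero_add, ite_mul, one_mul, zero_mul, Finset.sum_ite_eq', Finset.mem_univ,
    if_true, mul_neg, Finset.sum_neg_distrib, Finset.sum_mul, mul_assoc]
  ring

end IsAsymptoticallyFlat

theorem IsKilling.contDiffAt (hξ : IsKilling D g ξ) (hD : IsOpen D) (hp : p ∈ D) (a : Fin 4) :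
    ContDiffAt ℝ ∞ (fun q => ξ q a) p :=
  (hξ.1 a).contDiffAt (hD.mem_nhds hp)

theorem IsKilling.differentiableAt (hξ : IsKilling D g ξ) (hD : IsOpen D) (hp : p ∈ D) (a : Fin 4) :
    DifferentiableAt ℝ (fun q => ξ q a) p := differentiableAt_of_smooth (hξ.contDiffAt hD hp a)

namespace IsAsymptoticallyFlat

variable (hg : IsAsymptoticallyFlat J D g) (hξ : IsKilling D g ξ)
include hg hξ

theorem killing_contraction (hp : p ∈ D) (b : Fin 4) :
    ∑ c, g p c b * dr (fun q => ξ q c) p + pd b (fun q => ξ q 0) p =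
      (∑ k : Fin 3, ξ p k.succ * (g p k.succ b - dir k p * if b = 0 then 1 else 0)) *
          (radius p)⁻¹ := by
  have h := hg.sum_dir_mul_lieMetric hp ξ b
  simp only [hξ.2 p hp, mul_zero, Finset.sum_const_zero] at h
  linarith

/-- Since l is geodesic and ξ^u = l_a ξ^a, the derivative ∂_r ξ^u equals l^a l^b ∇_a ξ_b, which
vanishes for a Killing field. -/
theorem dr_killing_zero (hp : p ∈ D) : dr (fun q => ξ q 0) p = 0 := by
  have h : ∑ b : Fin 3, dir b p * (∑ c, g p c b.succ * dr (fun q => ξ q c) p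
      + pd b.succ (fun q => ξ q 0) p) = ∑ b : Fin 3, dir b p * ((∑ k : Fin 3, ξ p k.succ *
        (g p k.succ b.succ - dir k p * if b.succ = 0 then 1 else 0)) * (radius p)⁻¹) :=
    Finset.sum_congr rfl fun b _ => by rw [hg.killing_contraction hξ hp]
  have h1 : ∑ b : Fin 3, dir b p * ∑ c, g p c b.succ * dr (fun q => ξ q c) p =
      dr (fun q => ξ q 0) p := by
    simp only [Finset.mul_sum]
    rw [Finset.sum_comm]
    have : ∀ c, ∑ b : Fin 3, dir b p * (g p c b.succ * dr (fun q => ξ q c) p) =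
        (if c = 0 then 1 else 0) * dr (fun q => ξ q c) p := fun c => by
      rw [← hg.sum_mul_dir hp c, Finset.sum_mul]
      exact Finset.sum_congr rfl fun _ _ => by ring
    simp [this]
  have h2 : ∑ b : Fin 3, dir b p * ((∑ k : Fin 3, ξ p k.succ *
        (g p k.succ b.succ - dir k p * if b.succ = 0 then 1 else 0)) * (radius p)⁻¹) = 0 := by
    simp only [Fin.succ_ne_zero, if_false, mul_zero, sub_zero, Finset.sum_mul, Finset.mul_sum]
    rw [Finset.sum_comm]
    refine Finset.sum_eq_zero fun k _ => ?_
    have := hg.sum_mul_dir hp k.succ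
    rw [if_neg (Fin.succ_ne_zero k)] at this
    calc _ = ξ p k.succ * (radius p)⁻¹ * ∑ b : Fin 3, g p k.succ b.succ * dir b p := by
          rw [Finset.mul_sum]; exact Finset.sum_congr rfl fun _ _ => by ring
      _ = 0 := by rw [this, mul_zero]
  simp only [mul_add, Finset.sum_add_distrib] at h
  rw [h1, h2] at h
  change dr (fun q => ξ q 0) p + dr (fun q => ξ q 0) p = 0 at h
  linarith

/-- The `u`-component of a supertranslational Killing field is a function on the sphere. -/
theorem exists_killing_zero (hS : IsSupertranslational J ξ) :
    ∃ a : Pt → ℝ, ScriSmooth J a ∧ (∀ p ∈ region J, pd 0 a p = 0) ∧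
      (∀ u ∈ J, ∃ p ∈ region J, p 0 = u ∧ a p ≠ 0) ∧
      ∀ u ∈ J, ∀ᶠ p in nearScri u, ξ p 0 = a p := by
  obtain ⟨hP, α, ⟨x₀, hx₀⟩, hα⟩ := hS
  have hs : ∀ u ∈ J, ∀ᶠ p in nearScri u, ContDiffAt ℝ ∞ (fun q => ξ q 0) p := fun u hu => by
    filter_upwards [hg.eventually_mem hu] with p hp using hξ.contDiffAt hg.isOpen_D hp 0
  obtain ⟨N, c, hc, H⟩ := (hP 0).exists_leading hg.isOpen_J hs fun u hu x => by
    simpa using (hα u hu x).1.div_atTop tendsto_id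
  have hM := isRayPoly_sum_term hc (N + 1) 0
  have hray : ∀ (p : Pt) (hp : p ∈ region J),
      Tendsto (fun t => ξ (dilate t p) 0) atTop (𝓝 (α (direction p hp.2))) := fun p hp =>
    tendsto_along_ray (f := fun q => ξ q 0) hp.2 (hα (p 0) hp.1 _).1
  have hval : ∀ (p : Pt) (hp : p ∈ region J), c 0 p = α (direction p hp.2) := fun p hp => by
    have h2 := hM.tendsto hp (H (p 0) hp.1).hasOrder
    have h3 := (hray p hp).sub h2
    simp only [neg_zero, zpow_zero, one_mul, sub_sub_cancel, sub_zero] at h3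
    have h4 := congrArg (Polynomial.coeff · 0) (poly_eq_of_tendsto_log hp.2 h3)
    simpa [Polynomial.finsetSum_coeff, Finset.sum_range_succ'] using h4
  have hpt : ∀ u ∈ J, ∀ r > 0, ∀ x, c 0 (pt u r x) = α x := fun u hu r hr x => by
    have hm : pt u r x ∈ region J := ⟨hu, by rwa [radius_pt hr.le]⟩
    rw [hval _ hm]
    congr 1
    ext i
    simp only [direction, pt_succ, radius_pt hr.le]
    field_simp
  refine ⟨c 0, hc 0, fun p hp => ?_, fun u hu => ⟨pt u 1 x₀, ⟨hu, ?_⟩, rfl, ?_⟩, fun u hu => ?_⟩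
  · have h1 : HasDerivAt (fun s => pt s (radius p) (direction p hp.2)) (Pi.single 0 1) (p 0) := by
      rw [hasDerivAt_pi]
      refine Fin.cases ?_ fun i => ?_
      · simpa using hasDerivAt_id' (p 0)
      · simpa [Fin.succ_ne_zero] using hasDerivAt_const (p 0) (radius p * (direction p hp.2).1 i)
    have h2 : HasFDerivAt (c 0) (fderiv ℝ (c 0) p) (pt (p 0) (radius p) (direction p hp.2)) := by
      rw [pt_direction]; exact ((hc 0).differentiableAt hp).hasFDerivAt
    have h3 := h2.comp_hasDerivAt (p 0) h1
    refine h3.unique ((hasDerivAt_const (p 0) (α (direction p hp.2))).congr_of_eventuallyEq ?_)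
    filter_upwards [hg.isOpen_J.mem_nhds hp.1] with s hs using hpt s hs _ hp.2 _
  · rw [radius_pt zero_le_one]; exact one_pos
  · rwa [hpt u hu 1 one_pos]
  -- ξ^u is constant along the generators and therefore equal to its limit, not merely asymptotic to
  -- it.
  · filter_upwards [eventually_mem_region hg.isOpen_J hu, eventually_const_of_dr_eq_zero
      (F := fun q => ξ q 0) ((hs u hu).mono fun _ h => differentiableAt_of_smooth h)
      (by filter_upwards [hg.eventually_mem hu] with p hp using hg.dr_killing_zero hξ hp)]
      with p hp h
    rw [hval p hp]
    refine tendsto_nhds_unique (tendsto_const_nhds.congr' ?_) (hray p hp)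
    filter_upwards [eventually_ge_atTop 1] with t ht using (h t ht).symm

end IsAsymptoticallyFlat
end NullInfinity
end

/-! ### Spatial components of the Killing field -/

noncomputable section

namespace NullInfinity

variable {u₀ : ℝ} {J : Set ℝ} {D : Set Pt} {g : MetricField} {p : Pt} {ξ : Pt → Fin 4 → ℝ}

-- The tangential part plus the constant b solves Q' = Q, hence vanishes. So the tangential part of
-- P is constant, and the first equation says the same of the radial part.
open Polynomial in
theorem eq_of_tangential_equations {P : Fin 3 → ℝ[X]} {b : Fin 3 → ℝ}
    (p1 : ∑ k, C (dir k p) * derivative (P k) = 0)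
    (p2 : ∀ j, ∑ k, C (proj k j p) * (derivative (P k) - P k) = C (b j)) :
    (∀ j, ∑ k, C (proj k j p) * P k + C (b j) = 0) ∧ ∀ j, derivative (P j) = 0 := by
  have p3 : ∀ j, ∑ k, C (proj k j p) * P k + C (b j) = 0 := fun j => by
    refine eq_zero_of_derivative_eq_self ?_
    rw [← p2 j]
    simp only [derivative_sum, derivative_mul, derivative_add, derivative_C, zero_mul, zero_add,
      mul_sub, Finset.sum_sub_distrib, derivative_sub]
    have := congrArg derivative (p2 j)
    simp only [derivative_sum, derivative_mul, derivative_C, zero_mul, zero_add,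
      mul_sub, Finset.sum_sub_distrib, derivative_sub] at this
    linear_combination this
  have p4 : ∀ j, derivative (P j) = 0 := fun j => by
    have h1 := congrArg derivative (p3 j)
    simp only [derivative_sum, derivative_mul, derivative_add, derivative_C, zero_mul, zero_add,
      add_zero, derivative_zero] at h1
    have h2 : ∑ k, C (proj k j p) * derivative (P k) =
        derivative (P j) - C (dir j p) * ∑ k, C (dir k p) * derivative (P k) := by
      have h3 : ∀ k, C (proj k j p) * derivative (P k) = (if k = j then derivative (P k) else 0) -
          C (dir j p) * (C (dir k p) * derivative (P k)) := fun k => by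
        by_cases h : k = j <;> simp only [proj, h, if_true, if_false, map_sub, map_mul, map_one,
          map_zero] <;> ring
      simp only [h3, Finset.sum_sub_distrib, Finset.mul_sum, Finset.sum_ite_eq', Finset.mem_univ,
        if_true]
    rw [h2, p1, mul_zero, sub_zero] at h1
    exact h1
  exact ⟨p3, p4⟩

namespace IsAsymptoticallyFlat

variable (hg : IsAsymptoticallyFlat J D g) (hξ : IsKilling D g ξ)
include hg hξ

-- With H the polynomials of ξ^k, the u-component of the contracted Killing equation gives ∑ x_k
-- H_k' = 0 to leading order, and the spatial components give r ∂_j a for the tangential part of H'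
-- - H. These are the assumptions of `eq_of_tangential_equations`.
open Polynomial in
theorem killing_no_logarithms {a : Pt → ℝ} (ha : ScriSmooth J a)
    (ha0 : ∀ p ∈ region J, pd 0 a p = 0) (hξa : ∀ u ∈ J, ∀ᶠ p in nearScri u, ξ p 0 = a p)
    (hp : p ∈ region J) {H : Fin 3 → Pt → ℝ[X]} {M : Fin 3 → Pt → ℝ}
    (hM : ∀ i, IsRayPoly J (H i) 0 (M i)) (hM0 : ∀ i, IsSymbol (p 0) 0 (M i))
    (hsub : ∀ i, IsSymbol (p 0) (-1) fun q => ξ q i.succ - M i q) :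
    (∀ i, H i p = C ((H i p).coeff 0)) ∧
      ∀ i, ∑ j, proj j i p * (H j p).coeff 0 = -(radius p * pd i.succ a p) := by
  have hr := hp.2
  have hray := tendsto_dilate hr
  have hu : p 0 ∈ J := hp.1
  have hD := hray.eventually (hg.eventually_mem hu)
  have hreg := hray.eventually (eventually_mem_region hg.isOpen_J hu)
  have hξ0 : ∀ i : Fin 3, IsSymbol (p 0) 0 fun q => ξ q i.succ := fun i =>
    (((hsub i).mono (by norm_num)).add (hM0 i)).congr (Eventually.of_forall fun q => by ring)
  have hsub1 : ∀ i, IsSymbol (p 0) (-2) fun q => dr (fun q => ξ q i.succ) q - dr (M i) q :=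
    fun i => ((hsub i).dr (e := -2) (by norm_num)).congr (by
      filter_upwards [(hM0 i).smooth, (hξ0 i).smooth] with q h1 h2
      exact dr_sub (differentiableAt_of_smooth h2) (differentiableAt_of_smooth h1))
  have l0 := fun i => (hM i).tendsto hp (hsub i).hasOrder
  have l1 := fun i => (hM i).dr.tendsto hp (hsub1 i).hasOrder
  simp only [neg_zero, zpow_zero, one_mul, zero_sub, neg_neg, zpow_one, Int.cast_zero, map_zero,
    zero_mul, add_zero] at l0 l1
  have hpd : ∀ b, ∀ᶠ q in nearScri (p 0), pd b (fun q => ξ q 0) q = pd b a q := fun b =>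
    pd_congr_nearScri (hξa (p 0) hu) b
  have hh := fun a b => hg.isSymbol_pert hu a b
  -- In the u-component both ∂_r ξ^u and ∂_u ξ^u vanish, and the right-hand side is of second order
  -- because g_k0 - x_k is part of the deviation.
  have s1 : Tendsto (fun t => ∑ k : Fin 3, dir k p * (radius (dilate t p) *
      dr (fun q => ξ q k.succ) (dilate t p))) atTop (𝓝 0) := by
    have h1 : IsSymbol (p 0) (-1) fun q => ∑ k : Fin 3, ξ q k.succ * pert g k.succ 0 q
        - ∑ k : Fin 3, radius q ^ (1 : ℤ) * (pert g k.succ 0 q * dr (fun q => ξ q k.succ) q) :=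
      (IsSymbol.sum _ fun k _ => (hξ0 k).mul (hh _ _) (by norm_num)).sub
        (IsSymbol.sum _ fun k _ => (IsSymbol.zpow 1).mul ((hh _ _).mul
          ((hξ0 k).dr (e := -1) (by norm_num)) (e := -2) (by norm_num)) (by norm_num))
    refine (h1.hasOrder.tendsto_zero_along le_rfl hray).congr' ?_
    filter_upwards [hD, hreg, hray.eventually (hpd 0), eventually_gt_atTop 0] with t h1 h2 h3 h4
    have hrt := hg.radius_pos h1
    have h5 := hg.killing_contraction hξ h1 0
    rw [h3, ha0 _ h2, Fin.sum_univ_succ, hg.dr_killing_zero hξ h1] at h5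
    simp only [if_true, mul_one, mul_zero, zero_add, add_zero] at h5
    rw [← div_eq_mul_inv, eq_div_iff hrt.ne'] at h5
    simp only [zpow_one, pert, minkowski_succ_zero]
    rw [← h5]
    simp only [← dir_dilate h4 _ p, Finset.sum_mul, ← Finset.sum_sub_distrib]
    exact Finset.sum_congr rfl fun k _ => by ring
  have s2 : ∀ j, Tendsto (fun t => ∑ k : Fin 3, proj k j p * (radius (dilate t p) *
      dr (fun q => ξ q k.succ) (dilate t p) - ξ (dilate t p) k.succ)) atTop
      (𝓝 (radius p * pd j.succ a p)) := fun j => by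
    have h1 : IsSymbol (p 0) (-1) fun q => ∑ k : Fin 3, pert g k.succ j.succ q *
        (radius q ^ (1 : ℤ) * dr (fun q => ξ q k.succ) q - ξ q k.succ) :=
      IsSymbol.sum _ fun k _ => (hh _ _).mul (((IsSymbol.zpow 1).mul
        ((hξ0 k).dr (e := -1) (by norm_num)) (e := 0) (by norm_num)).sub (hξ0 k)) (by norm_num)
    have h2 := (h1.hasOrder.tendsto_zero_along le_rfl hray).add_const (radius p * pd j.succ a p)
    rw [zero_add] at h2
    refine h2.congr' ?_
    filter_upwards [hD, hreg, hray.eventually (hpd j.succ), eventually_gt_atTop 0] with t h1 h2 h3 h4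
    have hrt := hg.radius_pos h1
    have h5 := hg.killing_contraction hξ h1 j.succ
    rw [h3, Fin.sum_univ_succ, hg.dr_killing_zero hξ h1] at h5
    simp only [Fin.succ_ne_zero, if_false, mul_zero, zero_add, sub_zero] at h5
    rw [← div_eq_mul_inv, eq_div_iff hrt.ne'] at h5
    have h6 := (ha.radius_mul_pd hg.isOpen_J j).dilate p hp t h4
    have h7 : ∀ k : Fin 3, g (dilate t p) k.succ j.succ =
        pert g k.succ j.succ (dilate t p) - proj k j p := fun k => by
      rw [pert, minkowski_succ_succ, (ScriSmooth.proj (J := J) k j).dilate p hp t h4]; ring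
    rw [← h6]
    simp only [h7, add_mul, Finset.sum_mul] at h5
    simp only [zpow_one]
    have h8 : ∑ k : Fin 3, (pert g k.succ j.succ (dilate t p) - proj k j p) *
        dr (fun q => ξ q k.succ) (dilate t p) * radius (dilate t p)
        - ∑ k : Fin 3, ξ (dilate t p) k.succ * (pert g k.succ j.succ (dilate t p) - proj k j p)
        = ∑ k : Fin 3, pert g k.succ j.succ (dilate t p) * (radius (dilate t p) *
          dr (fun q => ξ q k.succ) (dilate t p) - ξ (dilate t p) k.succ)
        - ∑ k : Fin 3, proj k j p * (radius (dilate t p) *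
          dr (fun q => ξ q k.succ) (dilate t p) - ξ (dilate t p) k.succ) := by
      rw [← Finset.sum_sub_distrib, ← Finset.sum_sub_distrib]
      exact Finset.sum_congr rfl fun k _ => by ring
    linarith
  have p1 : ∑ k, C (dir k p) * derivative (H k p) = 0 := by
    have h : Tendsto (fun t => (∑ k, C (dir k p) * derivative (H k p)).eval
        (Real.log (t * radius p))) atTop (𝓝 0) := by
      have h1 : Tendsto (fun t => ∑ k, dir k p * (radius (dilate t p) *
          dr (fun q => ξ q k.succ) (dilate t p) - (derivative (H k p)).eval
            (Real.log (t * radius p)))) atTop (𝓝 (∑ k : Fin 3, dir k p * 0)) :=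
        tendsto_finsetSum _ fun k _ => (l1 k).const_mul _
      have h2 := s1.sub h1
      simp only [mul_zero, Finset.sum_const_zero, sub_zero] at h2
      refine h2.congr fun t => ?_
      rw [← Finset.sum_sub_distrib, eval_finsetSum]
      exact Finset.sum_congr rfl fun k _ => by rw [eval_mul, eval_C]; ring
    simpa using poly_eq_of_tendsto_log hr h
  have p2 : ∀ j, ∑ k, C (proj k j p) * (derivative (H k p) - H k p) =
      C (radius p * pd j.succ a p) := fun j => by
    refine poly_eq_of_tendsto_log hr ?_
    have h1 : Tendsto (fun t => ∑ k, proj k j p * ((radius (dilate t p) *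
        dr (fun q => ξ q k.succ) (dilate t p) - (derivative (H k p)).eval
          (Real.log (t * radius p))) - (ξ (dilate t p) k.succ - (H k p).eval
          (Real.log (t * radius p))))) atTop (𝓝 (∑ k : Fin 3, proj k j p * (0 - 0))) :=
      tendsto_finsetSum _ fun k _ => ((l1 k).sub (l0 k)).const_mul _
    have h2 := (s2 j).sub h1
    simp only [sub_self, mul_zero, Finset.sum_const_zero, sub_zero] at h2
    refine h2.congr fun t => ?_
    rw [← Finset.sum_sub_distrib, eval_finsetSum]
    exact Finset.sum_congr rfl fun k _ => by rw [eval_mul, eval_C, eval_sub]; ring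
  obtain ⟨p3, p4⟩ := eq_of_tangential_equations p1 p2
  refine ⟨fun i => eq_C_of_derivative_eq_zero (p4 i), fun i => ?_⟩
  have h := congrArg (fun P => coeff P 0) (p3 i)
  simp only [coeff_add, finsetSum_coeff, coeff_C_mul, coeff_C_zero, coeff_zero] at h
  linarith

/-- The leading coefficients of the spatial components of the Killing field. -/
theorem exists_killing_succ (hS : IsSupertranslational J ξ) {a : Pt → ℝ} (ha : ScriSmooth J a)
    (ha0 : ∀ p ∈ region J, pd 0 a p = 0) (hξa : ∀ u ∈ J, ∀ᶠ p in nearScri u, ξ p 0 = a p) :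
    ∃ c : Fin 3 → Pt → ℝ, (∀ i, ScriSmooth J (c i)) ∧
      (∀ u ∈ J, ∀ i : Fin 3, IsSymbol u (-1) fun p => ξ p i.succ - c i p) ∧
      ∀ p ∈ region J, ∀ i, ∑ j, proj j i p * c j p = -(radius p * pd i.succ a p) := by
  obtain ⟨hP, α, -, hα⟩ := hS
  have hs : ∀ (i : Fin 3), ∀ u ∈ J, ∀ᶠ p in nearScri u, ContDiffAt ℝ ∞ (fun q => ξ q i.succ) p :=
    fun i u hu => by
      filter_upwards [hg.eventually_mem hu] with p hp using hξ.contDiffAt hg.isOpen_D hp i.succ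
  have := fun i : Fin 3 => (hP i.succ).exists_leading hg.isOpen_J (hs i) fun u hu x => (hα u hu x).2 i
  choose N c hc hexp using this
  have hM := fun i => isRayPoly_sum_term (hc i) (N i + 1) 0
  have hM0 : ∀ u ∈ J, ∀ i, IsSymbol u 0 fun p => ∑ k ∈ Finset.range (N i + 1), term (c i k) k 0 p :=
    fun u hu i => IsSymbol.sum _ fun k _ => (hc i k).isSymbol_term hg.isOpen_J hu k 0
  have key := fun p (hp : p ∈ region J) => hg.killing_no_logarithms hξ ha ha0 hξa hp hM
    (hM0 (p 0) hp.1) (fun i => hexp i (p 0) hp.1)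
  have hcoeff : ∀ p i, (∑ k ∈ Finset.range (N i + 1),
      Polynomial.C (c i k p) * Polynomial.X ^ k : Polynomial ℝ).coeff 0 = c i 0 p := fun p i => by
    simp [Polynomial.finsetSum_coeff, Finset.sum_range_succ']
  refine ⟨fun i => c i 0, fun i => hc i 0, fun u hu i => (hexp i u hu).congr ?_, fun p hp i => ?_⟩
  · filter_upwards [eventually_mem_region hg.isOpen_J hu] with p hp
    have h := congrArg (Polynomial.eval (Real.log (radius p))) ((key p hp).1 i)
    rw [hcoeff] at h
    simp only [Polynomial.eval_finsetSum, Polynomial.eval_mul, Polynomial.eval_C,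
      Polynomial.eval_pow, Polynomial.eval_X] at h
    simp only [term, h, zpow_zero, mul_one]
  · have h := (key p hp).2 i
    simpa only [hcoeff] using h

end IsAsymptoticallyFlat
end NullInfinity
end

/-! ### The Killing equation to leading order -/

noncomputable section

namespace NullInfinity

variable {u₀ : ℝ} {J : Set ℝ} {D : Set Pt} {g : MetricField} {p : Pt} {ξ : Pt → Fin 4 → ℝ}

theorem eventually_mem_region_nhds (hJ : IsOpen J) (hp : p ∈ region J) : ∀ᶠ q in 𝓝 p, q ∈ region J :=
  (isOpen_region hJ).mem_nhds hp

theorem pd_proj (hp : 0 < radius p) (i j k : Fin 3) : pd k.succ (proj i j) p =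
    -((proj k i p * dir j p + dir i p * proj k j p) * (radius p)⁻¹) := by
  have hd : ∀ i, DifferentiableAt ℝ (dir i) p := fun i =>
    differentiableAt_of_smooth (contDiffAt_dir hp i)
  have h : pd k.succ (fun q => (if i = j then (1 : ℝ) else 0) - dir i q * dir j q) p =
      -((proj k i p * dir j p + dir i p * proj k j p) * (radius p)⁻¹) := by
    rw [pd_sub (differentiableAt_const _) ((hd i).fun_mul (hd j)), pd_const, pd_mul (hd i) (hd j),
      pd_dir_succ hp, pd_dir_succ hp]
    ring
  exact h

theorem sum_proj_mul_eq (v : Fin 3 → ℝ) (i : Fin 3) :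
    ∑ j, proj j i p * v j = v i - dir i p * ∑ j, dir j p * v j := by
  simp only [proj, sub_mul, Finset.sum_sub_distrib, Finset.mul_sum]
  congr 1
  · simp
  · exact Finset.sum_congr rfl fun j _ => by ring

/-- The leading coefficients of a supertranslational Killing field: `ξ^u = a` and
`ξ^i = x^i φ - η_i + o(1)`, where `η_i = ∂_i (r a)`. -/
structure IsKillingData (J : Set ℝ) (N : Fin 3 → Fin 3 → Pt → ℝ) (a φ : Pt → ℝ)
    (η : Fin 3 → Pt → ℝ) : Prop where
  scri_a : ScriSmooth J a
  scri_φ : ScriSmooth J φ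
  scri_η : ∀ i, ScriSmooth J (η i)
  pd_zero_a : ∀ p ∈ region J, pd 0 a p = 0
  pd_zero_η : ∀ p ∈ region J, ∀ i, pd 0 (η i) p = 0
  pd_zero_φ : ∀ p ∈ region J, pd 0 φ p = 0
  nonzero : ∀ u ∈ J, ∃ p ∈ region J, p 0 = u ∧ a p ≠ 0
  η_eq : ∀ p ∈ region J, ∀ i, η i p = dir i p * a p + radius p * pd i.succ a p
  sum_dir_mul_η : ∀ p ∈ region J, ∑ i, dir i p * η i p = a p
  pd_η : ∀ p ∈ region J, ∀ i j, radius p * pd i.succ (η j) p =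
    φ p * proj i j p - (1 / 2) * a p * N i j p

theorem pd_radius_mul {a : Pt → ℝ} (hr : 0 < radius p) (ha : DifferentiableAt ℝ a p) (i : Fin 3) :
    pd i.succ (fun q => radius q * a q) p = dir i p * a p + radius p * pd i.succ a p := by
  rw [pd_mul (differentiableAt_radius hr) ha, pd_radius_succ hr]

section gradient

variable {a : Pt → ℝ} {η : Fin 3 → Pt → ℝ} (hJ : IsOpen J) (ha : ScriSmooth J a)
  (hη : ∀ p ∈ region J, ∀ i, η i p = dir i p * a p + radius p * pd i.succ a p)
include ha hη

/-- η is the gradient of r a, which is homogeneous of degree one; this is Euler's identity. -/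
theorem sum_dir_mul_gradient (hp : p ∈ region J) : ∑ i, dir i p * η i p = a p := by
  have h := ha.dr_eq_zero hp
  rw [dr] at h
  simp only [hη p hp, mul_add, Finset.sum_add_distrib, ← mul_assoc, ← Finset.sum_mul,
    sum_dir_sq hp.2, one_mul]
  simp only [mul_comm _ (radius p), mul_assoc, ← Finset.mul_sum, h, mul_zero, add_zero]

include hJ

theorem pd_gradient_eq (hp : p ∈ region J) (b : Fin 4) (i : Fin 3) :
    pd b (η i) p = pd b (pd i.succ fun q => radius q * a q) p :=
  pd_congr (by
    filter_upwards [eventually_mem_region_nhds hJ hp] with q hq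
    rw [hη q hq, pd_radius_mul hq.2 (ha.differentiableAt hq)]) b

theorem pd_gradient_symm (hp : p ∈ region J) (i j : Fin 3) :
    pd i.succ (η j) p = pd j.succ (η i) p := by
  rw [pd_gradient_eq hJ ha hη hp, pd_gradient_eq hJ ha hη hp,
    pd_comm ((contDiffAt_radius hp.2).mul (ha.contDiffAt p hp))]

theorem pd_zero_gradient (ha0 : ∀ p ∈ region J, pd 0 a p = 0) (hp : p ∈ region J) (i : Fin 3) :
    pd 0 (η i) p = 0 := by
  rw [pd_gradient_eq hJ ha hη hp, pd_comm ((contDiffAt_radius hp.2).mul (ha.contDiffAt p hp)),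
    pd_congr (G := fun _ => (0 : ℝ)), pd_const]
  filter_upwards [eventually_mem_region_nhds hJ hp] with q hq
  rw [pd_mul (differentiableAt_radius hq.2) (ha.differentiableAt hq), pd_radius_zero hq.2, ha0 q hq]
  ring

end gradient

theorem ScriSmooth.eq_zero_of_isSymbol {c : Pt → ℝ} (hc : ScriSmooth J c) (hp : p ∈ region J)
    (h : IsSymbol (p 0) (-2) fun q => c q * (radius q)⁻¹) : c p = 0 :=
  hc.eq_zero_of_hasOrder hp.1 (d := -1) (e := -2) (by simpa using h.hasOrder) (by norm_num) rfl hp.2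

namespace IsAsymptoticallyFlat

variable (hg : IsAsymptoticallyFlat J D g) (hξ : IsKilling D g ξ)
include hg

/-- This is where the news tensor enters the Killing equation: ∂_u costs no power of r, so ∂_u C/r
stands at the same order as the angular derivatives of ξ. -/
theorem isSymbol_pd_zero_metric {C : Fin 3 → Fin 3 → Pt → ℝ} (hC : ∀ i j, ScriSmooth J (C i j))
    (hCh : ∀ u ∈ J, ∀ i j : Fin 3, IsSymbol u (-2)
      fun p => pert g i.succ j.succ p - C i j p * (radius p)⁻¹) (hu : u₀ ∈ J) (i j : Fin 3) :
    IsSymbol u₀ (-2) fun p => pd 0 (fun q => g q i.succ j.succ) p - pd 0 (C i j) p * (radius p)⁻¹ := by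
  refine (hCh u₀ hu i j).pd_zero.congr ?_
  filter_upwards [hg.eventually_mem hu, eventually_mem_region hg.isOpen_J hu] with p hp hq
  have hr := hq.2
  have hi := (differentiableAt_radius hr).fun_inv hr.ne'
  have hc := (hC i j).differentiableAt hq
  have hm := pd_minkowski_zero hr i.succ j.succ
  simp only [minkowski_succ_succ] at hm
  rw [pd_neg] at hm
  rw [pd_sub (hg.differentiableAt_pert hp _ _) (hc.fun_mul hi), pd_mul hc hi,
    pd_inv (differentiableAt_radius hr) hr.ne', pd_radius_zero hr, metric_eq,
    pd_sub (hg.differentiableAt_pert hp _ _) (hg.differentiableAt_proj hp i j)]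
  linarith

theorem isSymbol_metric_zero (hu : u₀ ∈ J) (j : Fin 3) :
    IsSymbol u₀ (-1) fun p => g p 0 j.succ - dir j p :=
  (hg.isSymbol_pert hu 0 j.succ).congr (Eventually.of_forall fun p => by
    rw [pert, minkowski_zero_succ])

theorem isSymbol_metric_succ (hu : u₀ ∈ J) (i j : Fin 3) :
    IsSymbol u₀ (-1) fun p => g p i.succ j.succ + proj i j p :=
  (hg.isSymbol_pert hu i.succ j.succ).congr (Eventually.of_forall fun p => by
    rw [pert, minkowski_succ_succ]; ring)

include hξ

/-- The leading order of the Killing equation for the spatial components. -/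
theorem killing_leading {C : Fin 3 → Fin 3 → Pt → ℝ} (hC : ∀ i j, ScriSmooth J (C i j))
    (hCh : ∀ u ∈ J, ∀ i j : Fin 3, IsSymbol u (-2)
      fun p => pert g i.succ j.succ p - C i j p * (radius p)⁻¹)
    {a : Pt → ℝ} (ha : ScriSmooth J a) (hξa : ∀ u ∈ J, ∀ᶠ p in nearScri u, ξ p 0 = a p)
    {c : Fin 3 → Pt → ℝ} (hc : ∀ i, ScriSmooth J (c i))
    (hξc : ∀ u ∈ J, ∀ i : Fin 3, IsSymbol u (-1) fun p => ξ p i.succ - c i p)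
    (hp : p ∈ region J) (i j : Fin 3) :
    a p * pd 0 (C i j) p
      + (∑ k, c k p * (proj k i p * dir j p + dir i p * proj k j p))
      + (dir j p * (radius p * pd i.succ a p) - ∑ k, proj k j p * (radius p * pd i.succ (c k) p))
      + (dir i p * (radius p * pd j.succ a p) - ∑ k, proj i k p * (radius p * pd j.succ (c k) p))
      = 0 := by
  have hJ := hg.isOpen_J
  have hu : p 0 ∈ J := hp.1
  have hS : ScriSmooth J fun p => a p * pd 0 (C i j) p
      + (∑ k, c k p * (proj k i p * dir j p + dir i p * proj k j p))
      + (dir j p * (radius p * pd i.succ a p) - ∑ k, proj k j p * (radius p * pd i.succ (c k) p))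
      + (dir i p * (radius p * pd j.succ a p)
        - ∑ k, proj i k p * (radius p * pd j.succ (c k) p)) :=
    ((((ha.mul ((hC i j).pd_zero hJ)).add (ScriSmooth.sum _ fun k _ => (hc k).mul
      (((ScriSmooth.proj k i).mul (ScriSmooth.dir j)).add
        ((ScriSmooth.dir i).mul (ScriSmooth.proj k j))))).add
      (((ScriSmooth.dir j).mul (ha.radius_mul_pd hJ i)).sub
        (ScriSmooth.sum _ fun k _ => (ScriSmooth.proj k j).mul ((hc k).radius_mul_pd hJ i))))).add
      (((ScriSmooth.dir i).mul (ha.radius_mul_pd hJ j)).sub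
        (ScriSmooth.sum _ fun k _ => (ScriSmooth.proj i k).mul ((hc k).radius_mul_pd hJ j)))
  -- Up to sign, the expression over r is the r⁻¹ part of (𝓛_ξ g)_ij = 0. The remainders `t1` to
  -- `t4`, from ξ^u ∂_u g, ξ^k ∂_k g and the derivatives of ξ^u and of ξ^k, are of order r⁻².
  refine hS.eq_zero_of_isSymbol hp ?_
  have sa := ha.isSymbol hJ hu
  have sc := fun k => (hc k).isSymbol hJ hu
  have sξ : ∀ k : Fin 3, IsSymbol (p 0) 0 fun q => ξ q k.succ := fun k =>
    (((hξc _ hu k).mono (by norm_num)).add (sc k)).congr (Eventually.of_forall fun q => by ring)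
  have t1 : IsSymbol (p 0) (-2) fun q => a q * (pd 0 (fun q => g q i.succ j.succ) q
      - pd 0 (C i j) q * (radius q)⁻¹) := sa.mul (hg.isSymbol_pd_zero_metric hC hCh hu i j) (by simp)
  have t2 : ∀ k : Fin 3, IsSymbol (p 0) (-2) fun q =>
      ξ q k.succ * (pd k.succ (pert g i.succ j.succ) q)
      - (ξ q k.succ - c k q) * pd k.succ (proj i j) q := fun k =>
    ((sξ k).mul ((hg.isSymbol_pert hu _ _).pd_succ k (e := -2) (by norm_num)) (by simp)).sub
      ((hξc _ hu k).mul ((IsSymbol.proj i j).pd_succ k (e := -1) (by norm_num)) (by norm_num))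
  have t3 : ∀ i j : Fin 3, IsSymbol (p 0) (-2) fun q => (g q 0 j.succ - dir j q) * pd i.succ a q :=
    fun i j => (hg.isSymbol_metric_zero hu j).mul (sa.pd_succ i (e := -1) (by norm_num)) (by norm_num)
  have t4 : ∀ i j k : Fin 3, IsSymbol (p 0) (-2) fun q =>
      (g q k.succ j.succ + proj k j q) * pd i.succ (fun q => ξ q k.succ) q
      - proj k j q * pd i.succ (fun q => ξ q k.succ - c k q) q := fun i j k =>
    ((hg.isSymbol_metric_succ hu k j).mul ((sξ k).pd_succ i (e := -1) (by norm_num))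
      (by norm_num)).sub ((IsSymbol.proj k j).mul ((hξc _ hu k).pd_succ i (e := -2) (by norm_num))
      (by norm_num))
  refine ((((t1.add (IsSymbol.sum Finset.univ fun k _ => t2 k)).add ((t3 i j).add (t3 j i))).add
    ((IsSymbol.sum Finset.univ fun k _ => t4 i j k).add (IsSymbol.sum Finset.univ fun k _ => t4 j i k))).neg).congr ?_
  filter_upwards [hg.eventually_mem hu, eventually_mem_region hJ hu, hξa _ hu,
    pd_congr_nearScri (hξa _ hu) i.succ, pd_congr_nearScri (hξa _ hu) j.succ] with q hq hqr h0 hi hj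
  have hr := hqr.2
  have hL := hξ.2 q hq i.succ j.succ
  rw [lieMetric, Fin.sum_univ_succ, h0, hi, hj] at hL
  have e1 : ∀ k : Fin 3, pd k.succ (fun q => g q i.succ j.succ) q =
      pd k.succ (pert g i.succ j.succ) q - pd k.succ (proj i j) q := fun k => by
    rw [metric_eq, pd_sub (hg.differentiableAt_pert hq _ _) (hg.differentiableAt_proj hq i j)]
  have e2 : ∀ k l : Fin 3, pd l.succ (fun q => ξ q k.succ - c k q) q =
      pd l.succ (fun q => ξ q k.succ) q - pd l.succ (c k) q := fun k l =>
    pd_sub (hξ.differentiableAt hg.isOpen_D hq _) ((hc k).differentiableAt hqr) _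
  simp only [e2]
  simp only [e1] at hL
  have e3 : ∀ k : Fin 3, proj k i q * dir j q + dir i q * proj k j q =
      -(radius q * pd k.succ (proj i j) q) := fun k => by
    rw [pd_proj hr]; field_simp
  simp only [e3]
  have hs : g q i.succ 0 = g q 0 i.succ := hg.symm hq _ _
  have hs' : ∀ k : Fin 3, g q i.succ k.succ = g q k.succ i.succ := fun k => hg.symm hq _ _
  have hs'' : ∀ k : Fin 3, proj i k q = proj k i q := fun k => proj_symm _ _ _
  rw [hs] at hL
  simp only [hs', hs''] at hL ⊢
  simp only [Fin.sum_univ_three] at hL ⊢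
  have hrr : radius q * (radius q)⁻¹ = 1 := mul_inv_cancel₀ hr.ne'
  generalize (radius q)⁻¹ = s at hrr ⊢
  generalize radius q = r at hrr ⊢
  linear_combination (-1) * hL + (
    (c 0 q * pd (Fin.succ 0) (proj i j) q + c 1 q * pd (Fin.succ 1) (proj i j) q
      + c 2 q * pd (Fin.succ 2) (proj i j) q) - dir j q * pd i.succ a q - dir i q * pd j.succ a q
    + (proj 0 j q * pd i.succ (c 0) q + proj 1 j q * pd i.succ (c 1) q
      + proj 2 j q * pd i.succ (c 2) q)
    + (proj 0 i q * pd j.succ (c 0) q + proj 1 i q * pd j.succ (c 1) q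
      + proj 2 i q * pd j.succ (c 2) q)) * hrr

/-- The leading order of a supertranslational Killing field. -/
theorem exists_killingData (hS : IsSupertranslational J ξ) {C : Fin 3 → Fin 3 → Pt → ℝ}
    (hC : ∀ i j, ScriSmooth J (C i j))
    (hCh : ∀ u ∈ J, ∀ i j : Fin 3, IsSymbol u (-2)
      fun p => pert g i.succ j.succ p - C i j p * (radius p)⁻¹)
    (htr : ∀ p ∈ region J, ∑ i, C i i p = 0) :
    ∃ (a φ : Pt → ℝ) (η : Fin 3 → Pt → ℝ), IsKillingData J (fun i j => pd 0 (C i j)) a φ η ∧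
      (∀ u ∈ J, ∀ᶠ p in nearScri u, ξ p 0 = a p) ∧
      ∀ u ∈ J, ∀ i : Fin 3, IsSymbol u (-1) fun p => ξ p i.succ - (dir i p * φ p - η i p) := by
  have hJ := hg.isOpen_J
  obtain ⟨a, ha, ha0, hane, hξa⟩ := hg.exists_killing_zero hξ hS
  obtain ⟨c, hc, hξc, hca⟩ := hg.exists_killing_succ hξ hS ha ha0 hξa
  -- As x·η = a, this is the choice for which c_i = x_i φ - η_i: the tangential part of c is already
  -- known to be that of -η.
  let φ : Pt → ℝ := fun p => ∑ j, dir j p * c j p + a p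
  let η : Fin 3 → Pt → ℝ := fun i p => dir i p * a p + radius p * pd i.succ a p
  have hφ : ScriSmooth J φ := (ScriSmooth.sum _ fun j _ => (ScriSmooth.dir j).mul (hc j)).add ha
  have hη : ∀ i, ScriSmooth J (η i) := fun i =>
    ((ScriSmooth.dir i).mul ha).add (ha.radius_mul_pd hJ i)
  have hηe : ∀ p ∈ region J, ∀ i, η i p = dir i p * a p + radius p * pd i.succ a p :=
    fun _ _ _ => rfl
  have hc' : ∀ p ∈ region J, ∀ i, c i p = dir i p * φ p - η i p := fun p hp i => by
    have h1 := hca p hp i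
    rw [sum_proj_mul_eq (fun j => c j p)] at h1
    simp only [φ, η]
    linarith
  have hξ' : ∀ u ∈ J, ∀ i : Fin 3, IsSymbol u (-1) fun p => ξ p i.succ - (dir i p * φ p - η i p) :=
    fun u hu i => (hξc u hu i).congr (by
      filter_upwards [eventually_mem_region hJ hu] with p hp
      rw [hc' p hp])
  have hηs := fun p (hp : p ∈ region J) i j => pd_gradient_symm hJ ha hηe hp i j
  have hηx := fun p (hp : p ∈ region J) => sum_dir_mul_gradient ha hηe hp
  have hη0 := fun p (hp : p ∈ region J) i => pd_zero_gradient hJ ha hηe ha0 hp i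
  have hmain : ∀ p ∈ region J, ∀ i j, radius p * pd i.succ (η j) p =
      φ p * proj i j p - (1 / 2) * a p * pd 0 (C i j) p := fun p hp i j => by
    have hr := hp.2
    have hd : ∀ i, DifferentiableAt ℝ (dir i) p := fun i =>
      differentiableAt_of_smooth (contDiffAt_dir hr i)
    have h := hg.killing_leading hξ hC hCh ha hξa (c := fun i p => dir i p * φ p - η i p)
      (fun i => ((ScriSmooth.dir i).mul hφ).sub (hη i)) hξ' hp i j
    have e1 : ∀ i k, radius p * pd i.succ (fun q => dir k q * φ q - η k q) p =
        proj i k p * φ p + dir k p * (radius p * pd i.succ φ p) - radius p * pd i.succ (η k) p :=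
      fun i k => by
        rw [pd_sub ((hd k).fun_mul (hφ.differentiableAt hp)) ((hη k).differentiableAt hp),
          pd_mul (hd k) (hφ.differentiableAt hp), pd_dir_succ hr]
        field_simp
    -- The Jacobian of η is symmetric and η is homogeneous of degree zero, so x annihilates it from
    -- both sides.
    have e2 : ∀ i : Fin 3, ∑ k, dir k p * pd i.succ (η k) p = 0 := fun i => by
      simp only [hηs p hp i]
      exact (hη i).dr_eq_zero hp
    have e3 : ∀ i j, ∑ k, proj k j p * (proj i k p * φ p + dir k p * (radius p * pd i.succ φ p)
        - radius p * pd i.succ (η k) p) = proj i j p * φ p - radius p * pd i.succ (η j) p :=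
      fun i j => by
        rw [sum_proj_mul_eq]
        have h1 := sum_dir_mul_proj hr i
        have h2 := sum_dir_sq hr
        have h3 := e2 i
        simp only [Fin.sum_univ_three, proj_symm _ i] at h1 h2 h3 ⊢
        linear_combination (-(dir j p)) * φ p * h1 - dir j p * radius p * pd i.succ φ p * h2
          + dir j p * radius p * h3
    have e4 : ∀ i j, ∑ k, (dir k p * φ p - η k p) * (proj k i p * dir j p + dir i p * proj k j p) =
        -(radius p * pd i.succ a p * dir j p + radius p * pd j.succ a p * dir i p) := fun i j => by
      have h1 := sum_proj_mul_eq (p := p) (fun k => dir k p * φ p - η k p) i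
      have h2 := sum_proj_mul_eq (p := p) (fun k => dir k p * φ p - η k p) j
      have h3 : ∑ k, dir k p * (dir k p * φ p - η k p) = φ p - a p := by
        rw [← hηx p hp]
        simp only [mul_sub, Finset.sum_sub_distrib, ← mul_assoc, ← Finset.sum_mul, sum_dir_sq hr,
          one_mul]
      rw [h3] at h1 h2
      simp only [hηe p hp] at h1 h2 ⊢
      simp only [Fin.sum_univ_three] at h1 h2 ⊢
      linear_combination dir j p * h1 + dir i p * h2
    have e5 : ∑ k, proj i k p * (proj j k p * φ p + dir k p * (radius p * pd j.succ φ p)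
        - radius p * pd j.succ (η k) p) = proj i j p * φ p - radius p * pd i.succ (η j) p := by
      rw [proj_symm i j, hηs p hp i j, ← e3 j i]
      exact Finset.sum_congr rfl fun k _ => by rw [proj_symm i k]
    simp only [e1] at h
    rw [e4, e3, e5] at h
    linarith
  refine ⟨a, φ, η, ⟨ha, hφ, hη, ha0, hη0, fun p hp => ?_, hane, hηe, hηx, hmain⟩, hξa, hξ'⟩
  -- The trace of `hmain`, with N trace-free and the projection of trace 2. It expresses φ through
  -- η, which transfers the independence of u.
  have hφe : ∀ q ∈ region J, φ q = (1 / 2) * ∑ i, radius q * pd i.succ (η i) q := fun q hq => by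
    have h1 := htr
    have h2 : ∑ i, pd 0 (C i i) q = 0 := by
      rw [← pd_sum _ fun i _ => (hC i i).differentiableAt hq, pd_congr (G := fun _ => (0 : ℝ)),
        pd_const]
      filter_upwards [eventually_mem_region_nhds hJ hq] with q' hq' using htr q' hq'
    have h3 : ∑ i, proj i i q = 2 := by
      have := sum_dir_sq hq.2
      simp only [proj, Fin.sum_univ_three, if_true] at this ⊢
      linarith
    simp only [hmain q hq, Finset.sum_sub_distrib, ← Finset.mul_sum, h2, h3]
    ring
  rw [pd_congr (G := fun q => (1 / 2) * ∑ i, radius q * pd i.succ (η i) q)]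
  · have hd : ∀ i : Fin 3, DifferentiableAt ℝ (pd i.succ (η i)) p := fun i =>
      differentiableAt_of_smooth (contDiffAt_pd ((hη i).contDiffAt p hp) _)
    have hr := differentiableAt_radius hp.2
    rw [pd_const_mul (DifferentiableAt.fun_sum fun i _ => hr.fun_mul (hd i)),
      pd_sum _ fun i _ => hr.fun_mul (hd i)]
    refine mul_eq_zero_of_right _ (Finset.sum_eq_zero fun i _ => ?_)
    rw [pd_mul hr (hd i), pd_radius_zero hp.2, pd_comm ((hη i).contDiffAt p hp),
      pd_congr (F := pd 0 (η i)) (G := fun _ => (0 : ℝ)), pd_const]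
    · ring
    · filter_upwards [eventually_mem_region_nhds hJ hp] with q hq using hη0 q hq i
  · filter_upwards [eventually_mem_region_nhds hJ hp] with q hq using hφe q hq

end IsAsymptoticallyFlat
end NullInfinity
end

noncomputable section

namespace NullInfinity

variable {u₀ : ℝ} {J : Set ℝ} {D : Set Pt} {g : MetricField} {p : Pt} {ξ : Pt → Fin 4 → ℝ}

/-! ### The norm of a Killing field in vacuum -/

/-- `ξ_a = g_ab ξ^b`. -/
def lower (g : MetricField) (ξ : Pt → Fin 4 → ℝ) (a : Fin 4) (p : Pt) : ℝ := ∑ b, g p a b * ξ p b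

/-- `F_ab = (∂_a ξ_b - ∂_b ξ_a) / 2`. -/
def twist (g : MetricField) (ξ : Pt → Fin 4 → ℝ) (a b : Fin 4) (p : Pt) : ℝ :=
  (1 / 2) * (pd a (lower g ξ b) p - pd b (lower g ξ a) p)

/-- `∇_a ξ^b`. -/
def covDeriv (g : MetricField) (ξ : Pt → Fin 4 → ℝ) (a b : Fin 4) (p : Pt) : ℝ :=
  pd a (fun q => ξ q b) p + ∑ c, christoffel g b a c p * ξ p c

/-- `g(ξ, ξ)`. -/
def normSq (g : MetricField) (ξ : Pt → Fin 4 → ℝ) (p : Pt) : ℝ := ∑ a, ξ p a * lower g ξ a p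

/-- `Γ^d_dc`. -/
def trChristoffel (g : MetricField) (c : Fin 4) (p : Pt) : ℝ := ∑ d, christoffel g d d c p

/-- `g^ab ∂_b f`. -/
def grad (g : MetricField) (f : Pt → ℝ) (a : Fin 4) (p : Pt) : ℝ := ∑ b, (g p)⁻¹ a b * pd b f p

theorem twist_antisymm (a b : Fin 4) (p : Pt) : twist g ξ a b p = -twist g ξ b a p := by
  simp only [twist]; ring

/-- The contracted Ricci identity ∇_c∇_aξ^c = ∇_a∇_cξ^c + R_ea ξ^e as pure algebra, with `G`, `dG`,
`dx`, `ddx` standing for Γ, ∂Γ, ∂ξ, ∂∂ξ. -/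
theorem ricci_identity_aux {G : Fin 4 → Fin 4 → Fin 4 → ℝ} (hG : ∀ c a b, G c a b = G c b a)
    (dG : Fin 4 → Fin 4 → Fin 4 → Fin 4 → ℝ) (x : Fin 4 → ℝ) (dx : Fin 4 → Fin 4 → ℝ)
    (ddx : Fin 4 → Fin 4 → Fin 4 → ℝ) (hdd : ∀ a b c, ddx a b c = ddx b a c) (a : Fin 4) :
    ∑ c, (ddx c a c + ∑ e, (dG c c a e * x e + G c a e * dx c e)
      + ∑ e, (G c c e * (dx a e + ∑ d, G e a d * x d) - G e c a * (dx e c + ∑ d, G c e d * x d)))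
    = ∑ c, (ddx a c c + ∑ e, (dG a c c e * x e + G c c e * dx a e))
      + ∑ e, (∑ c, (dG c c a e - dG a c c e + ∑ d, (G c c d * G d a e - G c a d * G d c e))) * x e := by
  have h1 : ∑ c, ∑ e, G e c a * dx e c = ∑ c, ∑ e, G c a e * dx c e := by
    rw [Finset.sum_comm]
    exact Finset.sum_congr rfl fun c _ => Finset.sum_congr rfl fun e _ => by rw [hG c a e]
  have h2 : ∑ c, ∑ e, ∑ d, G c c e * (G e a d * x d) = ∑ e, ∑ c, ∑ d, G c c d * G d a e * x e := by
    rw [Finset.sum_comm (γ := Fin 4) (s := Finset.univ) (f := fun e c => ∑ d, G c c d * G d a e * x e)]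
    refine Finset.sum_congr rfl fun c _ => ?_
    rw [Finset.sum_comm]
    exact Finset.sum_congr rfl fun _ _ => Finset.sum_congr rfl fun _ _ => by ring
  have h3 : ∑ c, ∑ e, ∑ d, G e c a * (G c e d * x d) = ∑ e, ∑ c, ∑ d, G c a d * G d c e * x e := by
    rw [Finset.sum_comm]
    rw [Finset.sum_comm (γ := Fin 4) (s := Finset.univ) (f := fun e c => ∑ d, G c a d * G d c e * x e)]
    refine Finset.sum_congr rfl fun c _ => ?_
    rw [Finset.sum_comm]
    rw [Finset.sum_comm (γ := Fin 4) (s := Finset.univ) (f := fun e d => G c a d * G d c e * x e)]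
    rw [Finset.sum_comm]
    exact Finset.sum_congr rfl fun _ _ => Finset.sum_congr rfl fun _ _ => by rw [hG c a]; ring
  have h4 : ∑ e, ∑ c, dG c c a e * x e = ∑ c, ∑ e, dG c c a e * x e := Finset.sum_comm
  have h5 : ∑ e, ∑ c, dG a c c e * x e = ∑ c, ∑ e, dG a c c e * x e := Finset.sum_comm
  simp only [hdd a]
  simp only [mul_add, Finset.sum_add_distrib, Finset.sum_sub_distrib, Finset.mul_sum, Finset.sum_mul,
    add_mul, sub_mul, h1, h2, h3, h4, h5]
  ring

/-- If ξ^a ∇_c∇_aξ^c = 0, only the derivative of ξ^a contributes to the divergence of -2 ξ^a ∇_aξ^c.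
Here `B` stands for ∇ξ. -/
theorem divergence_aux (G : Fin 4 → Fin 4 → Fin 4 → ℝ) (x : Fin 4 → ℝ) (dx B : Fin 4 → Fin 4 → ℝ)
    (dB : Fin 4 → Fin 4 → Fin 4 → ℝ)
    (h : ∑ a, x a * ∑ c, (dB c a c + ∑ e, (G c c e * B a e - G e c a * B e c)) = 0) :
    ∑ c, (-2 * ∑ a, (dx c a * B a c + x a * dB c a c) +
      (∑ d, G d d c) * (-2 * ∑ a, x a * B a c)) =
      -2 * ∑ c, ∑ e, (dx c e + ∑ a, G e c a * x a) * B e c := by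
  have h1 : ∑ c, ∑ d, ∑ a, G d d c * (x a * B a c) = ∑ a, ∑ c, ∑ e, x a * (G c c e * B a e) := by
    rw [Finset.sum_comm' (t' := Finset.univ) (s' := fun _ => Finset.univ) (by simp)]
    rw [Finset.sum_comm (f := fun a c => ∑ e, x a * (G c c e * B a e))]
    refine Finset.sum_congr rfl fun c _ => ?_
    rw [Finset.sum_comm]
    exact Finset.sum_congr rfl fun _ _ => Finset.sum_congr rfl fun _ _ => by ring
  have h2 : ∑ c, ∑ e, ∑ a, G e c a * x a * B e c = ∑ a, ∑ c, ∑ e, x a * (G e c a * B e c) := by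
    rw [Finset.sum_comm (f := fun a c => ∑ e, x a * (G e c a * B e c))]
    refine Finset.sum_congr rfl fun c _ => ?_
    rw [Finset.sum_comm]
    exact Finset.sum_congr rfl fun _ _ => Finset.sum_congr rfl fun _ _ => by ring
  have h3 : ∑ a, ∑ c, x a * dB c a c = ∑ c, ∑ a, x a * dB c a c := Finset.sum_comm
  have h4 : ∑ c, (-2 * ∑ a, (dx c a * B a c + x a * dB c a c) +
      (∑ d, G d d c) * (-2 * ∑ a, x a * B a c)) = -2 * (∑ c, ∑ a, dx c a * B a c +
      ∑ c, ∑ a, x a * dB c a c + ∑ c, ∑ d, ∑ a, G d d c * (x a * B a c)) := by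
    rw [← Finset.sum_add_distrib, ← Finset.sum_add_distrib, Finset.mul_sum]
    refine Finset.sum_congr rfl fun c _ => ?_
    rw [Finset.sum_add_distrib, ← Finset.sum_mul_sum]
    ring
  have h5 : ∑ c, ∑ e, (dx c e + ∑ a, G e c a * x a) * B e c = ∑ c, ∑ e, dx c e * B e c +
      ∑ c, ∑ e, ∑ a, G e c a * x a * B e c := by
    simp only [add_mul, Finset.sum_mul, Finset.sum_add_distrib]
  simp only [mul_add, mul_sub, Finset.mul_sum, Finset.sum_add_distrib, Finset.sum_sub_distrib] at h
  rw [h4, h5, h1, h2, ← h3]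
  linear_combination (-2) * h

namespace IsAsymptoticallyFlat

variable (hg : IsAsymptoticallyFlat J D g)
include hg

theorem sum_inv_mul (hp : p ∈ D) (a b : Fin 4) :
    ∑ c, (g p)⁻¹ a c * g p c b = if a = b then 1 else 0 := by
  have h := congrFun (congrFun (hg.inv_mul hp) a) b
  rwa [Matrix.mul_apply, Matrix.one_apply] at h

theorem sum_mul_inv (hp : p ∈ D) (a b : Fin 4) :
    ∑ c, g p a c * (g p)⁻¹ c b = if a = b then 1 else 0 := by
  have h := congrFun (congrFun (hg.mul_inv hp) a) b
  rwa [Matrix.mul_apply, Matrix.one_apply] at h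

theorem trChristoffel_eq (hp : p ∈ D) (c : Fin 4) :
    trChristoffel g c p = (1 / 2) * ∑ a, ∑ b, (g p)⁻¹ a b * pd c (fun q => g q a b) p := by
  simp only [trChristoffel, christoffel, ← Finset.mul_sum]
  congr 1
  simp only [mul_add, mul_sub, Finset.sum_add_distrib, Finset.sum_sub_distrib]
  have h : ∑ d, ∑ e, (g p)⁻¹ d e * pd e (fun q => g q d c) p =
      ∑ d, ∑ e, (g p)⁻¹ d e * pd d (fun q => g q e c) p := by
    rw [Finset.sum_comm]
    exact Finset.sum_congr rfl fun _ _ => Finset.sum_congr rfl fun _ _ => by rw [hg.inv_symm hp]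
  rw [h]
  have h2 : ∑ d, ∑ e, (g p)⁻¹ d e * pd c (fun q => g q e d) p =
      ∑ d, ∑ e, (g p)⁻¹ d e * pd c (fun q => g q d e) p :=
    Finset.sum_congr rfl fun _ _ => Finset.sum_congr rfl fun _ _ => by rw [hg.pd_symm hp]
  rw [h2]; ring

theorem lower_christoffel (hp : p ∈ D) (d a c : Fin 4) :
    ∑ b, g p d b * christoffel g b a c p = (1 / 2) * (pd a (fun q => g q d c) p +
      pd c (fun q => g q d a) p - pd d (fun q => g q a c) p) := by
  simp only [christoffel, Finset.mul_sum]
  rw [Finset.sum_comm]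
  have : ∀ e, ∑ b, g p d b * ((1 / 2) * ((g p)⁻¹ b e * (pd a (fun q => g q e c) p +
      pd c (fun q => g q e a) p - pd e (fun q => g q a c) p))) =
      (if d = e then 1 else 0) * ((1 / 2) * (pd a (fun q => g q e c) p +
      pd c (fun q => g q e a) p - pd e (fun q => g q a c) p)) := fun e => by
    rw [← hg.sum_mul_inv hp d e, Finset.sum_mul]
    exact Finset.sum_congr rfl fun _ _ => by ring
  simp only [this]
  simp

variable (hξ : IsKilling D g ξ)
include hξ

theorem differentiableAt_covDeriv (hp : p ∈ D) (a b : Fin 4) :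
    DifferentiableAt ℝ (covDeriv g ξ a b) p :=
  (differentiableAt_of_smooth (contDiffAt_pd (hξ.contDiffAt hg.isOpen_D hp b) a)).fun_add
    (DifferentiableAt.fun_sum fun c _ => (differentiableAt_of_smooth
      (hg.contDiffAt_christoffel hp b a c)).fun_mul (hξ.differentiableAt hg.isOpen_D hp c))

theorem contDiffAt_lower (hp : p ∈ D) (a : Fin 4) : ContDiffAt ℝ ∞ (lower g ξ a) p :=
  ContDiffAt.sum fun b _ => (hg.contDiffAt hp a b).mul (hξ.contDiffAt hg.isOpen_D hp b)

theorem pd_lower (hp : p ∈ D) (a b : Fin 4) : pd a (lower g ξ b) p =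
    ∑ c, (pd a (fun q => g q b c) p * ξ p c + g p b c * pd a (fun q => ξ q c) p) := by
  have hd := hξ.differentiableAt hg.isOpen_D hp
  have h : pd a (fun q => ∑ c, g q b c * ξ q c) p = _ :=
    pd_sum _ (fun c _ => (hg.differentiableAt hp b c).fun_mul (hd c)) a
  exact h.trans (Finset.sum_congr rfl fun c _ => pd_mul (hg.differentiableAt hp b c) (hd c) a)

/-- The Killing equation removes the symmetric part of ∇_a ξ_d, which leaves the antisymmetrised
partial derivatives. -/
theorem lower_covDeriv (hp : p ∈ D) (a d : Fin 4) :
    ∑ b, g p d b * covDeriv g ξ a b p = twist g ξ a d p := by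
  have hK := hξ.2 p hp a d
  simp only [lieMetric, Finset.sum_add_distrib] at hK
  simp only [covDeriv, mul_add, Finset.sum_add_distrib, Finset.mul_sum]
  rw [Finset.sum_comm]
  simp only [← mul_assoc, ← Finset.sum_mul, hg.lower_christoffel hp]
  simp only [twist, hg.pd_lower hξ hp, Finset.sum_add_distrib]
  have h1 : ∑ c, 1 / 2 * (pd a (fun q => g q d c) p + pd c (fun q => g q d a) p
      - pd d (fun q => g q a c) p) * ξ p c = 1 / 2 * (∑ c, pd a (fun q => g q d c) p * ξ p c
      + ∑ c, ξ p c * pd c (fun q => g q a d) p - ∑ c, pd d (fun q => g q a c) p * ξ p c) := by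
    rw [← Finset.sum_add_distrib, ← Finset.sum_sub_distrib, Finset.mul_sum]
    exact Finset.sum_congr rfl fun c _ => by rw [hg.pd_symm hp c d a]; ring
  have h2 : ∑ c, g p c d * pd a (fun q => ξ q c) p = ∑ c, g p d c * pd a (fun q => ξ q c) p :=
    Finset.sum_congr rfl fun c _ => by rw [hg.symm hp]
  rw [h1]
  linarith

theorem covDeriv_eq (hp : p ∈ D) (a b : Fin 4) :
    covDeriv g ξ a b p = ∑ d, (g p)⁻¹ b d * twist g ξ a d p := by
  simp only [← hg.lower_covDeriv hξ hp, Finset.mul_sum]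
  rw [Finset.sum_comm]
  simp only [← mul_assoc, ← Finset.sum_mul, hg.sum_inv_mul hp]
  simp

theorem trace_covDeriv (hp : p ∈ D) : ∑ a, covDeriv g ξ a a p = 0 := by
  have h : ∑ a, ∑ d, (g p)⁻¹ a d * twist g ξ a d p = -∑ a, ∑ d, (g p)⁻¹ a d * twist g ξ a d p := by
    conv_lhs => rw [Finset.sum_comm]
    rw [← Finset.sum_neg_distrib]
    refine Finset.sum_congr rfl fun a _ => ?_
    rw [← Finset.sum_neg_distrib]
    exact Finset.sum_congr rfl fun d _ => by rw [hg.inv_symm hp, twist_antisymm]; ring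
  simp only [hg.covDeriv_eq hξ hp]
  linarith

/-- In the contracted Ricci identity ∇_cξ^c = 0 by antisymmetry of ∇ξ, and the Ricci term vanishes
in vacuum. -/
theorem divergence_covDeriv (hp : p ∈ D) (a : Fin 4) :
    ∑ c, (pd c (covDeriv g ξ a c) p + ∑ e, (christoffel g c c e p * covDeriv g ξ a e p
      - christoffel g e c a p * covDeriv g ξ e c p)) = 0 := by
  have hd := hξ.differentiableAt hg.isOpen_D hp
  have hΓ := fun a b c => differentiableAt_of_smooth (hg.contDiffAt_christoffel hp a b c)
  have hdd : ∀ a b, DifferentiableAt ℝ (pd a fun q => ξ q b) p := fun a b =>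
    differentiableAt_of_smooth (contDiffAt_pd (hξ.contDiffAt hg.isOpen_D hp b) a)
  have e1 : ∀ c a b, pd c (covDeriv g ξ a b) p = pd c (pd a fun q => ξ q b) p
      + ∑ e, (pd c (christoffel g b a e) p * ξ p e
        + christoffel g b a e p * pd c (fun q => ξ q e) p) := fun c a b => by
    have h : pd c (fun q => pd a (fun q => ξ q b) q + ∑ c, christoffel g b a c q * ξ q c) p = _ :=
      pd_add (hdd a b) (DifferentiableAt.fun_sum fun e _ => (hΓ b a e).fun_mul (hd e)) c
    rw [pd_sum _ fun e _ => (hΓ b a e).fun_mul (hd e)] at h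
    exact h.trans (by simp only [pd_mul (hΓ _ _ _) (hd _)])
  have h0 : ∑ c, pd a (covDeriv g ξ c c) p = 0 := by
    rw [← pd_sum _ fun c _ => hg.differentiableAt_covDeriv hξ hp c c,
      pd_congr (G := fun _ => (0 : ℝ)), pd_const]
    filter_upwards [hg.isOpen_D.mem_nhds hp] with q hq using hg.trace_covDeriv hξ hq
  have hR : ∀ e, ∑ c, (pd c (christoffel g c a e) p - pd a (christoffel g c c e) p +
      ∑ d, (christoffel g c c d p * christoffel g d a e p
        - christoffel g c a d p * christoffel g d c e p)) = 0 := fun e => hg.vacuum p hp e a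
  have := ricci_identity_aux (G := fun c a b => christoffel g c a b p)
    (fun c a b => hg.christoffel_symm hp c a b) (fun d c a b => pd d (christoffel g c a b) p) (ξ p)
    (fun c e => pd c (fun q => ξ q e) p) (fun a b c => pd a (pd b fun q => ξ q c) p)
    (fun a b c => pd_comm (hξ.contDiffAt hg.isOpen_D hp c) a b) a
  simp only [hR, zero_mul, Finset.sum_const_zero, add_zero, ← e1, h0] at this
  exact this

/-- Subtracting ξ^c (𝓛_ξ g)_dc = 0 from the derivative of ξ^a ξ_a produces the curl without any
Christoffel symbols. -/
theorem pd_normSq (hp : p ∈ D) (d : Fin 4) :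
    pd d (normSq g ξ) p = 2 * ∑ b, ξ p b * twist g ξ d b p := by
  have hd := hξ.differentiableAt hg.isOpen_D hp
  have hl := fun a => differentiableAt_of_smooth (hg.contDiffAt_lower hξ hp a)
  have h : pd d (fun q => ∑ a, ξ q a * lower g ξ a q) p = _ :=
    pd_sum _ (fun c _ => (hd c).fun_mul (hl c)) d
  simp only [pd_mul (hd _) (hl _)] at h
  refine h.trans ?_
  have hK : ∑ c, ξ p c * lieMetric g ξ d c p = 0 := by simp [hξ.2 p hp]
  have h1 : ∑ c, ξ p c * lieMetric g ξ d c p =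
      ∑ b, ξ p b * pd b (lower g ξ d) p + ∑ b, pd d (fun q => ξ q b) p * lower g ξ b p := by
    simp only [lieMetric, hg.pd_lower hξ hp, lower, mul_add, Finset.mul_sum, Finset.sum_add_distrib]
    have k1 : ∑ x, ∑ i, ξ p x * (ξ p i * pd i (fun q => g q d x) p) =
        ∑ x, ∑ i, ξ p x * (pd x (fun q => g q d i) p * ξ p i) := by
      rw [Finset.sum_comm]
      exact Finset.sum_congr rfl fun _ _ => Finset.sum_congr rfl fun _ _ => by ring
    have k2 : ∑ x, ∑ i, ξ p x * (g p i x * pd d (fun q => ξ q i) p) =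
        ∑ x, ∑ i, pd d (fun q => ξ q x) p * (g p x i * ξ p i) := by
      rw [Finset.sum_comm]
      exact Finset.sum_congr rfl fun _ _ => Finset.sum_congr rfl fun _ _ => by ring
    rw [k1, k2]; ring
  simp only [twist, Finset.sum_add_distrib, Finset.mul_sum]
  have h2 : ∑ i, 2 * (ξ p i * (1 / 2 * (pd d (lower g ξ i) p - pd i (lower g ξ d) p))) =
      ∑ i, ξ p i * pd d (lower g ξ i) p - ∑ i, ξ p i * pd i (lower g ξ d) p := by
    rw [← Finset.sum_sub_distrib]
    exact Finset.sum_congr rfl fun _ _ => by ring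
  rw [h2]
  linarith

theorem sum_mul_pd_normSq (hp : p ∈ D) : ∑ d, ξ p d * pd d (normSq g ξ) p = 0 := by
  have h : ∑ a, ∑ b, ξ p a * ξ p b * twist g ξ a b p = -∑ a, ∑ b, ξ p a * ξ p b * twist g ξ a b p := by
    conv_lhs => rw [Finset.sum_comm]
    rw [← Finset.sum_neg_distrib]
    refine Finset.sum_congr rfl fun a _ => ?_
    rw [← Finset.sum_neg_distrib]
    exact Finset.sum_congr rfl fun d _ => by rw [twist_antisymm]; ring
  have h2 : ∑ d, ξ p d * pd d (normSq g ξ) p = 2 * ∑ a, ∑ b, ξ p a * ξ p b * twist g ξ a b p := by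
    simp only [hg.pd_normSq hξ hp, Finset.mul_sum]
    exact Finset.sum_congr rfl fun _ _ => Finset.sum_congr rfl fun _ _ => by ring
  linarith

theorem grad_normSq (hp : p ∈ D) (c : Fin 4) :
    grad g (normSq g ξ) c p = -2 * ∑ a, ξ p a * covDeriv g ξ a c p := by
  simp only [grad, hg.pd_normSq hξ hp, hg.covDeriv_eq hξ hp, Finset.mul_sum]
  rw [Finset.sum_comm]
  exact Finset.sum_congr rfl fun _ _ => Finset.sum_congr rfl fun _ _ => by
    rw [twist_antisymm]; ring

/-- The wave equation for the norm of a Killing field in vacuum. -/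
theorem divergence_grad_normSq (hp : p ∈ D) :
    ∑ c, (pd c (grad g (normSq g ξ) c) p + trChristoffel g c p * grad g (normSq g ξ) c p) =
      -2 * ∑ c, ∑ e, covDeriv g ξ c e p * covDeriv g ξ e c p := by
  have hd := hξ.differentiableAt hg.isOpen_D hp
  have hB := fun a b => hg.differentiableAt_covDeriv hξ hp a b
  have e1 : ∀ c, pd c (grad g (normSq g ξ) c) p = -2 * ∑ a, (pd c (fun q => ξ q a) p *
      covDeriv g ξ a c p + ξ p a * pd c (covDeriv g ξ a c) p) := fun c => by
    rw [pd_congr (G := fun q => -2 * ∑ a, ξ q a * covDeriv g ξ a c q),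
      pd_const_mul (DifferentiableAt.fun_sum fun a _ => (hd a).fun_mul (hB a c)),
      pd_sum _ fun a _ => (hd a).fun_mul (hB a c)]
    · simp only [pd_mul (hd _) (hB _ _)]
    · filter_upwards [hg.isOpen_D.mem_nhds hp] with q hq using hg.grad_normSq hξ hq c
  have h0 : ∑ a, ξ p a * ∑ c, (pd c (covDeriv g ξ a c) p + ∑ e, (christoffel g c c e p *
      covDeriv g ξ a e p - christoffel g e c a p * covDeriv g ξ e c p)) = 0 := by
    simp only [hg.divergence_covDeriv hξ hp, mul_zero, Finset.sum_const_zero]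
  simp only [e1, hg.grad_normSq hξ hp, trChristoffel]
  have h := divergence_aux (fun c a b => christoffel g c a b p) (ξ p)
    (fun c a => pd c (fun q => ξ q a) p) (fun a c => covDeriv g ξ a c p)
    (fun d a c => pd d (covDeriv g ξ a c) p) h0
  rw [h]
  rfl

end IsAsymptoticallyFlat
end NullInfinity
end

/-! ### Decay of the covariant derivative of the Killing field -/

noncomputable section

namespace NullInfinity

variable {u₀ : ℝ} {J : Set ℝ} {D : Set Pt} {g : MetricField} {p : Pt} {ξ : Pt → Fin 4 → ℝ}
  {N : Fin 3 → Fin 3 → Pt → ℝ} {a φ : Pt → ℝ} {η : Fin 3 → Pt → ℝ}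

theorem pd_zero_dr {F : Pt → ℝ} (hp : 0 < radius p) (hF : ContDiffAt ℝ ∞ F p) :
    pd 0 (dr F) p = dr (pd 0 F) p := by
  have hd : ∀ i, DifferentiableAt ℝ (dir i) p := fun i =>
    differentiableAt_of_smooth (contDiffAt_dir hp i)
  have hF' : ∀ i : Fin 3, DifferentiableAt ℝ (pd i.succ F) p := fun i =>
    differentiableAt_of_smooth (contDiffAt_pd hF _)
  have h : pd 0 (fun q => ∑ i : Fin 3, dir i q * pd i.succ F q) p = _ :=
    pd_sum _ (fun i _ => (hd i).fun_mul (hF' i)) 0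
  refine h.trans (Finset.sum_congr rfl fun i _ => ?_)
  rw [pd_mul (hd i) (hF' i), pd_dir_zero hp, pd_comm hF, zero_mul, zero_add]

/-- The leading coefficient of `g(ξ, ξ)`. -/
def leadingNorm (a φ : Pt → ℝ) (η : Fin 3 → Pt → ℝ) (p : Pt) : ℝ :=
  2 * a p * φ p - ∑ i, η i p * η i p

/-- `r ∂_i` of the leading coefficient of `g(ξ, ξ)`. -/
def leadingGrad (a φ : Pt → ℝ) (η : Fin 3 → Pt → ℝ) (i : Fin 3) (p : Pt) : ℝ :=
  radius p * pd i.succ (leadingNorm a φ η) p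

namespace IsKillingData

variable (hk : IsKillingData J N a φ η)
include hk

theorem scri_leadingNorm : ScriSmooth J (leadingNorm a φ η) :=
  (((ScriSmooth.const 2).mul hk.scri_a).mul hk.scri_φ).sub
    (ScriSmooth.sum _ fun i _ => (hk.scri_η i).mul (hk.scri_η i))

theorem scri_leadingGrad (hJ : IsOpen J) (i : Fin 3) : ScriSmooth J (leadingGrad a φ η i) :=
  hk.scri_leadingNorm.radius_mul_pd hJ i

theorem pd_leadingNorm (hp : p ∈ region J) (b : Fin 4) : pd b (leadingNorm a φ η) p =
    2 * (pd b a p * φ p + a p * pd b φ p) - 2 * ∑ i, η i p * pd b (η i) p := by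
  have ha := hk.scri_a.differentiableAt hp
  have hφ := hk.scri_φ.differentiableAt hp
  have hη := fun i => (hk.scri_η i).differentiableAt hp
  have h : pd b (fun q => 2 * a q * φ q - ∑ i, η i q * η i q) p = _ :=
    pd_sub ((ha.const_mul 2).fun_mul hφ) (DifferentiableAt.fun_sum fun i _ => (hη i).fun_mul (hη i)) b
  rw [pd_mul (ha.const_mul 2) hφ, pd_const_mul ha, pd_sum _ fun i _ => (hη i).fun_mul (hη i)] at h
  refine h.trans ?_
  simp only [pd_mul (hη _) (hη _), Finset.mul_sum]
  congr 1
  · ring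
  · exact Finset.sum_congr rfl fun _ _ => by ring

theorem pd_zero_leadingNorm (hp : p ∈ region J) : pd 0 (leadingNorm a φ η) p = 0 := by
  simp [hk.pd_leadingNorm hp, hk.pd_zero_a p hp, hk.pd_zero_φ p hp, hk.pd_zero_η p hp]

theorem pd_η_symm (hJ : IsOpen J) (hp : p ∈ region J) (i j : Fin 3) :
    pd i.succ (η j) p = pd j.succ (η i) p :=
  pd_gradient_symm hJ hk.scri_a hk.η_eq hp i j

end IsKillingData

/-- The expansion of ∇_cξ^e ∇_eξ^c, with F_i for the component 0i of the twist. The largest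
components F_i occur quadratically only in the combination x·F, which decays faster. -/
theorem sum_sq_aux (x F A B : Fin 3 → ℝ) (G : Fin 3 → Fin 3 → ℝ) :
    2 * ((∑ j, x j * F j) * ∑ j, x j * F j) + 2 * ∑ j, B j * A j
      + -2 * ∑ i, ∑ j, x j * F i * G j i + ∑ i, ∑ j, G i j * G j i =
    (∑ j, x j * F j) * (∑ j, x j * F j) + ∑ j, B j * A j + (∑ i, A i * B i
      + ∑ i, ∑ j, (x j * -F i + G i j) * (x i * -F j + G j i)) := by
  simp only [Fin.sum_univ_three]
  ring

namespace IsAsymptoticallyFlat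

variable (hg : IsAsymptoticallyFlat J D g) (hξ : IsKilling D g ξ) (hk : IsKillingData J N a φ η)
  (hξa : ∀ u ∈ J, ∀ᶠ p in nearScri u, ξ p 0 = a p)
  (hξs : ∀ u ∈ J, ∀ i : Fin 3, IsSymbol u (-1) fun p => ξ p i.succ - (dir i p * φ p - η i p))

section
include hg hk hξa hξs

theorem isSymbol_killing (hu : u₀ ∈ J) (c : Fin 4) : IsSymbol u₀ 0 fun p => ξ p c := by
  have hJ := hg.isOpen_J
  refine Fin.cases ?_ (fun i => ?_) c
  · exact (hk.scri_a.isSymbol hJ hu).congr (by filter_upwards [hξa u₀ hu] with p hp using hp.symm)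
  · exact (((hξs u₀ hu i).mono (by norm_num)).add ((((ScriSmooth.dir i).mul hk.scri_φ).sub
      (hk.scri_η i)).isSymbol hJ hu)).congr (Eventually.of_forall fun p => by ring)

/-- With the Minkowski metric ξ_i = x_i a - P_ij (x_j φ - η_j) = η_i, because P x = 0 and x·η = a.
-/
theorem isSymbol_lower_succ (hu : u₀ ∈ J) (i : Fin 3) :
    IsSymbol u₀ (-1) fun p => lower g ξ i.succ p - η i p := by
  have h := (IsSymbol.sum Finset.univ fun b _ => (hg.isSymbol_pert hu i.succ b).mul
    (hg.isSymbol_killing hk hξa hξs hu b) (e := -1) (by norm_num)).sub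
    (IsSymbol.sum Finset.univ fun k _ => (IsSymbol.proj k i).mul (hξs u₀ hu k) (e := -1)
      (by norm_num))
  refine h.congr ?_
  filter_upwards [hξa u₀ hu, eventually_mem_region hg.isOpen_J hu] with p h0 hp
  have h1 := sum_proj_mul_eq (p := p) (fun k => ξ p k.succ - (dir k p * φ p - η k p)) i
  have h2 := hk.sum_dir_mul_η p hp
  have h3 := sum_dir_sq hp.2
  rw [h1]
  simp only [lower, pert, Fin.sum_univ_succ (n := 3), minkowski_succ_zero, minkowski_succ_succ, h0]
  have h4 := sum_proj_mul_eq (p := p) (fun k => ξ p k.succ) i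
  simp only [sub_mul, neg_mul, Finset.sum_sub_distrib, Finset.sum_neg_distrib, proj_symm i, h4,
    mul_sub]
  have h5 : ∑ k, dir k p * (dir k p * φ p) = φ p := by
    simp only [← mul_assoc, ← Finset.sum_mul, h3, one_mul]
  rw [h2, h5]
  ring

/-- With the Minkowski metric ξ_0 = a + x·(xφ - η) = φ. -/
theorem isSymbol_lower_zero (hu : u₀ ∈ J) :
    IsSymbol u₀ (-1) fun p => lower g ξ 0 p - φ p := by
  have h := (IsSymbol.sum Finset.univ fun b _ => (hg.isSymbol_pert hu 0 b).mul
    (hg.isSymbol_killing hk hξa hξs hu b) (e := -1) (by norm_num)).add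
    (IsSymbol.sum Finset.univ fun k _ => (IsSymbol.dir k).mul (hξs u₀ hu k) (e := -1)
      (by norm_num))
  refine h.congr ?_
  filter_upwards [hξa u₀ hu, eventually_mem_region hg.isOpen_J hu] with p h0 hp
  have h2 := hk.sum_dir_mul_η p hp
  have h3 := sum_dir_sq hp.2
  have h5 : ∑ k, dir k p * (dir k p * φ p) = φ p := by
    simp only [← mul_assoc, ← Finset.sum_mul, h3, one_mul]
  simp only [lower, pert, Fin.sum_univ_succ (n := 3), minkowski_zero_zero, minkowski_zero_succ, h0,
    sub_mul, mul_sub, Finset.sum_sub_distrib, h2, h5]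
  ring

end

include hg in
theorem sum_dir_mul_lower (hp : p ∈ D) (ξ : Pt → Fin 4 → ℝ) :
    ∑ j : Fin 3, dir j p * lower g ξ j.succ p = ξ p 0 := by
  simp only [lower, Finset.mul_sum]
  rw [Finset.sum_comm]
  simp only [← mul_assoc, ← Finset.sum_mul, hg.sum_dir_mul hp]
  simp

include hg hξ hk hξa hξs

/-- The leading part η of ξ_i is a gradient and has no curl, which gains one order over ∂_i ξ_j. -/
theorem isSymbol_twist_succ_succ (hu : u₀ ∈ J) (i j : Fin 3) :
    IsSymbol u₀ (-2) (twist g ξ i.succ j.succ) := by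
  have hl := fun k => hg.isSymbol_lower_succ hk hξa hξs hu k
  have h := (((hl j).pd_succ i (e := -2) (by norm_num)).sub
    ((hl i).pd_succ j (e := -2) (by norm_num))).const_mul (1 / 2)
  refine h.congr ?_
  filter_upwards [hg.eventually_mem hu, eventually_mem_region hg.isOpen_J hu] with p hp hr
  have hd := fun k => differentiableAt_of_smooth (hg.contDiffAt_lower hξ hp k)
  have hη := fun k => (hk.scri_η k).differentiableAt hr
  rw [pd_sub (hd _) (hη _), pd_sub (hd _) (hη _), hk.pd_η_symm hg.isOpen_J hr i j, twist]
  ring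

/-- The leading part η of ξ_j does not depend on u, so ∂_u ξ_j is no larger than the remainder, and
∂_j ξ_0 gains an order. -/
theorem isSymbol_twist_zero_succ (hu : u₀ ∈ J) (j : Fin 3) :
    IsSymbol u₀ (-1) (twist g ξ 0 j.succ) := by
  have hl := hg.isSymbol_lower_succ hk hξa hξs hu j
  have hl0 := hg.isSymbol_lower_zero hk hξa hξs hu
  have h := ((hl.pd_zero).sub (((hl0.pd_succ j (e := -2) (by norm_num)).mono (d' := -1)
    (by norm_num)).add ((hk.scri_φ.isSymbol hg.isOpen_J hu).pd_succ j (e := -1) (by norm_num)))).const_mul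
    (1 / 2)
  refine h.congr ?_
  filter_upwards [hg.eventually_mem hu, eventually_mem_region hg.isOpen_J hu] with p hp hr
  have hd := fun k => differentiableAt_of_smooth (hg.contDiffAt_lower hξ hp k)
  rw [pd_sub (hd _) ((hk.scri_η j).differentiableAt hr), pd_sub (hd _) (hk.scri_φ.differentiableAt hr),
    hk.pd_zero_η p hr, twist]
  ring

/-- The sum of x_j ξ_j is exactly ξ^u = a, which does not depend on u. Only -½ ∂_r ξ_0 remains, and
the leading part φ of ξ_0 has no r-derivative. -/
theorem isSymbol_sum_dir_twist (hu : u₀ ∈ J) :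
    IsSymbol u₀ (-2) fun p => ∑ j : Fin 3, dir j p * twist g ξ 0 j.succ p := by
  have hl0 := hg.isSymbol_lower_zero hk hξa hξs hu
  refine ((hl0.dr (e := -2) (by norm_num)).const_mul (-1 / 2)).congr ?_
  filter_upwards [hg.eventually_mem hu, eventually_mem_region hg.isOpen_J hu,
    pd_congr_nearScri (hξa u₀ hu) 0] with p hp hr h0
  have hd := fun k => differentiableAt_of_smooth (hg.contDiffAt_lower hξ hp k)
  have hx := fun k => differentiableAt_of_smooth (contDiffAt_dir hr.2 k)
  rw [hk.pd_zero_a p hr] at h0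
  have h1 : pd 0 (fun q => ∑ j : Fin 3, dir j q * lower g ξ j.succ q) p = 0 := by
    rw [← h0]
    refine pd_congr ?_ 0
    filter_upwards [hg.isOpen_D.mem_nhds hp] with q hq using hg.sum_dir_mul_lower hq ξ
  rw [pd_sum _ fun j _ => (hx j).fun_mul (hd _)] at h1
  simp only [pd_mul (hx _) (hd _), pd_dir_zero hr.2, zero_mul, zero_add] at h1
  rw [dr_sub (hd 0) (hk.scri_φ.differentiableAt hr), hk.scri_φ.dr_eq_zero hr, sub_zero, dr]
  simp only [twist, mul_left_comm _ (1 / 2 : ℝ), mul_sub, Finset.sum_sub_distrib, ← Finset.mul_sum, h1]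
  ring

/-- Counting orders naively gives only r⁻², from products of two components F_0i. As g^{00} = 0 and
g^{0i} = x^i, these combine to squares of x·F, of order r⁻⁴. -/
theorem isSymbol_covDeriv_sq (hu : u₀ ∈ J) :
    IsSymbol u₀ (-3) fun p => ∑ c, ∑ e, covDeriv g ξ c e p * covDeriv g ξ e c p := by
  have hs := hg.isSymbol_sum_dir_twist hξ hk hξa hξs hu
  have h1 := fun j => hg.isSymbol_twist_zero_succ hξ hk hξa hξs hu j
  have h2 := fun i j => hg.isSymbol_twist_succ_succ hξ hk hξa hξs hu i j
  have hx := fun i => IsSymbol.dir (u₀ := u₀) i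
  have hi := fun a b => hg.isSymbol_inv hu a b
  have hA : ∀ i : Fin 3, IsSymbol u₀ (-2) fun p => ∑ k : Fin 3, dir k p * twist g ξ i.succ k.succ p :=
    fun i => IsSymbol.sum _ fun k _ => (hx k).mul (h2 i k) (by norm_num)
  have hB : ∀ j : Fin 3, IsSymbol u₀ (-1) fun p =>
      ∑ k : Fin 3, (g p)⁻¹ j.succ k.succ * twist g ξ 0 k.succ p :=
    fun j => IsSymbol.sum _ fun k _ => (hi _ _).mul (h1 k) (by norm_num)
  have hG : ∀ i j : Fin 3, IsSymbol u₀ (-2) fun p =>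
      ∑ k : Fin 3, (g p)⁻¹ j.succ k.succ * twist g ξ i.succ k.succ p :=
    fun i j => IsSymbol.sum _ fun k _ => (hi _ _).mul (h2 i k) (by norm_num)
  have t1 := ((hs.mul hs (e := -4) (by norm_num)).const_mul 2).mono (d' := -3) (by norm_num)
  have t2 := (IsSymbol.sum Finset.univ fun j _ => (hB j).mul (hA j) (e := -3) (by norm_num)).const_mul 2
  have t3 := (IsSymbol.sum Finset.univ fun (i : Fin 3) _ => IsSymbol.sum Finset.univ fun (j : Fin 3) _ =>
    (((hx j).mul (h1 i) (e := -1) (by norm_num)).mul (hG j i) (e := -3) (by norm_num))).const_mul (-2)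
  have t4 := (IsSymbol.sum Finset.univ fun i _ => IsSymbol.sum Finset.univ fun j _ =>
    (hG i j).mul (hG j i) (e := -4) (by norm_num)).mono (d' := -3) (by norm_num)
  refine (((t1.add t2).add t3).add t4).congr ?_
  filter_upwards [hg.eventually_mem hu] with p hp
  have b0 : ∀ c, covDeriv g ξ c 0 p = ∑ k : Fin 3, dir k p * twist g ξ c k.succ p := fun c => by
    rw [hg.covDeriv_eq hξ hp, Fin.sum_univ_succ, hg.inv_zero_zero hp, zero_mul, zero_add]
    simp only [hg.inv_zero_succ hp]
  have b1 : ∀ c (j : Fin 3), covDeriv g ξ c j.succ p = dir j p * twist g ξ c 0 p +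
      ∑ k : Fin 3, (g p)⁻¹ j.succ k.succ * twist g ξ c k.succ p := fun c j => by
    rw [hg.covDeriv_eq hξ hp, Fin.sum_univ_succ, hg.inv_succ_zero hp]
  have b2 : twist g ξ 0 0 p = 0 := by simp [twist]
  have b3 : ∀ i : Fin 3, twist g ξ i.succ 0 p = -twist g ξ 0 i.succ p := fun i => twist_antisymm _ _ _
  simp only [Fin.sum_univ_succ (n := 3), b0, b1, b2, b3]
  simp only [mul_zero, zero_add]
  rw [Finset.sum_add_distrib (f := fun i : Fin 3 => (∑ k : Fin 3, dir k p * twist g ξ i.succ k.succ p) * _)]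
  exact sum_sq_aux (fun i => dir i p) (fun i => twist g ξ 0 i.succ p) (fun i =>
    ∑ k : Fin 3, dir k p * twist g ξ i.succ k.succ p) (fun j =>
    ∑ k : Fin 3, (g p)⁻¹ j.succ k.succ * twist g ξ 0 k.succ p) (fun i j =>
    ∑ k : Fin 3, (g p)⁻¹ j.succ k.succ * twist g ξ i.succ k.succ p)

end IsAsymptoticallyFlat
end NullInfinity
end

/-! ### The wave equation for the norm at order r⁻² -/

noncomputable section

namespace NullInfinity

variable {u₀ : ℝ} {J : Set ℝ} {D : Set Pt} {g : MetricField} {p : Pt} {ξ : Pt → Fin 4 → ℝ}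
  {N : Fin 3 → Fin 3 → Pt → ℝ} {a φ : Pt → ℝ} {η : Fin 3 → Pt → ℝ}

/-- This is the logarithmic derivative of the determinant of the Minkowski metric, which is
constant; concretely it reduces to x·∂_j x = 0. -/
theorem sum_minkowskiInv_mul_pd (hp : 0 < radius p) (j : Fin 3) :
    ∑ a, ∑ b, minkowskiInv p a b * pd j.succ (fun q => minkowski q a b) p = 0 := by
  have hd : ∀ i, DifferentiableAt ℝ (dir i) p := fun i =>
    differentiableAt_of_smooth (contDiffAt_dir hp i)
  have h0 : ∑ i, dir i p * pd j.succ (dir i) p = 0 := by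
    have h : pd j.succ (fun q => ∑ i, dir i q * dir i q) p = 0 := by
      rw [pd_congr (G := fun _ => (1 : ℝ)), pd_const]
      filter_upwards [continuous_radius.continuousAt.eventually (lt_mem_nhds hp)] with q hq
        using sum_dir_sq hq
    rw [pd_sum _ fun i _ => (hd i).fun_mul (hd i)] at h
    simp only [pd_mul (hd _) (hd _)] at h
    have h2 : ∑ i, (pd j.succ (dir i) p * dir i p + dir i p * pd j.succ (dir i) p) =
        2 * ∑ i, dir i p * pd j.succ (dir i) p := by
      rw [Finset.mul_sum]
      exact Finset.sum_congr rfl fun _ _ => by ring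
    linarith
  have h1 : ∀ i, pd j.succ (fun q => minkowski q i.succ i.succ) p =
      2 * (dir i p * pd j.succ (dir i) p) := fun i => by
    simp only [minkowski_succ_succ, proj, if_true, neg_sub]
    rw [pd_sub ((hd i).fun_mul (hd i)) (differentiableAt_const _), pd_mul (hd i) (hd i), pd_const]
    ring
  have h2 : ∀ i k : Fin 3, minkowskiInv p i.succ k.succ = if i = k then -1 else 0 := fun _ _ => rfl
  have h3 : ∀ i : Fin 3, minkowskiInv p 0 i.succ = dir i p := fun _ => rfl
  have h4 : ∀ i : Fin 3, minkowskiInv p i.succ 0 = dir i p := fun _ => rfl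
  have h5 : minkowskiInv p 0 0 = 0 := rfl
  simp only [Fin.sum_univ_succ (n := 3), h2, h3, h4, h5, minkowski_zero_succ, minkowski_succ_zero]
  simp only [ite_mul, zero_mul, Finset.sum_ite_eq, Finset.mem_univ, if_true, h1,
    Finset.sum_add_distrib]
  change 0 + ∑ i, dir i p * pd j.succ (dir i) p + (∑ i, dir i p * pd j.succ (dir i) p + _) = 0
  rw [h0]
  simp only [neg_mul, one_mul, Finset.sum_neg_distrib, ← Finset.mul_sum, h0]
  ring

theorem IsKillingData.sum_dir_mul_leadingGrad (hk : IsKillingData J N a φ η)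
    (hp : p ∈ region J) : ∑ i, dir i p * leadingGrad a φ η i p = 0 := by
  have h := hk.scri_leadingNorm.dr_eq_zero hp
  simp only [leadingGrad, mul_left_comm _ (radius p), ← Finset.mul_sum]
  rw [dr] at h
  rw [h, mul_zero]

namespace IsAsymptoticallyFlat

variable (hg : IsAsymptoticallyFlat J D g)
include hg

theorem isSymbol_trChristoffel_zero (hu : u₀ ∈ J) : IsSymbol u₀ (-1) (trChristoffel g 0) :=
  IsSymbol.sum _ fun d _ => hg.isSymbol_christoffel hu d d 0

/-- Γ^d_dj is half the logarithmic derivative of the determinant, and its Minkowski part vanishes.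
The gained order is needed since the spatial gradient of the norm is only O(r⁻¹) up to logarithms.
-/
theorem isSymbol_trChristoffel_succ (hu : u₀ ∈ J) (j : Fin 3) :
    IsSymbol u₀ (-2) (trChristoffel g j.succ) := by
  have h := (((IsSymbol.sum Finset.univ fun a _ => IsSymbol.sum Finset.univ fun b _ =>
    (hg.isSymbol_inv_sub hu a b).mul (hg.isSymbol_pd_metric hu j.succ a b) (e := -2) (by norm_num)).add
    (IsSymbol.sum Finset.univ fun a _ => IsSymbol.sum Finset.univ fun b _ =>
    (isSymbol_minkowskiInv a b).mul ((hg.isSymbol_pert hu a b).pd_succ j (e := -2) (by norm_num))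
    (e := -2) (by norm_num)))).const_mul (1 / 2)
  refine h.congr ?_
  filter_upwards [hg.eventually_mem hu] with p hp
  have hr := hg.radius_pos hp
  have h0 := sum_minkowskiInv_mul_pd hr j
  rw [hg.trChristoffel_eq hp]
  have h1 : ∀ a b, pd j.succ (fun q => g q a b) p =
      pd j.succ (pert g a b) p + pd j.succ (fun q => minkowski q a b) p := fun a b => by
    rw [← pd_add (hg.differentiableAt_pert hp a b)
      (differentiableAt_of_smooth (contDiffAt_minkowski hr a b))]
    simp [pert]
  have h2 : ∑ a, ∑ b, (g p)⁻¹ a b * pd j.succ (fun q => g q a b) p =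
      ∑ a, ∑ b, ((g p)⁻¹ a b - minkowskiInv p a b) * pd j.succ (fun q => g q a b) p +
      ∑ a, ∑ b, minkowskiInv p a b * pd j.succ (pert g a b) p +
      ∑ a, ∑ b, minkowskiInv p a b * pd j.succ (fun q => minkowski q a b) p := by
    simp only [← Finset.sum_add_distrib]
    refine Finset.sum_congr rfl fun a _ => Finset.sum_congr rfl fun b _ => ?_
    rw [h1]; ring
  rw [h2, h0, add_zero]

theorem isSymbol_inv_succ_succ (hu : u₀ ∈ J) (i j : Fin 3) :
    IsSymbol u₀ (-1) fun p => (g p)⁻¹ i.succ j.succ + if i = j then 1 else 0 := by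
  refine (hg.isSymbol_inv_sub hu i.succ j.succ).congr (Eventually.of_forall fun p => ?_)
  have : minkowskiInv p i.succ j.succ = if i = j then -1 else 0 := rfl
  simp only [this]
  split_ifs <;> ring

variable (hξ : IsKilling D g ξ) (hk : IsKillingData J N a φ η)
  (hξa : ∀ u ∈ J, ∀ᶠ p in nearScri u, ξ p 0 = a p)
  (hξs : ∀ u ∈ J, ∀ i : Fin 3, IsSymbol u (-1) fun p => ξ p i.succ - (dir i p * φ p - η i p))

include hk hξa hξs

theorem isSymbol_normSq_sub (hu : u₀ ∈ J) :
    IsSymbol u₀ (-1) fun p => normSq g ξ p - leadingNorm a φ η p := by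
  have hJ := hg.isOpen_J
  have hl := fun k => hg.isSymbol_lower_succ hk hξa hξs hu k
  have hl0 := hg.isSymbol_lower_zero hk hξa hξs hu
  have hs := fun c => hg.isSymbol_killing hk hξa hξs hu c
  have h := (((hs 0).mul hl0 (e := -1) (by norm_num)).add (IsSymbol.sum Finset.univ fun k _ =>
    (hs (Fin.succ k)).mul (hl k) (e := -1) (by norm_num))).add (IsSymbol.sum Finset.univ fun k _ =>
    (hξs u₀ hu k).mul ((hk.scri_η k).isSymbol hJ hu) (e := -1) (by norm_num))
  refine h.congr ?_
  filter_upwards [hξa u₀ hu, eventually_mem_region hJ hu] with p h0 hp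
  have h2 := hk.sum_dir_mul_η p hp
  have h3 : ∑ k, dir k p * φ p * η k p = φ p * a p := by
    rw [← h2, Finset.mul_sum]; exact Finset.sum_congr rfl fun _ _ => by ring
  simp only [normSq, leadingNorm, Fin.sum_univ_succ (n := 3), h0, mul_sub, sub_mul,
    Finset.sum_sub_distrib, h3]
  ring

theorem isSymbol_pd_succ_normSq (hξ : IsKilling D g ξ) (hu : u₀ ∈ J) (j : Fin 3) :
    IsSymbol u₀ (-2) fun p =>
      pd j.succ (normSq g ξ) p - leadingGrad a φ η j p * (radius p)⁻¹ := by
  refine ((hg.isSymbol_normSq_sub hk hξa hξs hu).pd_succ j (e := -2) (by norm_num)).congr ?_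
  filter_upwards [hg.eventually_mem hu, eventually_mem_region hg.isOpen_J hu] with p hp hr
  have hf : ContDiffAt ℝ ∞ (normSq g ξ) p := ContDiffAt.sum fun c _ =>
    (hξ.contDiffAt hg.isOpen_D hp c).mul (hg.contDiffAt_lower hξ hp c)
  rw [pd_sub (differentiableAt_of_smooth hf) (hk.scri_leadingNorm.differentiableAt hr), leadingGrad]
  have := hr.2.ne'
  field_simp

theorem isSymbol_pd_zero_normSq (hξ : IsKilling D g ξ) (hu : u₀ ∈ J) :
    IsSymbol u₀ (-1) (pd 0 (normSq g ξ)) := by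
  refine ((hg.isSymbol_normSq_sub hk hξa hξs hu).pd_zero).congr ?_
  filter_upwards [hg.eventually_mem hu, eventually_mem_region hg.isOpen_J hu] with p hp hr
  have hf : ContDiffAt ℝ ∞ (normSq g ξ) p := ContDiffAt.sum fun c _ =>
    (hξ.contDiffAt hg.isOpen_D hp c).mul (hg.contDiffAt_lower hξ hp c)
  rw [pd_sub (differentiableAt_of_smooth hf) (hk.scri_leadingNorm.differentiableAt hr),
    hk.pd_zero_leadingNorm hr, sub_zero]

include hξ

/-- ξ(f) = 0 solved for a ∂_u f. The part x^k φ of ξ^k drops out because the leading gradient of f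
is tangential. The factor a must stay, as a may have zeros. -/
theorem isSymbol_mul_pd_zero_normSq (hu : u₀ ∈ J) : IsSymbol u₀ (-2) fun p =>
    a p * pd 0 (normSq g ξ) p - (∑ i, η i p * leadingGrad a φ η i p) * (radius p)⁻¹ := by
  have hJ := hg.isOpen_J
  have hs := fun c => hg.isSymbol_killing hk hξa hξs hu c
  have h := ((IsSymbol.sum Finset.univ fun k _ => (hs (Fin.succ k)).mul
    (hg.isSymbol_pd_succ_normSq hk hξa hξs hξ hu k) (e := -2) (by norm_num)).add
    (IsSymbol.sum Finset.univ fun k _ => (hξs u₀ hu k).mul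
    (((hk.scri_leadingGrad hJ k).isSymbol hJ hu).mul IsSymbol.inv_radius (e := -1) (by norm_num))
    (e := -2) (by norm_num))).neg
  refine h.congr ?_
  filter_upwards [hg.eventually_mem hu, hξa u₀ hu, eventually_mem_region hJ hu] with p hp h0 hr
  have h1 := hg.sum_mul_pd_normSq hξ hp
  rw [Fin.sum_univ_succ, h0] at h1
  have h2 := hk.sum_dir_mul_leadingGrad hr
  simp only [Fin.sum_univ_three] at h1 h2 ⊢
  linear_combination (-1) * h1 + φ p * (radius p)⁻¹ * h2

/-- To order r⁻² the wave operator is 2 ∂_r∂_u f + (2/r) ∂_u f - r⁻² Δf₀. With a ∂_u f = E/r +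
O(r⁻²) up to logarithms, the first two terms times a are -2E/r² and 2E/r² and cancel; the source is
O(r⁻³) up to logarithms, so a Δf₀ = 0. -/
theorem leadingGrad_divergence (hp : p ∈ region J) :
    a p * ∑ j : Fin 3, radius p * pd j.succ (leadingGrad a φ η j) p = 0 := by
  have hJ := hg.isOpen_J
  have hu : p 0 ∈ J := hp.1
  have hS : ScriSmooth J fun p => a p * ∑ j : Fin 3, radius p * pd j.succ (leadingGrad a φ η j) p :=
    hk.scri_a.mul (ScriSmooth.sum _ fun j _ => (hk.scri_leadingGrad hJ j).radius_mul_pd hJ j)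
  refine hS.eq_zero_of_hasOrder hu (d := -2) (e := -3) (IsSymbol.hasOrder ?_) (by norm_num) rfl hp.2
  have sa := hk.scri_a.isSymbol hJ hu
  have hE : ScriSmooth J fun p => ∑ i, η i p * leadingGrad a φ η i p :=
    ScriSmooth.sum _ fun i _ => (hk.scri_η i).mul (hk.scri_leadingGrad hJ i)
  have s0 := hg.isSymbol_mul_pd_zero_normSq hξ hk hξa hξs hu
  have f0 := hg.isSymbol_pd_zero_normSq hk hξa hξs hξ hu
  have fj := fun j => hg.isSymbol_pd_succ_normSq hk hξa hξs hξ hu j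
  have fs : ∀ᶠ q in nearScri (p 0), ContDiffAt ℝ ∞ (normSq g ξ) q := by
    filter_upwards [hg.eventually_mem hu] with q hq
    exact ContDiffAt.sum fun c _ => (hξ.contDiffAt hg.isOpen_D hq c).mul (hg.contDiffAt_lower hξ hq c)
  have sκ := fun j => ((hk.scri_leadingGrad hJ j).isSymbol hJ hu).mul
    (IsSymbol.inv_radius (u₀ := p 0)) (e := -1) (by norm_num)
  have fj1 : ∀ j : Fin 3, IsSymbol (p 0) (-1) (pd j.succ (normSq g ξ)) := fun j =>
    (((fj j).mono (by norm_num)).add (sκ j)).congr (Eventually.of_forall fun q => by ring)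
  -- The u-component of the gradient is ∂_r f, and f₀ does not depend on r.
  have V0 : IsSymbol (p 0) (-2) (grad g (normSq g ξ) 0) := by
    refine (IsSymbol.sum Finset.univ fun j _ => (IsSymbol.dir j).mul (fj j) (e := -2)
      (by norm_num)).congr ?_
    filter_upwards [hg.eventually_mem hu, eventually_mem_region hJ hu] with q hq hr
    have h2 := hk.sum_dir_mul_leadingGrad hr
    simp only [grad, hg.inv_zero hq, Fin.sum_univ_succ (n := 3), lVec_zero, lVec_succ, mul_sub,
      Finset.sum_sub_distrib, ← mul_assoc, ← Finset.sum_mul, h2]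
    ring
  have Vj : ∀ j : Fin 3, IsSymbol (p 0) (-2) fun q => grad g (normSq g ξ) j.succ q -
      (dir j q * pd 0 (normSq g ξ) q - leadingGrad a φ η j q * (radius q)⁻¹) := fun j => by
    refine ((IsSymbol.sum Finset.univ fun k _ => (hg.isSymbol_inv_succ_succ hu j k).mul (fj1 k)
      (e := -2) (by norm_num)).sub (fj j)).congr ?_
    filter_upwards [hg.eventually_mem hu] with q hq
    simp only [grad, hg.inv_succ_zero hq, Fin.sum_univ_succ (n := 3) (fun b => (g q)⁻¹ j.succ b * _),
      add_mul, Finset.sum_add_distrib, ite_mul, one_mul, zero_mul, Finset.sum_ite_eq,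
      Finset.mem_univ, if_true]
    ring
  have Vj1 : ∀ j : Fin 3, IsSymbol (p 0) (-1) (grad g (normSq g ξ) j.succ) := fun j =>
    (((Vj j).mono (by norm_num)).add (((IsSymbol.dir j).mul f0 (e := -1) (by norm_num)).sub
      (sκ j))).congr (Eventually.of_forall fun q => by ring)
  -- The relation for a ∂_u f is differentiated along the generators, where a and the coefficient E
  -- are constant.
  have r1 : IsSymbol (p 0) (-3) fun q =>
      dr (fun q => a q * pd 0 (normSq g ξ) q) q
        + (∑ i, η i q * leadingGrad a φ η i q) * ((radius q)⁻¹ * (radius q)⁻¹) := by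
    refine (s0.dr (e := -3) (by norm_num)).congr ?_
    filter_upwards [fs, eventually_mem_region hJ hu] with q hq hr
    have hi := (differentiableAt_radius hr.2).fun_inv hr.2.ne'
    have ha := hk.scri_a.differentiableAt hr
    rw [dr_sub (ha.fun_mul (differentiableAt_of_smooth (contDiffAt_pd hq 0)))
      ((hE.differentiableAt hr).fun_mul hi), dr_mul (hE.differentiableAt hr) hi,
      hE.dr_eq_zero hr, dr_inv_radius hr.2]
    ring
  have r2 := s0.mul IsSymbol.inv_radius (e := -3) (by norm_num)
  -- The divergence of x^j ∂_u f supplies (2/r) ∂_u f + ∂_r∂_u f; the tangential κ_j/r contributes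
  -- only the angular Laplacian.
  have r3 : IsSymbol (p 0) (-3) fun q => ∑ j : Fin 3, (pd j.succ (grad g (normSq g ξ) j.succ) q) -
      (2 * (radius q)⁻¹ * pd 0 (normSq g ξ) q + dr (pd 0 (normSq g ξ)) q
        - (∑ j : Fin 3, pd j.succ (leadingGrad a φ η j) q) * (radius q)⁻¹) := by
    refine (IsSymbol.sum Finset.univ fun j _ => (Vj j).pd_succ j (e := -3) (by norm_num)).congr ?_
    filter_upwards [fs, eventually_mem_region hJ hu, (IsSymbol.sum Finset.univ fun j _ => Vj1 j).smooth,
      (Vj1 0).smooth, (Vj1 1).smooth, (Vj1 2).smooth] with q hq hr _ v0 v1 v2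
    have hi := (differentiableAt_radius hr.2).fun_inv hr.2.ne'
    have hv : ∀ j : Fin 3, DifferentiableAt ℝ (grad g (normSq g ξ) j.succ) q := fun j => by
      fin_cases j
      exacts [differentiableAt_of_smooth v0, differentiableAt_of_smooth v1,
        differentiableAt_of_smooth v2]
    have hx := fun k => differentiableAt_of_smooth (contDiffAt_dir hr.2 k)
    have hf := differentiableAt_of_smooth (contDiffAt_pd hq 0)
    have hκ := fun k => (hk.scri_leadingGrad hJ k).differentiableAt hr
    have e1 : ∀ j : Fin 3, pd j.succ (fun q => grad g (normSq g ξ) j.succ q -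
      (dir j q * pd 0 (normSq g ξ) q - leadingGrad a φ η j q * (radius q)⁻¹)) q =
      pd j.succ (grad g (normSq g ξ) j.succ) q - (proj j j q * (radius q)⁻¹ * pd 0 (normSq g ξ) q +
        dir j q * pd j.succ (pd 0 (normSq g ξ)) q - (pd j.succ (leadingGrad a φ η j) q * (radius q)⁻¹
        - leadingGrad a φ η j q * (dir j q * ((radius q)⁻¹ * (radius q)⁻¹)))) := fun j => by
      rw [pd_sub (hv j) (((hx j).fun_mul hf).fun_sub ((hκ j).fun_mul hi)),
        pd_sub ((hx j).fun_mul hf) ((hκ j).fun_mul hi), pd_mul (hx j) hf, pd_mul (hκ j) hi,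
        pd_dir_succ hr.2, pd_inv (differentiableAt_radius hr.2) hr.2.ne', pd_radius_succ hr.2]
      ring
    simp only [e1]
    have h2 := hk.sum_dir_mul_leadingGrad hr
    have h3 := sum_dir_sq hr.2
    simp only [dr, proj, if_true, Fin.sum_univ_three] at h2 h3 ⊢
    linear_combination (radius q)⁻¹ * pd 0 (normSq g ξ) q * h3 - (radius q)⁻¹ * (radius q)⁻¹ * h2
  have r4 := (hg.isSymbol_covDeriv_sq hξ hk hξa hξs hu).const_mul (-2)
  have r5 := (hg.isSymbol_trChristoffel_zero hu).mul V0 (e := -3) (by norm_num)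
  have r6 := IsSymbol.sum Finset.univ fun (j : Fin 3) _ =>
    (hg.isSymbol_trChristoffel_succ hu j).mul (Vj1 j) (e := -3) (by norm_num)
  have r7 := sa.mul (((r4.sub r5).sub r6).sub r3) (e := -3) (by norm_num)
  refine (((r1.const_mul 2).add (r2.const_mul 2)).sub r7).congr ?_
  filter_upwards [hg.eventually_mem hu, fs, eventually_eventually_nhds fs,
    eventually_mem_region hJ hu] with q hq hf hfn hr
  have hD := hg.divergence_grad_normSq hξ hq
  rw [Finset.sum_add_distrib, Fin.sum_univ_succ (n := 3) (fun c => pd c _ q),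
    Fin.sum_univ_succ (n := 3) (fun c => trChristoffel g c q * _)] at hD
  have e0 : pd 0 (grad g (normSq g ξ) 0) q = dr (pd 0 (normSq g ξ)) q := by
    rw [← pd_zero_dr hr.2 hf]
    refine pd_congr ?_ 0
    filter_upwards [hg.isOpen_D.mem_nhds hq] with q' hq'
    simp only [grad, hg.inv_zero hq', dr_eq_sum_lVec]
  have e1 : dr (fun q => a q * pd 0 (normSq g ξ) q) q = a q * dr (pd 0 (normSq g ξ)) q := by
    rw [dr_mul (hk.scri_a.differentiableAt hr) (differentiableAt_of_smooth (contDiffAt_pd hf 0)),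
      hk.scri_a.dr_eq_zero hr]
    ring
  have hz : radius q ^ (-2 : ℤ) = (radius q)⁻¹ * (radius q)⁻¹ := by
    rw [zpow_neg, zpow_ofNat, pow_two, _root_.mul_inv]
  have hrr : radius q * (radius q)⁻¹ = 1 := mul_inv_cancel₀ hr.2.ne'
  rw [e1, hz, ← Finset.mul_sum]
  rw [e0] at hD
  linear_combination a q * hD - a q * (∑ j : Fin 3, pd j.succ (leadingGrad a φ η j) q) *
    (radius q)⁻¹ * hrr

end IsAsymptoticallyFlat
end NullInfinity
end

noncomputable section

namespace NullInfinity

variable {J : Set ℝ} {p : Pt}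

/-! ### Harmonic functions on the sphere -/

theorem hasDerivAt_line (p v : Pt) (t : ℝ) : HasDerivAt (fun s : ℝ => p + s • v) v t := by
  simpa using ((hasDerivAt_id t).smul_const v).const_add p

/-- A positive second derivative would make the point a local minimum as well, so the function would
be constant nearby and its second derivative zero. -/
theorem pd_pd_nonpos_of_isLocalMax {F : Pt → ℝ} (hF : ∀ᶠ q in 𝓝 p, ContDiffAt ℝ ∞ F q) (b : Fin 4)
    (h : IsLocalMax (fun t : ℝ => F (p + t • Pi.single b 1)) 0) : pd b (pd b F) p ≤ 0 := by
  set ψ : ℝ → ℝ := fun t => F (p + t • Pi.single b 1) with hψ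
  have hcont : ContinuousAt (fun t : ℝ => p + t • (Pi.single b 1 : Pt)) 0 := by fun_prop
  have e0 : p + (0 : ℝ) • (Pi.single b 1 : Pt) = p := by simp
  have hev : ∀ᶠ t : ℝ in 𝓝 0, ContDiffAt ℝ ∞ F (p + t • Pi.single b 1) := by
    exact hcont.eventually (by simpa using hF)
  have hder : ∀ {G : Pt → ℝ} {t : ℝ}, DifferentiableAt ℝ G (p + t • Pi.single b 1) →
      HasDerivAt (fun t : ℝ => G (p + t • Pi.single b 1)) (pd b G (p + t • Pi.single b 1)) t :=
    fun hG => hG.hasFDerivAt.comp_hasDerivAt _ (hasDerivAt_line p _ _)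
  have hd1 : deriv ψ =ᶠ[𝓝 0] fun t => pd b F (p + t • Pi.single b 1) := by
    filter_upwards [hev] with t ht using (hder (differentiableAt_of_smooth ht)).deriv
  have hd2 : deriv (deriv ψ) 0 = pd b (pd b F) p := by
    rw [hd1.deriv_eq, (hder (G := pd b F) (t := 0) _).deriv, e0]
    rw [e0]; exact differentiableAt_of_smooth (contDiffAt_pd hF.self_of_nhds b)
  by_contra hpos
  rw [not_le, ← hd2] at hpos
  have hmin := isLocalMin_of_deriv_deriv_pos hpos h.deriv_eq_zero
    (hder (differentiableAt_of_smooth hev.self_of_nhds)).continuousAt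
  have hconst : ψ =ᶠ[𝓝 0] fun _ => ψ 0 := by
    filter_upwards [h, hmin] with t h1 h2 using le_antisymm h1 h2
  have h3 : deriv ψ =ᶠ[𝓝 0] fun _ => 0 := by
    filter_upwards [hconst.eventuallyEq_nhds] with t ht
    rw [ht.deriv_eq, deriv_const]
  rw [h3.deriv_eq, deriv_const] at hpos
  exact lt_irrefl _ hpos

theorem isCompact_sphere_slice (u : ℝ) : IsCompact {p : Pt | p 0 = u ∧ radius p = 1} := by
  refine Metric.isCompact_of_isClosed_isBounded ?_ ?_
  · exact (isClosed_eq (continuous_apply 0) continuous_const).inter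
      (isClosed_eq continuous_radius continuous_const)
  · refine (Metric.isBounded_iff_subset_closedBall 0).2 ⟨max |u| 1, fun p hp => ?_⟩
    rw [mem_closedBall_zero_iff, pi_norm_le_iff_of_nonneg (by positivity)]
    refine Fin.cases ?_ fun i => ?_
    · rw [hp.1, Real.norm_eq_abs]; exact le_max_left _ _
    · refine le_trans ?_ (le_max_right _ _)
      have h1 := radius_sq p
      rw [hp.2] at h1
      have h2 : p i.succ ^ 2 ≤ ∑ i : Fin 3, p i.succ ^ 2 :=
        Finset.single_le_sum (f := fun i : Fin 3 => p i.succ ^ 2) (fun _ _ => sq_nonneg _)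
          (Finset.mem_univ i)
      rw [Real.norm_eq_abs, ← sq_le_one_iff_abs_le_one]
      linarith

/-- A function on null infinity takes its maximum over the sphere at fixed retarded time. -/
theorem ScriSmooth.exists_max {c : Pt → ℝ} (hc : ScriSmooth J c) {u : ℝ} (hu : u ∈ J) :
    ∃ p ∈ region J, p 0 = u ∧ ∀ q ∈ region J, q 0 = u → c q ≤ c p := by
  have hsub : {p : Pt | p 0 = u ∧ radius p = 1} ⊆ region J := fun p hp =>
    ⟨hp.1 ▸ hu, by rw [hp.2]; exact one_pos⟩
  have hne : {p : Pt | p 0 = u ∧ radius p = 1}.Nonempty := by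
    refine ⟨Fin.cons u ![1, 0, 0], rfl, ?_⟩
    simp [radius, Fin.sum_univ_three]
  obtain ⟨p, hp, hmax⟩ := (isCompact_sphere_slice u).exists_isMaxOn hne (f := c) fun q hq =>
    (hc.contDiffAt q (hsub hq)).continuousAt.continuousWithinAt
  refine ⟨p, hsub hp, hp.1, fun q hq hqu => ?_⟩
  have hr : 0 < (radius q)⁻¹ := inv_pos.2 hq.2
  rw [← hc.dilate q hq _ hr]
  exact hmax ⟨hqu, by rw [radius_dilate hr.le, inv_mul_cancel₀ hq.2.ne']⟩

/-- A harmonic function on the sphere is constant. -/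
theorem gradient_eq_zero_of_harmonic (hJ : IsOpen J) {f : Pt → ℝ} (hf : ScriSmooth J f)
    (h : ∀ p ∈ region J, ∑ j : Fin 3, radius p * pd j.succ (fun q => radius q * pd j.succ f q) p = 0)
    (hp : p ∈ region J) (i : Fin 3) : radius p * pd i.succ f p = 0 := by
  let κ : Fin 3 → Pt → ℝ := fun i q => radius q * pd i.succ f q
  have hκ : ∀ i, ScriSmooth J (κ i) := fun i => hf.radius_mul_pd hJ i
  have hr : ∀ q ∈ region J, DifferentiableAt ℝ radius q := fun q hq => differentiableAt_radius hq.2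
  have hf1 : ∀ q ∈ region J, ∀ a, ContDiffAt ℝ ∞ (pd a f) q := fun q hq a =>
    contDiffAt_pd (hf.contDiffAt q hq) a
  have hf2 : ∀ q ∈ region J, ∀ a b, ContDiffAt ℝ ∞ (pd a (pd b f)) q := fun q hq a b =>
    contDiffAt_pd (hf1 q hq b) a
  have d1 : ∀ q ∈ region J, ∀ i j : Fin 3, pd j.succ (κ i) q =
      dir j q * pd i.succ f q + radius q * pd j.succ (pd i.succ f) q := fun q hq i j => by
    rw [← pd_radius_succ hq.2]
    exact pd_mul (hr q hq) (differentiableAt_of_smooth (hf1 q hq _)) _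
  have hx : ∀ q ∈ region J, ∑ i, dir i q * pd i.succ f q = 0 := fun q hq => hf.dr_eq_zero hq
  have hlap : ∀ q ∈ region J, ∑ j : Fin 3, pd j.succ (pd j.succ f) q = 0 := fun q hq => by
    have h1 := h q hq
    rw [← Finset.mul_sum] at h1
    have h2 := (mul_eq_zero.1 h1).resolve_left hq.2.ne'
    have h3 : ∑ j : Fin 3, pd j.succ (κ j) q = 0 := h2
    simp only [d1 q hq, Finset.sum_add_distrib, hx q hq, zero_add, ← Finset.mul_sum] at h3
    exact (mul_eq_zero.1 h3).resolve_left hq.2.ne'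
  -- Each κ_i = r ∂_i f is again harmonic: the Laplacian of r ∂_i f leaves (2/r) ∂_i f + 2 ∂_r ∂_i
  -- f, which vanishes since ∂_i f has degree -1.
  have hharm : ∀ q ∈ region J, ∀ i, ∑ j : Fin 3, pd j.succ (pd j.succ (κ i)) q = 0 := fun q hq i => by
    have hxd := fun k => differentiableAt_of_smooth (contDiffAt_dir hq.2 k)
    have e1 : ∀ j : Fin 3, pd j.succ (pd j.succ (κ i)) q = proj j j q / radius q * pd i.succ f q +
        2 * (dir j q * pd j.succ (pd i.succ f) q) + radius q * pd i.succ (pd j.succ (pd j.succ f)) q :=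
      fun j => by
        rw [pd_congr (G := fun q => dir j q * pd i.succ f q + radius q * pd j.succ (pd i.succ f) q)]
        · have k1 := differentiableAt_of_smooth (hf1 q hq i.succ)
          have k2 := differentiableAt_of_smooth (hf2 q hq j.succ i.succ)
          rw [pd_add ((hxd j).fun_mul k1) ((hr q hq).fun_mul k2), pd_mul (hxd j) k1,
            pd_mul (hr q hq) k2, pd_dir_succ hq.2, pd_radius_succ hq.2]
          have k3 : pd j.succ (pd j.succ (pd i.succ f)) q = pd i.succ (pd j.succ (pd j.succ f)) q := by
            refine Eq.trans (pd_congr ?_ _) (pd_comm (hf1 q hq j.succ) j.succ i.succ)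
            filter_upwards [eventually_mem_region_nhds hJ hq] with q' hq'
              using pd_comm (hf.contDiffAt q' hq') _ _
          rw [k3]; ring
        · filter_upwards [eventually_mem_region_nhds hJ hq] with q' hq' using d1 q' hq' i j
    have e2 : ∑ j : Fin 3, pd i.succ (pd j.succ (pd j.succ f)) q = 0 := by
      rw [← pd_sum _ fun j _ => differentiableAt_of_smooth (hf2 q hq _ _),
        pd_congr (G := fun _ => (0 : ℝ)), pd_const]
      filter_upwards [eventually_mem_region_nhds hJ hq] with q' hq' using hlap q' hq'
    have e3 : pd i.succ f q + radius q * dr (pd i.succ f) q = 0 := by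
      have k := (hκ i).dr_eq_zero hq
      have k2 : dr (κ i) q = dr radius q * pd i.succ f q + radius q * dr (pd i.succ f) q :=
        dr_mul (hr q hq) (differentiableAt_of_smooth (hf1 q hq _))
      rw [k2, dr_radius hq.2, one_mul] at k
      exact k
    have e4 : ∑ j, proj j j q = 2 := by
      have := sum_dir_sq hq.2
      simp only [proj, if_true, Fin.sum_univ_three] at this ⊢
      linarith
    simp only [e1, Finset.sum_add_distrib, ← Finset.mul_sum, e2, ← Finset.sum_mul, ← Finset.sum_div, e4]
    rw [← dr]
    have hr0 := hq.2.ne'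
    field_simp
    linear_combination 2 * e3
  -- Maximum principle for |κ|²: its Laplacian is 2 |∂κ|², since κ is harmonic. By homogeneity the
  -- maximum over the sphere is one over all y at fixed u, so ∂κ = 0 there.
  let M : Pt → ℝ := fun q => ∑ i, κ i q * κ i q
  have hM : ScriSmooth J M := ScriSmooth.sum _ fun i _ => (hκ i).mul (hκ i)
  obtain ⟨p₀, hp₀, hu, hmax⟩ := hM.exists_max hp.1
  have hM2 : ∀ j : Fin 3, pd j.succ (pd j.succ M) p₀ =
      2 * ∑ i, (pd j.succ (κ i) p₀ * pd j.succ (κ i) p₀ + κ i p₀ * pd j.succ (pd j.succ (κ i)) p₀) :=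
    fun j => by
      have k1 := fun q (hq : q ∈ region J) i => (hκ i).differentiableAt hq
      have k2 := fun i => differentiableAt_of_smooth (contDiffAt_pd ((hκ i).contDiffAt p₀ hp₀) j.succ)
      rw [pd_congr (G := fun q => 2 * ∑ i, κ i q * pd j.succ (κ i) q)]
      · rw [pd_const_mul (DifferentiableAt.fun_sum fun i _ => (k1 p₀ hp₀ i).fun_mul (k2 i)),
          pd_sum _ fun i _ => (k1 p₀ hp₀ i).fun_mul (k2 i)]
        simp only [pd_mul (k1 p₀ hp₀ _) (k2 _)]
      · filter_upwards [eventually_mem_region_nhds hJ hp₀] with q hq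
        have k3 : pd j.succ M q = ∑ i, pd j.succ (fun q => κ i q * κ i q) q :=
          pd_sum _ (fun i _ => (k1 q hq i).fun_mul (k1 q hq i)) _
        rw [k3, Finset.mul_sum]
        refine Finset.sum_congr rfl fun i _ => ?_
        rw [pd_mul (k1 q hq i) (k1 q hq i)]; ring
  have hneg : ∀ j : Fin 3, pd j.succ (pd j.succ M) p₀ ≤ 0 := fun j => by
    refine pd_pd_nonpos_of_isLocalMax ?_ _ ?_
    · filter_upwards [eventually_mem_region_nhds hJ hp₀] with q hq using hM.contDiffAt q hq
    have hcont : ContinuousAt (fun t : ℝ => p₀ + t • (Pi.single j.succ 1 : Pt)) 0 := by fun_prop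
    have hev : ∀ᶠ t : ℝ in 𝓝 0, p₀ + t • (Pi.single j.succ 1 : Pt) ∈ region J :=
      hcont.eventually (by simpa using eventually_mem_region_nhds hJ hp₀)
    filter_upwards [hev] with t ht
    simp only [zero_smul, add_zero]
    refine hmax _ ht ?_
    simp [hu, (Fin.succ_ne_zero j).symm]
  have hzero : ∀ i j : Fin 3, pd j.succ (κ i) p₀ = 0 := by
    have k1 : ∑ j : Fin 3, ∑ i, pd j.succ (κ i) p₀ * pd j.succ (κ i) p₀ ≤ 0 := by
      have k2 : ∑ j : Fin 3, ∑ i, κ i p₀ * pd j.succ (pd j.succ (κ i)) p₀ = 0 := by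
        rw [Finset.sum_comm]
        simp only [← Finset.mul_sum, hharm p₀ hp₀, mul_zero, Finset.sum_const_zero]
      have k3 := Finset.sum_nonpos fun (j : Fin 3) (_ : j ∈ Finset.univ) => hneg j
      simp only [hM2, ← Finset.mul_sum, Finset.sum_add_distrib, k2] at k3
      linarith
    intro i j
    have k4 := (Finset.sum_eq_zero_iff_of_nonneg fun j _ => Finset.sum_nonneg fun i _ =>
      mul_self_nonneg _).1 (le_antisymm k1 (Finset.sum_nonneg fun j _ => Finset.sum_nonneg fun i _ =>
      mul_self_nonneg _)) j (Finset.mem_univ j)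
    exact mul_self_eq_zero.1 ((Finset.sum_eq_zero_iff_of_nonneg fun i _ => mul_self_nonneg _).1 k4 i
      (Finset.mem_univ i))
  have hκx : ∀ q ∈ region J, ∑ i, dir i q * κ i q = 0 := fun q hq => by
    simp only [κ, mul_left_comm _ (radius q), ← Finset.mul_sum, hx q hq, mul_zero]
  -- Differentiating x·κ = 0 at a point with ∂κ = 0 leaves the tangential part of κ, which is κ
  -- itself. So the maximum of |κ|² is zero.
  have hκ0 : ∀ j, κ j p₀ = 0 := fun j => by
    have k1 : pd j.succ (fun q => ∑ i, dir i q * κ i q) p₀ = 0 := by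
      rw [pd_congr (G := fun _ => (0 : ℝ)), pd_const]
      filter_upwards [eventually_mem_region_nhds hJ hp₀] with q hq using hκx q hq
    have hxd := fun k => differentiableAt_of_smooth (contDiffAt_dir hp₀.2 k)
    rw [pd_sum _ fun i _ => (hxd i).fun_mul ((hκ i).differentiableAt hp₀)] at k1
    simp only [pd_mul (hxd _) ((hκ _).differentiableAt hp₀), hzero, mul_zero, add_zero,
      pd_dir_succ hp₀.2, div_mul_eq_mul_div, ← Finset.sum_div] at k1
    simp only [proj_symm j] at k1
    rw [sum_proj_mul_eq (fun i => κ i p₀), hκx p₀ hp₀, mul_zero, sub_zero] at k1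
    exact (div_eq_zero_iff.1 k1).resolve_right hp₀.2.ne'
  have hMp : M p ≤ 0 := by
    refine (hmax p hp rfl).trans (le_of_eq ?_)
    simp only [M, hκ0, mul_zero, Finset.sum_const_zero]
  exact mul_self_eq_zero.1 ((Finset.sum_eq_zero_iff_of_nonneg fun i _ => mul_self_nonneg (κ i p)).1
    (le_antisymm hMp (Finset.sum_nonneg fun i _ => mul_self_nonneg _)) i (Finset.mem_univ i))

end NullInfinity
end

noncomputable section

namespace NullInfinity

variable {J : Set ℝ} {p q : Pt}

/-! ### Linear systems on the sphere -/

/-- For orthogonal y-parts, r² on the segment is (1-t)² r(p)² + t² r(q)², so the segment avoids r =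
0. -/
theorem mem_region_of_segment {t : ℝ} (hp : p ∈ region J) (hq : q ∈ region J) (hu : q 0 = p 0)
    (ho : ∑ i : Fin 3, p i.succ * q i.succ = 0) : p + t • (q - p) ∈ region J := by
  have h0 : (p + t • (q - p)) 0 = p 0 := by simp [hu]
  refine ⟨h0 ▸ hp.1, ?_⟩
  have h1 : radius (p + t • (q - p)) ^ 2 = (1 - t) ^ 2 * radius p ^ 2 + t ^ 2 * radius q ^ 2 := by
    simp only [radius_sq, Fin.sum_univ_three] at ho ⊢
    simp only [Pi.add_apply, Pi.smul_apply, Pi.sub_apply, smul_eq_mul]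
    linear_combination 2 * t * (1 - t) * ho
  have h2 : 0 < radius (p + t • (q - p)) ^ 2 := by
    rw [h1]
    rcases eq_or_ne t 0 with rfl | ht
    · simpa using pow_pos hp.2 2
    · have := mul_pos (pow_pos (abs_pos.2 ht) 2) (pow_pos hq.2 2)
      rw [sq_abs] at this
      positivity
  exact (radius_nonneg _).lt_of_ne fun h => by rw [← h] at h2; simp at h2

/-- The matrix with rows p, q and zero has a nontrivial kernel. -/
theorem exists_orthogonal (p q : Pt) : ∃ w : Pt, w 0 = p 0 ∧ 0 < radius w ∧
    ∑ i : Fin 3, p i.succ * w i.succ = 0 ∧ ∑ i : Fin 3, q i.succ * w i.succ = 0 := by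
  obtain ⟨v, hv, h⟩ := Matrix.exists_mulVec_eq_zero_iff.2
    (Matrix.det_eq_zero_of_row_eq_zero (A := Matrix.of ![fun i : Fin 3 => p i.succ, fun i => q i.succ, 0])
      2 fun j => by simp)
  refine ⟨Fin.cons (p 0) v, rfl, ?_, ?_, ?_⟩
  · refine Real.sqrt_pos.2 ?_
    obtain ⟨i, hi⟩ := Function.ne_iff.1 hv
    exact Finset.sum_pos' (fun _ _ => sq_nonneg _) ⟨i, Finset.mem_univ i, by
      simpa [sq_pos_iff] using hi⟩
  · simpa [Matrix.mulVec, dotProduct] using congrFun h 0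
  · simpa [Matrix.mulVec, dotProduct] using congrFun h 1

section system

variable {ι : Type*} [Fintype ι] {y : ι → Pt → ℝ} {B : Fin 3 → ι → ι → Pt → ℝ}
  (hy : ∀ α, ScriSmooth J (y α)) (hB : ∀ i α β, ScriSmooth J (B i α β))
  (h : ∀ p ∈ region J, ∀ i α, radius p * pd i.succ (y α) p = ∑ β, B i α β p * y β p)
include hy hB h

/-- Restricted to the segment from p to q the system is a linear ordinary differential equation with
bounded coefficients, and Grönwall's inequality applies. -/
theorem linear_system_eq_zero_of_orthogonal (hp : p ∈ region J) (hq : q ∈ region J) (hu : q 0 = p 0)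
    (ho : ∑ i : Fin 3, p i.succ * q i.succ = 0) (h0 : ∀ α, y α p = 0) (α : ι) : y α q = 0 := by
  let γ : ℝ → Pt := fun t => p + t • (q - p)
  have hγ : ∀ t, γ t ∈ region J := fun t => mem_region_of_segment hp hq hu ho
  have hγc : Continuous γ := by fun_prop
  let v : Fin 3 → ℝ := fun i => q i.succ - p i.succ
  let f : ℝ → ι → ℝ := fun t α => y α (γ t)
  let f' : ℝ → ι → ℝ := fun t α => ∑ i, v i * ((radius (γ t))⁻¹ * ∑ β, B i α β (γ t) * y β (γ t))
  have hf : ∀ t, HasDerivAt f (f' t) t := fun t => by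
    refine hasDerivAt_pi.2 fun α => ?_
    have h1 := ((hy α).differentiableAt (hγ t)).hasFDerivAt.comp_hasDerivAt t
      (hasDerivAt_line p (q - p) t)
    refine h1.congr_deriv ?_
    have h2 : q - p = ∑ b, (q - p) b • (Pi.single b 1 : Pt) := pi_eq_sum_univ' _
    rw [h2, map_sum, Fin.sum_univ_succ]
    simp only [map_smul, smul_eq_mul, Pi.sub_apply, hu, sub_self, zero_mul, zero_add]
    refine Finset.sum_congr rfl fun i _ => ?_
    rw [← h (γ t) (hγ t), inv_mul_cancel_left₀ (hγ t).2.ne']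
    rfl
  let G : ℝ → ℝ := fun t => ∑ α, ∑ i, ∑ β, |v i| * ((radius (γ t))⁻¹ * |B i α β (γ t)|)
  have hG : Continuous G := by
    refine continuous_finsetSum _ fun α _ => continuous_finsetSum _ fun i _ =>
      continuous_finsetSum _ fun β _ => continuous_const.mul (Continuous.mul ?_ (Continuous.abs ?_))
    · exact (continuous_radius.comp hγc).inv₀ fun t => (hγ t).2.ne'
    · exact continuous_iff_continuousAt.2 fun t =>
        ContinuousAt.comp (f := γ) ((hB i α β).contDiffAt _ (hγ t)).continuousAt hγc.continuousAt
  obtain ⟨K, hK⟩ := (isCompact_Icc (a := (0 : ℝ)) (b := 1)).bddAbove_image hG.continuousOn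
  have hbound : ∀ t ∈ Set.Ico (0 : ℝ) 1, ‖f' t‖ ≤ K * ‖f t‖ := fun t ht => by
    have hK' : G t ≤ K := hK ⟨t, Set.Ico_subset_Icc_self ht, rfl⟩
    have hr := inv_pos.2 (hγ t).2
    refine le_trans ?_ (mul_le_mul_of_nonneg_right hK' (norm_nonneg _))
    refine (pi_norm_le_iff_of_nonneg (mul_nonneg (by positivity) (norm_nonneg _))).2 fun α => ?_
    have e1 : ‖f' t α‖ ≤ (∑ i, ∑ β, |v i| * ((radius (γ t))⁻¹ * |B i α β (γ t)|)) * ‖f t‖ := by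
      simp only [f', Finset.sum_mul, Finset.mul_sum]
      refine norm_sum_le_of_le _ fun i _ => norm_sum_le_of_le _ fun β _ => ?_
      rw [norm_mul, norm_mul, norm_mul, Real.norm_of_nonneg hr.le, mul_assoc, mul_assoc]
      exact mul_le_mul_of_nonneg_left (mul_le_mul_of_nonneg_left (mul_le_mul_of_nonneg_left
        (norm_le_pi_norm (f t) β) (abs_nonneg _)) hr.le) (abs_nonneg _)
    refine e1.trans (mul_le_mul_of_nonneg_right ?_ (norm_nonneg _))
    exact Finset.single_le_sum (f := fun α => ∑ i, ∑ β, |v i| * ((radius (γ t))⁻¹ * |B i α β (γ t)|))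
      (fun _ _ => by positivity) (Finset.mem_univ α)
  have h1 := eq_zero_of_abs_deriv_le_mul_abs_self_of_eq_zero_right (a := 0) (b := 1)
    (fun t _ => (hf t).continuousAt.continuousWithinAt) (fun t _ => (hf t).hasDerivWithinAt)
    (by ext α; simpa [f, γ] using h0 α) hbound 1 (by simp)
  simpa [f, γ] using congrFun h1 α

/-- A solution of a linear differential system over the sphere that vanishes at a point vanishes
identically. -/
theorem linear_system_eq_zero (hp : p ∈ region J) (hq : q ∈ region J) (hu : q 0 = p 0)
    (h0 : ∀ α, y α p = 0) (α : ι) : y α q = 0 := by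
  -- A detour over a common normal w: the direct segment could meet r = 0 when p and q are opposite.
  obtain ⟨w, hw, hwr, hpw, hqw⟩ := exists_orthogonal p q
  have hwm : w ∈ region J := ⟨hw ▸ hp.1, hwr⟩
  refine linear_system_eq_zero_of_orthogonal hy hB h hwm hq (hu.trans hw.symm)
    (by simpa only [mul_comm] using hqw)
    (linear_system_eq_zero_of_orthogonal hy hB h hp hwm hw hpw h0) α

end system

/-- `N` is a smooth symmetric trace-free tensor field on the sphere. -/
structure IsTraceFree (J : Set ℝ) (N : Fin 3 → Fin 3 → Pt → ℝ) : Prop where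
  scri : ∀ i j, ScriSmooth J (N i j)
  symm : ∀ p ∈ region J, ∀ i j, N i j p = N j i p
  sum_dir_mul : ∀ p ∈ region J, ∀ i, ∑ j, dir j p * N j i p = 0
  trace : ∀ p ∈ region J, ∑ i, N i i p = 0

/-! ### Integrability of the leading Killing equation -/

namespace IsKillingData

variable {N : Fin 3 → Fin 3 → Pt → ℝ} {a φ : Pt → ℝ} {η : Fin 3 → Pt → ℝ}
  (hJ : IsOpen J) (hk : IsKillingData J N a φ η) (hN : IsTraceFree J N)
include hk

theorem radius_mul_pd_a (hp : p ∈ region J) (i : Fin 3) :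
    radius p * pd i.succ a p = η i p - dir i p * a p := by
  linarith [hk.η_eq p hp i]

include hN

theorem sum_pd_η (hp : p ∈ region J) : ∑ j, radius p * pd j.succ (η j) p = 2 * φ p := by
  have h1 := hN.trace p hp
  have h2 := sum_dir_sq hp.2
  simp only [hk.pd_η p hp, proj, if_true, Fin.sum_univ_three] at h1 h2 ⊢
  linear_combination (-1 / 2) * a p * h1 - φ p * h2

include hJ

/-- Integrability: the divergence over j of r ∂_iη_j = φ P_ij - ½ a N_ij is compared with ∂_i of the
trace ∑ r ∂_jη_j = 2φ, using ∂_i∂_j = ∂_j∂_i. -/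
theorem pd_φ (hp : p ∈ region J) (i : Fin 3) : radius p * pd i.succ φ p =
    -(1 / 2) * ∑ j, N i j p * η j p - (1 / 2) * a p * ∑ j, radius p * pd j.succ (N i j) p := by
  have hr := hp.2
  have hη1 : ∀ j b, ContDiffAt ℝ ∞ (pd b (η j)) p := fun j b =>
    contDiffAt_pd ((hk.scri_η j).contDiffAt p hp) b
  have hη1d := fun j b => differentiableAt_of_smooth (hη1 j b)
  have hφ := hk.scri_φ.differentiableAt hp
  have ha := hk.scri_a.differentiableAt hp
  have hNd := fun i j => (hN.scri i j).differentiableAt hp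
  have hP : ∀ j, DifferentiableAt ℝ (proj i j) p := fun j =>
    (ScriSmooth.proj (J := J) i j).differentiableAt hp
  have hrd := differentiableAt_radius hr
  have e1 : ∀ j : Fin 3, pd j.succ (fun q => radius q * pd i.succ (η j) q) p =
      pd j.succ (fun q => φ q * proj i j q - (1 / 2) * a q * N i j q) p := fun j => by
    refine pd_congr ?_ _
    filter_upwards [eventually_mem_region_nhds hJ hp] with q hq using hk.pd_η q hq i j
  have e2 : pd i.succ (fun q => ∑ j, radius q * pd j.succ (η j) q) p =
      pd i.succ (fun q => 2 * φ q) p := by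
    refine pd_congr ?_ _
    filter_upwards [eventually_mem_region_nhds hJ hp] with q hq using hk.sum_pd_η hN hq
  rw [pd_sum _ fun j _ => hrd.fun_mul (hη1d j _), pd_const_mul hφ] at e2
  simp only [pd_mul hrd (hη1d _ _), pd_radius_succ hr] at e2
  have e3 : ∀ j : Fin 3, pd j.succ (fun q => φ q * proj i j q - (1 / 2) * a q * N i j q) p =
      pd j.succ φ p * proj i j p + φ p * pd j.succ (proj i j) p
        - (1 / 2) * (pd j.succ a p * N i j p + a p * pd j.succ (N i j) p) := fun j => by
    rw [pd_sub (hφ.fun_mul (hP j)) ((ha.const_mul _).fun_mul (hNd i j)), pd_mul hφ (hP j),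
      pd_mul (ha.const_mul _) (hNd i j), pd_const_mul ha]
    ring
  simp only [pd_mul hrd (hη1d _ _), pd_radius_succ hr, e3] at e1
  have e4 : ∀ j : Fin 3, pd i.succ (pd j.succ (η j)) p = pd j.succ (pd i.succ (η j)) p := fun j =>
    pd_comm ((hk.scri_η j).contDiffAt p hp) _ _
  have e5 : ∑ j, dir j p * pd i.succ (η j) p = 0 := by
    simp only [hk.pd_η_symm hJ hp i]
    exact (hk.scri_η i).dr_eq_zero hp
  have k1 : ∑ j, pd j.succ φ p * proj i j p = pd i.succ φ p := by
    have h1 := sum_proj_mul_eq (p := p) (fun j => pd j.succ φ p) i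
    have h2 : ∑ j, dir j p * pd j.succ φ p = 0 := hk.scri_φ.dr_eq_zero hp
    rw [h2, mul_zero, sub_zero] at h1
    simpa only [proj_symm i, mul_comm] using h1
  have k2 : radius p * ∑ j, pd j.succ (proj i j) p = -2 * dir i p := by
    have h1 := sum_dir_sq hr
    simp only [pd_proj hr, Fin.sum_univ_three, proj, if_true] at h1 ⊢
    have hr0 := hr.ne'
    fin_cases i <;> simp at h1 ⊢ <;> field_simp
    · linear_combination 2 * dir 0 p * h1
    · linear_combination 2 * dir 1 p * h1
    · linear_combination 2 * dir 2 p * h1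
  have k3 : ∑ j, radius p * pd j.succ a p * N i j p = ∑ j, N i j p * η j p := by
    have h1 := hN.sum_dir_mul p hp i
    simp only [hk.radius_mul_pd_a hp, hN.symm p hp i, Fin.sum_univ_three] at h1 ⊢
    linear_combination (-a p) * h1
  have e6 := hk.sum_pd_η hN hp
  have e7 := Finset.sum_congr (rfl : Finset.univ = Finset.univ) fun (j : Fin 3) _ => e1 j
  simp only [e4] at e2
  simp only [Fin.sum_univ_three] at *
  linear_combination (-radius p) * e2 + radius p * e7 + dir i p * e6 - radius p * e5 + radius p * k1
    + φ p * k2 - (1 / 2) * k3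

/-- The gradient of the leading coefficient of `g(ξ, ξ)` is a divergence of the news tensor. -/
theorem leadingGrad_eq (hp : p ∈ region J) (i : Fin 3) : leadingGrad a φ η i p =
    -(a p * (a p * ∑ j, radius p * pd j.succ (N i j) p)) := by
  have h1 := hk.pd_φ hJ hN hp i
  have h2 := hk.radius_mul_pd_a hp i
  have h3 := hk.pd_η p hp i
  have h4 := sum_proj_mul_eq (p := p) (fun j => η j p) i
  rw [hk.sum_dir_mul_η p hp] at h4
  rw [leadingGrad, hk.pd_leadingNorm hp]
  simp only [Fin.sum_univ_three, proj_symm i] at *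
  linear_combination 2 * φ p * h2 + 2 * a p * h1 - 2 * η 0 p * h3 0 - 2 * η 1 p * h3 1
    - 2 * η 2 p * h3 2 - 2 * φ p * h4

/-- The zeros of the leading coefficient `a` have no interior. -/
theorem eq_zero_of_mul_eq_zero {F : Pt → ℝ} (hF : ScriSmooth J F)
    (h : ∀ p ∈ region J, a p * F p = 0) (hp : p ∈ region J) : F p = 0 := by
  by_contra hne
  have ha : ∀ᶠ q in 𝓝 p, a q = 0 := by
    filter_upwards [(hF.contDiffAt p hp).continuousAt.eventually_ne hne,
      eventually_mem_region_nhds hJ hp] with q hq hqm using (mul_eq_zero.1 (h q hqm)).resolve_right hq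
  have hη : ∀ᶠ q in 𝓝 p, ∀ i, η i q = 0 := by
    filter_upwards [ha.eventually_nhds, eventually_mem_region_nhds hJ hp] with q hq hqm i
    rw [hk.η_eq q hqm, hq.self_of_nhds, pd_congr (G := fun _ => (0 : ℝ)) hq, pd_const]
    ring
  have hφ : φ p = 0 := by
    have h1 := hk.sum_pd_η hN hp
    have h2 : ∀ j : Fin 3, pd j.succ (η j) p = 0 := fun j => by
      rw [pd_congr (G := fun _ => (0 : ℝ)), pd_const]
      filter_upwards [hη] with q hq using hq j
    simp only [h2, mul_zero, Finset.sum_const_zero] at h1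
    linarith
  obtain ⟨q, hq, hqu, hqa⟩ := hk.nonzero _ hp.1
  -- On an open set where a = 0 also η and φ vanish. The formulas for the gradients of η, a and φ
  -- form a closed linear system in these five functions (`true` marks a, `false` marks φ), so a
  -- would vanish on the whole sphere at this u, against `nonzero`.
  let y : Fin 3 ⊕ Bool → Pt → ℝ := Sum.elim η fun b => if b then a else φ
  let B : Fin 3 → Fin 3 ⊕ Bool → Fin 3 ⊕ Bool → Pt → ℝ := fun i α => match α with
    | .inl j => Sum.elim (fun _ _ => 0) fun b p => if b then -(1 / 2) * N i j p else proj i j p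
    | .inr true => Sum.elim (fun k _ => if i = k then 1 else 0)
        fun b p => if b then -1 * dir i p else 0
    | .inr false => Sum.elim (fun k p => -(1 / 2) * N i k p)
        fun b p => if b then -(1 / 2) * ∑ j, radius p * pd j.succ (N i j) p else 0
  refine hqa (linear_system_eq_zero (y := y) (B := B) ?_ ?_ ?_ hp hq hqu ?_ (.inr true))
  · rintro (i | _ | _)
    exacts [hk.scri_η i, hk.scri_φ, hk.scri_a]
  · have c := fun x => ScriSmooth.const (J := J) x
    rintro i (j | _ | _) (k | _ | _)
    · exact c 0
    · exact ScriSmooth.proj i j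
    · exact (c _).mul (hN.scri i j)
    · exact (c _).mul (hN.scri i k)
    · exact c 0
    · exact (c _).mul (ScriSmooth.sum _ fun j _ => (hN.scri i j).radius_mul_pd hJ j)
    · exact c _
    · exact c 0
    · exact (c _).mul (ScriSmooth.dir i)
  · rintro p hp i (j | _ | _)
    · simp [y, B, hk.pd_η p hp]; ring
    · have := hk.pd_φ hJ hN hp i
      simp [y, B, this, Fin.sum_univ_three]
      ring
    · simp [y, B, hk.radius_mul_pd_a hp]; ring
  · rintro (i | _ | _)
    exacts [hη.self_of_nhds i, hφ, ha.self_of_nhds]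

end IsKillingData
end NullInfinity
end

noncomputable section

namespace NullInfinity

variable {J : Set ℝ} {D : Set Pt} {g : MetricField} {ξ : Pt → Fin 4 → ℝ} {p : Pt}
  {N : Fin 3 → Fin 3 → Pt → ℝ}

/-! ### Vanishing of the news tensor -/

/-- The antisymmetric pair is dual to a vector, and its transversality makes that vector parallel to
x: W_kij = ε_kil x_l s_j. Transversality in j gives x·s = 0, the trace gives x × s = 0, hence s = 0.
-/
theorem eq_zero_of_antisymm_of_trace {x : Fin 3 → ℝ} {W : Fin 3 → Fin 3 → Fin 3 → ℝ}
    (hx : ∑ i, x i * x i = 1) (ha : ∀ k i j, W k i j = -W i k j)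
    (h1 : ∀ i j, ∑ k, x k * W k i j = 0) (h3 : ∀ k i, ∑ j, x j * W k i j = 0)
    (ht : ∀ k, ∑ i, W k i i = 0) (k i j : Fin 3) : W k i j = 0 := by
  have hd : ∀ i j, W i i j = 0 := fun i j => by linarith [ha i i j]
  simp only [Fin.sum_univ_three] at hx h1 h3 ht
  have a1 : ∀ j, W 2 1 j = -W 1 2 j := ha 2 1
  have a2 : ∀ j, W 0 2 j = -W 2 0 j := ha 0 2
  have a3 : ∀ j, W 1 0 j = -W 0 1 j := ha 1 0
  have b0 : ∀ j, x 2 * W 2 0 j - x 1 * W 0 1 j = 0 := fun j => by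
    linear_combination h1 0 j - x 0 * hd 0 j - x 1 * a3 j
  have b1 : ∀ j, x 0 * W 0 1 j - x 2 * W 1 2 j = 0 := fun j => by
    linear_combination h1 1 j - x 1 * hd 1 j - x 2 * a1 j
  have b2 : ∀ j, x 1 * W 1 2 j - x 0 * W 2 0 j = 0 := fun j => by
    linear_combination h1 2 j - x 2 * hd 2 j - x 0 * a2 j
  obtain ⟨s, hs⟩ : ∃ s : Fin 3 → ℝ, ∀ j, s j = x 0 * W 1 2 j + x 1 * W 2 0 j + x 2 * W 0 1 j :=
    ⟨_, fun _ => rfl⟩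
  have c0 : ∀ j, W 1 2 j = x 0 * s j := fun j => by
    rw [hs]; linear_combination -W 1 2 j * hx + x 1 * b2 j - x 2 * b1 j
  have c1 : ∀ j, W 2 0 j = x 1 * s j := fun j => by
    rw [hs]; linear_combination -W 2 0 j * hx - x 0 * b2 j + x 2 * b0 j
  have c2 : ∀ j, W 0 1 j = x 2 * s j := fun j => by
    rw [hs]; linear_combination -W 0 1 j * hx + x 0 * b1 j - x 1 * b0 j
  have t0 := ht 0
  have t1 := ht 1
  have t2 := ht 2
  have d0 := h3 1 2
  have d1 := h3 2 0
  have d2 := h3 0 1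
  simp only [hd, a1, a2, a3, c0, c1, c2] at t0 t1 t2 d0 d1 d2
  have hq : x 0 * s 0 + x 1 * s 1 + x 2 * s 2 = 0 := by
    linear_combination x 0 * d0 + x 1 * d1 + x 2 * d2 - (x 0 * s 0 + x 1 * s 1 + x 2 * s 2) * hx
  have hs0 : s 0 = 0 := by linear_combination -s 0 * hx + x 0 * hq + x 1 * t2 - x 2 * t1
  have hs1 : s 1 = 0 := by linear_combination -s 1 * hx + x 1 * hq - x 0 * t2 + x 2 * t0
  have hs2 : s 2 = 0 := by linear_combination -s 2 * hx + x 2 * hq + x 0 * t1 - x 1 * t0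
  have hs : ∀ j, s j = 0 := fun j => by fin_cases j <;> assumption
  simp only [hs, mul_zero] at c0 c1 c2
  fin_cases k <;> fin_cases i <;> simp [hd, a1, a2, a3, c0, c1, c2]

namespace IsTraceFree

variable (hJ : IsOpen J) (hN : IsTraceFree J N)
include hJ hN

theorem pd_symm (hp : p ∈ region J) (b : Fin 4) (i j : Fin 3) : pd b (N i j) p = pd b (N j i) p :=
  pd_congr (by
    filter_upwards [eventually_mem_region_nhds hJ hp] with q hq using hN.symm q hq i j) b

/-- Transversality differentiated: the derivative of x_j returns N itself. -/
theorem sum_dir_mul_pd (hp : p ∈ region J) (k i : Fin 3) :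
    ∑ j, dir j p * (radius p * pd k.succ (N j i) p) = -N k i p := by
  have h1 : pd k.succ (fun q => ∑ j, dir j q * N j i q) p = 0 := by
    rw [pd_congr (G := fun _ => (0 : ℝ)), pd_const]
    filter_upwards [eventually_mem_region_nhds hJ hp] with q hq using hN.sum_dir_mul q hq i
  have hx := fun k => differentiableAt_of_smooth (contDiffAt_dir hp.2 k)
  have hd := fun i j => (hN.scri i j).differentiableAt hp
  rw [pd_sum _ fun j _ => (hx j).fun_mul (hd j i)] at h1
  simp only [pd_mul (hx _) (hd _ _), pd_dir_succ hp.2] at h1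
  have h2 := sum_proj_mul_eq (p := p) (fun j => N j i p) k
  rw [hN.sum_dir_mul p hp] at h2
  have hr := hp.2.ne'
  simp only [Fin.sum_univ_three, proj_symm k] at h1 h2 ⊢
  field_simp at h1
  linear_combination h1 - h2

theorem pd_trace (hp : p ∈ region J) (b : Fin 4) : ∑ i, pd b (N i i) p = 0 := by
  rw [← pd_sum _ fun i _ => (hN.scri i i).differentiableAt hp, pd_congr (G := fun _ => (0 : ℝ)),
    pd_const]
  filter_upwards [eventually_mem_region_nhds hJ hp] with q hq using hN.trace q hq

variable (hdiv : ∀ p ∈ region J, ∀ i, ∑ j, radius p * pd j.succ (N i j) p = 0)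
include hdiv

/-- In two dimensions the exterior derivative of a symmetric trace-free tensor is dual to its
divergence. -/
theorem pd_exchange (hp : p ∈ region J) (k i j : Fin 3) : radius p * pd k.succ (N i j) p =
    radius p * pd i.succ (N k j) p + (dir k p * N i j p - dir i p * N k j p) := by
  have hs := hN.symm p hp
  have hx := hN.sum_dir_mul p hp
  have hx' : ∀ i, ∑ j, dir j p * N i j p = 0 := fun i =>
    (Finset.sum_congr rfl fun j _ => by rw [hs i j]).trans (hx i)
  have h2 := sum_dir_sq hp.2
  have hb := fun k i => hN.sum_dir_mul_pd hJ hp k i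
  have hb' : ∀ k i, ∑ j, dir j p * (radius p * pd k.succ (N i j) p) = -N k i p := fun k i =>
    (Finset.sum_congr rfl fun j _ => by rw [hN.pd_symm hJ hp _ i j]).trans (hb k i)
  have hd : ∀ i j, ∑ k, dir k p * (radius p * pd k.succ (N i j) p) = 0 := fun i j => by
    have : ∑ k, dir k p * pd k.succ (N i j) p = 0 := (hN.scri i j).dr_eq_zero hp
    simp only [mul_left_comm _ (radius p), ← Finset.mul_sum, this, mul_zero]
  -- The tensor `W` is the tangential part of the exterior derivative of N; the corrections with x
  -- make it transversal in all indices, and its trace is the divergence.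
  have h := eq_zero_of_antisymm_of_trace (x := fun i => dir i p) (W := fun k i j =>
    radius p * pd k.succ (N i j) p - radius p * pd i.succ (N k j) p
      - (dir k p * N i j p - dir i p * N k j p)) h2 (fun _ _ _ => by ring) ?_ ?_ ?_ k i j
  · linarith
  · intro i j
    have e1 := hd i j
    have e2 := hb i j
    have e3 := hx j
    simp only [Fin.sum_univ_three] at *
    linear_combination e1 - e2 - N i j p * h2 + dir i p * e3
  · intro k i
    have e1 := hb' k i
    have e2 := hb' i k
    have e3 := hx' i
    have e4 := hx' k
    simp only [Fin.sum_univ_three] at e1 e2 e3 e4 ⊢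
    linear_combination e1 - e2 - dir k p * e3 + dir i p * e4 + hs i k
  · intro k
    have e1 := hN.pd_trace hJ hp k.succ
    have e2 := hdiv p hp k
    have e3 := hN.trace p hp
    have e4 := hx' k
    simp only [Fin.sum_univ_three] at e1 e2 e3 e4 ⊢
    linear_combination radius p * e1 - e2 - dir k p * e3 + e4

/-- A symmetric trace-free tensor field on the sphere without divergence vanishes. -/
theorem eq_zero (hp : p ∈ region J) (i j : Fin 3) : N i j p = 0 := by
  -- Each Cartesian component of N is harmonic on the sphere: after exchanging ∂_k and ∂_i by
  -- `pd_exchange`, the second derivatives form a derivative of the divergence, and the remaining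
  -- terms cancel.
  have key : ∀ (p : Pt), p ∈ region J → ∀ i j, ∑ k : Fin 3, radius p *
      pd k.succ (fun q => radius q * pd k.succ (N i j) q) p = 0 := fun p hp i j => by
    have hr := hp.2
    have hrd := differentiableAt_radius hr
    have hx := fun k => differentiableAt_of_smooth (contDiffAt_dir hp.2 k)
    have hd := fun i j => (hN.scri i j).differentiableAt hp
    have hdd := fun i j b => differentiableAt_of_smooth (contDiffAt_pd ((hN.scri i j).contDiffAt p hp) b)
    have e1 : ∀ k : Fin 3, pd k.succ (fun q => radius q * pd k.succ (N i j) q) p =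
        dir k p * pd i.succ (N k j) p + radius p * pd i.succ (pd k.succ (N k j)) p
        + (proj k k p / radius p * N i j p + dir k p * pd k.succ (N i j) p
        - (proj i k p / radius p * N k j p + dir i p * pd k.succ (N k j) p)) := fun k => by
      rw [pd_congr (G := fun p => radius p * pd i.succ (N k j) p +
        (dir k p * N i j p - dir i p * N k j p)), pd_add (hrd.fun_mul (hdd _ _ _))
          (((hx k).fun_mul (hd i j)).fun_sub ((hx i).fun_mul (hd k j))),
        pd_sub ((hx k).fun_mul (hd i j)) ((hx i).fun_mul (hd k j)), pd_mul hrd (hdd _ _ _),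
        pd_mul (hx k) (hd i j), pd_mul (hx i) (hd k j), pd_radius_succ hr, pd_dir_succ hr,
        pd_dir_succ hr, pd_comm ((hN.scri k j).contDiffAt p hp) k.succ i.succ, proj_symm k i]
      filter_upwards [eventually_mem_region_nhds hJ hp] with q hq
        using hN.pd_exchange hJ hdiv hq k i j
    have hdiv' : ∀ q ∈ region J, ∑ k : Fin 3, pd k.succ (N k j) q = 0 := fun q hq => by
      have h1 := hdiv q hq j
      rw [← Finset.mul_sum] at h1
      simpa only [hN.pd_symm hJ hq _ j] using (mul_eq_zero.1 h1).resolve_left hq.2.ne'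
    have e2 : ∑ k : Fin 3, pd i.succ (pd k.succ (N k j)) p = 0 := by
      rw [← pd_sum _ fun k _ => hdd k j k.succ, pd_congr (G := fun _ => (0 : ℝ)), pd_const]
      filter_upwards [eventually_mem_region_nhds hJ hp] with q hq using hdiv' q hq
    have e3 := hN.sum_dir_mul_pd hJ hp i j
    have e4 : ∑ k, dir k p * pd k.succ (N i j) p = 0 := (hN.scri i j).dr_eq_zero hp
    have e5 := sum_proj_mul_eq (p := p) (fun k => N k j p) i
    rw [hN.sum_dir_mul p hp, mul_zero, sub_zero] at e5
    have e6 := hdiv' p hp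
    have e7 := sum_dir_sq hr
    have hr0 := hr.ne'
    simp only [proj_symm i] at e5 e1
    simp only [e1, Fin.sum_univ_three] at *
    have e8 : proj 0 0 p + proj 1 1 p + proj 2 2 p = 2 := by
      simp only [proj, if_true]; linarith
    field_simp
    linear_combination e3 + radius p ^ 2 * e2 + N i j p * e8 + radius p * e4 - e5
      - radius p * dir i p * e6
  have h0 : ∀ k i j : Fin 3, radius p * pd k.succ (N i j) p = 0 := fun k i j =>
    gradient_eq_zero_of_harmonic hJ (hN.scri i j) (fun p hp => key p hp i j) hp k
  -- The components are thus constant, and a transversal tensor with constant components is zero.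
  have h1 := hN.sum_dir_mul_pd hJ hp i j
  simp only [h0, mul_zero, Finset.sum_const_zero] at h1
  linarith

end IsTraceFree

/-- A supertranslational Killing field forces the news tensor to vanish. -/
theorem IsAsymptoticallyFlat.news_eq_zero (hg : IsAsymptoticallyFlat J D g) (hξ : IsKilling D g ξ)
    (hS : IsSupertranslational J ξ) {C : Fin 3 → Fin 3 → Pt → ℝ} (hC : ∀ i j, ScriSmooth J (C i j))
    (hCh : ∀ u ∈ J, ∀ i j : Fin 3, IsSymbol u (-2)
      fun p => pert g i.succ j.succ p - C i j p * (radius p)⁻¹)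
    (hCa : ∀ p ∈ region J, (∀ i j, C i j p = C j i p) ∧ (∀ i, ∑ j, dir j p * C j i p = 0) ∧
      ∑ i, C i i p = 0) (hp : p ∈ region J) (i j : Fin 3) : pd 0 (C i j) p = 0 := by
  have hJ := hg.isOpen_J
  obtain ⟨a, φ, η, hk, hξa, hξs⟩ := hg.exists_killingData hξ hS hC hCh fun p hp => (hCa p hp).2.2
  have hN : IsTraceFree J fun i j => pd 0 (C i j) := by
    refine ⟨fun i j => (hC i j).pd_zero hJ, fun p hp i j => pd_congr ?_ _, fun p hp i => ?_,
      fun p hp => ?_⟩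
    · filter_upwards [eventually_mem_region_nhds hJ hp] with q hq using (hCa q hq).1 i j
    · have h1 : pd 0 (fun q => ∑ j, dir j q * C j i q) p = 0 := by
        rw [pd_congr (G := fun _ => (0 : ℝ)), pd_const]
        filter_upwards [eventually_mem_region_nhds hJ hp] with q hq using (hCa q hq).2.1 i
      have hx := fun k => differentiableAt_of_smooth (contDiffAt_dir hp.2 k)
      have hd := fun i j => (hC i j).differentiableAt hp
      rw [pd_sum _ fun j _ => (hx j).fun_mul (hd j i)] at h1
      simpa only [pd_mul (hx _) (hd _ _), pd_dir_zero hp.2, zero_mul, zero_add] using h1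
    · rw [← pd_sum _ fun i _ => (hC i i).differentiableAt hp, pd_congr (G := fun _ => (0 : ℝ)),
        pd_const]
      filter_upwards [eventually_mem_region_nhds hJ hp] with q hq using (hCa q hq).2.2
  have h1 : ∀ p ∈ region J, ∑ j : Fin 3, radius p * pd j.succ (leadingGrad a φ η j) p = 0 :=
    fun p hp => hk.eq_zero_of_mul_eq_zero hJ hN
      (ScriSmooth.sum _ fun j _ => (hk.scri_leadingGrad hJ j).radius_mul_pd hJ j)
      (fun q hq => hg.leadingGrad_divergence hξ hk hξa hξs hq) hp
  have h2 : ∀ p ∈ region J, ∀ i, leadingGrad a φ η i p = 0 := fun p hp i =>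
    gradient_eq_zero_of_harmonic hJ hk.scri_leadingNorm h1 hp i
  have hs : ∀ i, ScriSmooth J fun p => ∑ j : Fin 3, radius p * pd j.succ (pd 0 (C i j)) p := fun i =>
    ScriSmooth.sum _ fun j _ => (hN.scri i j).radius_mul_pd hJ j
  refine hN.eq_zero hJ (fun p hp i => ?_) hp i j
  -- The gradient of f₀ is -a² div N and vanishes; the two factors a are removed one after the
  -- other.
  refine hk.eq_zero_of_mul_eq_zero hJ hN (hs i) (fun p hp => ?_) hp
  refine hk.eq_zero_of_mul_eq_zero hJ hN (hk.scri_a.mul (hs i)) (fun p hp => ?_) hp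
  have h3 := hk.leadingGrad_eq hJ hN hp i
  rw [h2 p hp] at h3
  exact neg_eq_zero.1 h3.symm

end NullInfinity
end

noncomputable section

namespace NullInfinity

variable {J : Set ℝ} {D : Set Pt} {g : MetricField} {u : ℝ}

/-! ### The shear along the generators -/

theorem pt_mem_region (hu : u ∈ J) {r : ℝ} (hr : 0 < r) (x : S2) : pt u r x ∈ region J :=
  ⟨hu, by rwa [radius_pt hr.le]⟩

theorem ScriSmooth.hasDerivAt_pt {c : Pt → ℝ} (hc : ScriSmooth J c) (hu : u ∈ J) (x : S2) :
    HasDerivAt (fun s => c (pt s 1 x)) (NullInfinity.pd 0 c (pt u 1 x)) u := by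
  have h1 : HasDerivAt (fun s => pt s 1 x) (Pi.single 0 1) u := by
    rw [hasDerivAt_pi]
    refine Fin.cases ?_ fun i => ?_
    · simpa using hasDerivAt_id' u
    · simpa [Fin.succ_ne_zero] using hasDerivAt_const u (1 * x.1 i)
  exact (hc.differentiableAt (pt_mem_region hu one_pos x)).hasFDerivAt.comp_hasDerivAt u h1

variable (hg : IsAsymptoticallyFlat J D g)
include hg

/-- C is constant along the generators, so ∂_r (C/r) = -C/r². -/
theorem IsAsymptoticallyFlat.tendsto_dr_pert {C : Fin 3 → Fin 3 → Pt → ℝ}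
    (hC : ∀ i j, ScriSmooth J (C i j))
    (hCh : ∀ u ∈ J, ∀ i j : Fin 3, IsSymbol u (-2)
      fun p => pert g i.succ j.succ p - C i j p * (radius p)⁻¹) (hu : u ∈ J) (x : S2) (i j : Fin 3) :
    Tendsto (fun r => r ^ 2 * dr (pert g i.succ j.succ) (pt u r x)) atTop (𝓝 (-C i j (pt u 1 x))) := by
  have h1 := (((IsSymbol.zpow (u₀ := u) 2).mul ((hCh u hu i j).dr (e := -3) (by norm_num)) (e := -1)
    (by norm_num)).hasOrder.tendsto_zero_along le_rfl (tendsto_pt u x)).sub_const (C i j (pt u 1 x))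
  rw [zero_sub] at h1
  refine h1.congr' ?_
  filter_upwards [(tendsto_pt u x).eventually (hg.eventually_mem hu), eventually_gt_atTop 0]
    with r hr hr0
  have hm := pt_mem_region hu hr0 x
  have hc := (hC i j).differentiableAt hm
  have hi := (differentiableAt_radius hm.2).fun_inv hm.2.ne'
  have hd := (hC i j).dilate _ (pt_mem_region hu one_pos x) r hr0
  rw [dilate_pt, mul_one] at hd
  rw [dr_sub (hg.differentiableAt_pert hr _ _) (hc.fun_mul hi), dr_mul hc hi, dr_inv_radius hm.2,
    (hC i j).dr_eq_zero hm, hd, radius_pt hr0.le]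
  field_simp
  ring

/-- The limit of `shear_eq`. As μ does not depend on u, the retarded time enters the leading shear
through C alone. -/
theorem IsAsymptoticallyFlat.isLeadingShear {C : Fin 3 → Fin 3 → Pt → ℝ}
    (hC : ∀ i j, ScriSmooth J (C i j))
    (hCh : ∀ u ∈ J, ∀ i j : Fin 3, IsSymbol u (-2)
      fun p => pert g i.succ j.succ p - C i j p * (radius p)⁻¹)
    {W : Set S2} {m : Pt → Fin 4 → ℂ} {μ : S2 → Fin 4 → ℂ} (hm : IsTetradFrame J g W m μ) :
    IsLeadingShear J g W m fun u x =>
      (1 / 2) * ∑ i : Fin 3, ∑ j : Fin 3, (-C i j (pt u 1 x) : ℂ) * μ x i.succ * μ x j.succ := by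
  intro u hu x hx
  obtain ⟨hleg, hlim⟩ := hm u hu x hx
  have hμ := fun i => (tendsto_pi_nhds.1 hlim) i
  have h := (tendsto_finsetSum Finset.univ fun (i : Fin 3) _ =>
    tendsto_finsetSum Finset.univ fun (j : Fin 3) _ =>
    (((Complex.continuous_ofReal.tendsto _).comp (hg.tendsto_dr_pert hC hCh hu x i j)).mul
      (hμ i.succ)).mul (hμ j.succ)).const_mul (1 / 2 : ℂ)
  simp only [Complex.ofReal_neg] at h
  refine h.congr' ?_
  filter_upwards [(tendsto_pt u x).eventually (hg.eventually_mem hu), hleg] with r hr hl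
  rw [hg.shear_eq hr hl, mul_left_comm, Finset.mul_sum]
  simp only [Finset.mul_sum, Function.comp_apply, Complex.ofReal_mul, Complex.ofReal_pow, mul_assoc]

end NullInfinity
end
-- The main theorem
theorem mainTheorem2 (J : Set ℝ) (D : Set NullInfinity.Pt) (g : NullInfinity.MetricField)
    (hg : NullInfinity.IsAsymptoticallyFlat J D g)
    (hξ : ∃ ξ : NullInfinity.Pt → Fin 4 → ℝ,
      NullInfinity.IsKilling D g ξ ∧ NullInfinity.IsSupertranslational J ξ) :
    NullInfinity.IsNonRadiative J g := by
  obtain ⟨ξ, hK, hS⟩ := hξ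
  obtain ⟨C, hC, hCh, hCa⟩ := hg.exists_shearTensor
  refine fun W m μ hm => ⟨_, hg.isLeadingShear hC hCh hm, fun u hu x _ => ?_⟩
  have h1 : ∀ i j : Fin 3, HasDerivAt (fun s => C i j (NullInfinity.pt s 1 x)) 0 u := fun i j => by
    have h := (hC i j).hasDerivAt_pt hu x
    rwa [hg.news_eq_zero hK hS hC hCh hCa (NullInfinity.pt_mem_region hu one_pos x)] at h
  have h2 := (HasDerivAt.fun_sum fun (i : Fin 3) (_ : i ∈ Finset.univ) =>
    HasDerivAt.fun_sum fun (j : Fin 3) (_ : j ∈ Finset.univ) =>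
    ((h1 i j).ofReal_comp.fun_neg.mul_const (μ x i.succ)).mul_const (μ x j.succ)).const_mul (1 / 2 : ℂ)
  simpa using h2
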